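/- Let $S\subseteq\mathbb R$ be an open set of times. For $t\in S$ let $z(t,\cdot)$ be a $2\pi$-periodic, regular, counterclockwise parametrization of a simple closed curve bounding the domain $\Omega(t)\subset\mathbb C$, with $z$ jointly $C^3$ in $(t,\alpha)$, $|\Omega(t)|=\pi$ and $0\in\Omega(t)$. Let $$Hf(\alpha)=\frac{\mathrm{p.v.}}{\pi i}\int_0^{2\pi}\frac{f(\beta)\,z_\beta(\beta)}{z(\beta)-z(\alpha)}\,d\beta,\qquad \overline H f=\overline{H\overline f},$$ and suppose that, with a real-valued function $a(t,\alpha)$, $$z_{tt}+iaz_\alpha=-\nabla\phi(z),\qquad \nabla\phi(x)=\iint_{\Omega(t)}\frac{x-y}{|x-y|^2}\,dy,\qquad H\overline z_t=\overline z_t$$ (the boundary formulation of the incompressible, irrotational Euler–Poisson system). Put $\varepsilon=|z|^2-1$, $\delta=(I-H)\varepsilon$, $[f,T]g=f\,Tg-T(fg)$, and $E(f)=E_1(f)+E_2(f)+E_3(f)$, where, with $Y=\varepsilon/z$, $$E_1(f)=-\frac{\mathrm{p.v.}}{\pi i}\int_0^{2\pi}\frac{f(\beta)\,(Y(\alpha)-Y(\beta))\,(z(\alpha)z(\beta))^2}{(z(\alpha)-z(\beta))^2}\,\partial_\beta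 Y(\beta)\,d\beta,$$ $$E_2(f)=-\frac{\mathrm{p.v.}}{\pi i}\int_0^{2\pi}\frac{f(\beta)\,(Y(\beta)-Y(\alpha))^2(z(\alpha)z(\beta))^2}{(z(\beta)-z(\alpha))\,|z(\beta)-z(\alpha)|^2}\,\partial_\beta Y(\beta)\,d\beta,$$ and $E_3(f)$ is $E_2(f)$ with the factor $\partial_\beta Y(\beta)$ replaced by $\partial_\beta(1/z(\beta))$. Let $$J_1=\int_0^{2\pi}\frac{(z_t(\alpha)-z_t(\beta))\,\partial_\beta(z_t(\beta)\overline z(\beta))\,\overline z(\alpha)\overline z(\beta)\Big(\frac{\varepsilon(\alpha)}{\overline z(\alpha)}-\frac{\varepsilon(\beta)}{\overline z(\beta)}\Big)}{|z(\beta)-z(\alpha)|^2}\,d\beta,\qquad J_2=\int_0^{2\pi}\Big(\frac{z_t(\beta)-z_t(\alpha)}{z(\beta)-z(\alpha)}\Big)^2\varepsilon_\beta(\beta)\,d\beta.$$ Then $\delta$ is $C^2$ and $E(z),E(\varepsilon)$ are $C^1$ in $(t,\alpha)$ on $S\times\mathbb R$; at each time in $S$ the principal values defining $Hf,\overline Hf,E_1(f),E_2(f),E_3(f)$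 exist for all $2\pi$-periodic $C^1$ functions $f$, and the integrals $J_1,J_2$ converge absolutely; and on $S\times\mathbb R$ $$(\partial_t^2+ia\partial_\alpha-\pi)\delta=\mathcal N_1:=-\frac\pi2[E(z),H]\frac{\varepsilon_\alpha}{z_\alpha}+\frac\pi2(I-H)E(\varepsilon)-2\Big[z_t,H\frac1{z_\alpha}+\overline H\frac1{\overline z_\alpha}\Big]\partial_\alpha(z_t\overline z)-\frac1{\pi i}J_2,$$ where $$\Big[z_t,H\frac1{z_\alpha}+\overline H\frac1{\overline z_\alpha}\Big]\partial_\alpha(z_t\overline z)=-\frac1{\pi i}J_1 .$$ If moreover $z$ is jointly $C^4$ in $(t,\alpha)$, then on $S\times\mathbb R$ the function $\delta$ is $C^3$, $a$ is $C^1$, $E(z),E(\varepsilon)$ are $C^2$, $J_1,J_2$ are differentiable in $t$, and $$\begin{aligned}(\partial_t^2+ia\partial_\alpha-\pi)\delta_t=\mathcal N_2:=&-ia_t\partial_\alpha\delta+\frac\pi2\Big((I-H)\partial_tE(\varepsilon)-[z_t,H]\frac{\partial_\alpha E(\varepsilon)}{z_\alpha}\Big)\\&-\frac\pi2\Big([\partial_tE(z),H]\frac{\varepsilon_\alpha}{z_\alpha}+[E(z),H]\partial_t\Big(\frac{\varepsilon_\alpha}{z_\alpha}\Big)+E(z)[z_t,H]\frac{\partial_\alpha(\varepsilon_\alpha/z_\alpha)}{z_\alpha}-[z_t,H]\frac{\partial_\alpha\big(E(z)\varepsilon_\alpha/z_\alpha\big)}{z_\alpha}\Big)\\&+\frac2{\pi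 i}\partial_tJ_1-\frac1{\pi i}\partial_tJ_2.\end{aligned}$$ -/

import Mathlib

open MeasureTheory Filter Topology Set

noncomputable section

namespace EulerPoisson

/-! Complex-valued functions of time and Lagrangian parameter are written `u t α`. -/

/-- The time derivative `∂_t u`. -/
def dt (u : ℝ → ℝ → ℂ) : ℝ → ℝ → ℂ := fun t α => deriv (fun s => u s α) t

/-- The derivative `∂_α u` in the Lagrangian parameter. -/
def da (u : ℝ → ℝ → ℂ) : ℝ → ℝ → ℂ := fun t α => deriv (u t) α

/-- The pointwise complex conjugate of `u`. -/
def bar (u : ℝ → ℝ → ℂ) : ℝ → ℝ → ℂ := fun t α => (starRingEnd ℂ) (u t α)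

/-! ### Principal values -/

/-- The integral of a `2π`-periodic function over one period centred at `α`, with the
interval `(α - r, α + r)` removed. -/
def truncatedIntegral (F : ℝ → ℂ) (α r : ℝ) : ℂ :=
  (∫ β in (α - Real.pi)..(α - r), F β) + ∫ β in (α + r)..(α + Real.pi), F β

/-- The principal value (over one period) of `F`, which may be singular at `α`. -/
def pv (F : ℝ → ℂ) (α : ℝ) : ℂ := limUnder (𝓝[>] (0 : ℝ)) (truncatedIntegral F α)

/-- The principal value of `F` at `α` is a genuine limit of genuine integrals. -/
def PVExists (F : ℝ → ℂ) (α : ℝ) : Prop :=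
  (∀ r : ℝ, 0 < r → r < Real.pi →
    IntervalIntegrable F volume (α - Real.pi) (α - r) ∧
    IntervalIntegrable F volume (α + r) (α + Real.pi)) ∧
  ∃ L : ℂ, Tendsto (truncatedIntegral F α) (𝓝[>] (0 : ℝ)) (𝓝 L)

/-! ### The Hilbert transform of the curve `z t` -/

def hilbertKernel (z f : ℝ → ℝ → ℂ) (t α β : ℝ) : ℂ :=
  f t β / (z t β - z t α) * da z t β

def hilbertBarKernel (z f : ℝ → ℝ → ℂ) (t α β : ℝ) : ℂ :=
  f t β / (bar z t β - bar z t α) * da (bar z) t β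

/-- `H f = (1 / π i) p.v. ∫ f(β) z_β(β) / (z(β) - z(α)) dβ`. -/
def H (z f : ℝ → ℝ → ℂ) : ℝ → ℝ → ℂ := fun t α =>
  1 / (Real.pi * Complex.I) * pv (hilbertKernel z f t α) α

/-- The conjugate transform `f ↦ conj (H (conj f))`, that is
`- (1 / π i) p.v. ∫ f(β) conj(z)_β(β) / (conj(z(β)) - conj(z(α))) dβ`. -/
def Hbar (z f : ℝ → ℝ → ℂ) : ℝ → ℝ → ℂ := fun t α =>
  -(1 / (Real.pi * Complex.I)) * pv (hilbertBarKernel z f t α) α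

/-- The operator `g ↦ H (g / z_α) + Hbar (g / conj(z)_α)`. -/
def Hsum (z g : ℝ → ℝ → ℂ) : ℝ → ℝ → ℂ :=
  H z (g / da z) + Hbar z (g / da (bar z))

/-- The commutator `[f, T] g = f T(g) - T(f g)` of multiplication by `f` with `T`. -/
def comm (f : ℝ → ℝ → ℂ) (T : (ℝ → ℝ → ℂ) → (ℝ → ℝ → ℂ)) (g : ℝ → ℝ → ℂ) : ℝ → ℝ → ℂ :=
  f * T g - T (f * g)

/-! ### The small quantities and the quadratic error operator `E` -/

/-- `ε = |z|² - 1`. -/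
def eps (z : ℝ → ℝ → ℂ) : ℝ → ℝ → ℂ := fun t α => ((‖z t α‖ ^ 2 - 1 : ℝ) : ℂ)

/-- `δ = (I - H) ε`. -/
def delta (z : ℝ → ℝ → ℂ) : ℝ → ℝ → ℂ := eps z - H z (eps z)

def E1Kernel (z f : ℝ → ℝ → ℂ) (t α β : ℝ) : ℂ :=
  f t β * (eps z t α / z t α - eps z t β / z t β) * (z t α * z t β) ^ 2
    / (z t α - z t β) ^ 2 * da (eps z / z) t β

def E2Kernel (z f : ℝ → ℝ → ℂ) (t α β : ℝ) : ℂ :=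
  f t β * (eps z t β / z t β - eps z t α / z t α) ^ 2 * (z t α * z t β) ^ 2
    / ((z t β - z t α) * ((‖z t β - z t α‖ ^ 2 : ℝ) : ℂ)) * da (eps z / z) t β

def E3Kernel (z f : ℝ → ℝ → ℂ) (t α β : ℝ) : ℂ :=
  f t β * (eps z t β / z t β - eps z t α / z t α) ^ 2 * (z t α * z t β) ^ 2
    / ((z t β - z t α) * ((‖z t β - z t α‖ ^ 2 : ℝ) : ℂ)) * da z⁻¹ t β

/-- `E(f) = E₁(f) + E₂(f) + E₃(f)`. -/
def E (z f : ℝ → ℝ → ℂ) : ℝ → ℝ → ℂ := fun t α =>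
  -(1 / (Real.pi * Complex.I)) * pv (E1Kernel z f t α) α
  - 1 / (Real.pi * Complex.I) * pv (E2Kernel z f t α) α
  - 1 / (Real.pi * Complex.I) * pv (E3Kernel z f t α) α

/-! ### The two absolutely convergent integrals in the nonlinearities -/

def J1Integrand (z : ℝ → ℝ → ℂ) (t α β : ℝ) : ℂ :=
  (dt z t α - dt z t β) * da (dt z * bar z) t β * bar z t α * bar z t β
    * (eps z t α / bar z t α - eps z t β / bar z t β) / ((‖z t β - z t α‖ ^ 2 : ℝ) : ℂ)

def J1 (z : ℝ → ℝ → ℂ) : ℝ → ℝ → ℂ := fun t α =>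
  ∫ β in (0 : ℝ)..(2 * Real.pi), J1Integrand z t α β

def J2Integrand (z : ℝ → ℝ → ℂ) (t α β : ℝ) : ℂ :=
  ((dt z t β - dt z t α) / (z t β - z t α)) ^ 2 * da (eps z) t β

def J2 (z : ℝ → ℝ → ℂ) : ℝ → ℝ → ℂ := fun t α =>
  ∫ β in (0 : ℝ)..(2 * Real.pi), J2Integrand z t α β

/-! ### The nonlinearities -/

/-- The right-hand side of the equation for `δ`. -/
def N1 (z : ℝ → ℝ → ℂ) : ℝ → ℝ → ℂ := fun t α =>
  -(Real.pi / 2) * comm (E z z) (H z) (da (eps z) / da z) t α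
  + Real.pi / 2 * (E z (eps z) - H z (E z (eps z))) t α
  - 2 * comm (dt z) (Hsum z) (da (dt z * bar z)) t α
  - 1 / (Real.pi * Complex.I) * J2 z t α

/-- The right-hand side of the equation for `∂_t δ`. -/
def N2 (z : ℝ → ℝ → ℂ) (a : ℝ → ℝ → ℝ) : ℝ → ℝ → ℂ := fun t α =>
  -Complex.I * dt (fun s γ => (a s γ : ℂ)) t α * da (delta z) t α
  + Real.pi / 2 *
      ((dt (E z (eps z)) - H z (dt (E z (eps z)))) t α
        - comm (dt z) (H z) (da (E z (eps z)) / da z) t α)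
  - Real.pi / 2 *
      (comm (dt (E z z)) (H z) (da (eps z) / da z) t α
        + comm (E z z) (H z) (dt (da (eps z) / da z)) t α
        + E z z t α * comm (dt z) (H z) (da (da (eps z) / da z) / da z) t α
        - comm (dt z) (H z) (da (E z z * (da (eps z) / da z)) / da z) t α)
  + 2 / (Real.pi * Complex.I) * dt (J1 z) t α
  - 1 / (Real.pi * Complex.I) * dt (J2 z) t α

/-! ### The free boundary problem -/

/-- Winding number of the closed curve `γ` (of period `2π`) about a point `w` off the curve. -/
def windingNumber (γ : ℝ → ℂ) (w : ℂ) : ℂ :=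
  1 / (2 * Real.pi * Complex.I) * ∫ β in (0 : ℝ)..(2 * Real.pi), deriv γ β / (γ β - w)

/-- The domain bounded by the closed curve `γ`. -/
def enclosedRegion (γ : ℝ → ℂ) : Set ℂ := {w | w ∉ range γ ∧ windingNumber γ w ≠ 0}

/-- `γ` is a `2π`-periodic regular parametrization of a simple closed curve, which runs
counterclockwise around the domain that it bounds. -/
structure IsCounterclockwiseParam (γ : ℝ → ℂ) : Prop where
  contDiff : ContDiff ℝ 1 γ
  periodic : Function.Periodic γ (2 * Real.pi)
  injOn : InjOn γ (Ico 0 (2 * Real.pi))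
  deriv_ne_zero : ∀ α, deriv γ α ≠ 0
  winding : ∀ w ∈ enclosedRegion γ, windingNumber γ w = 1

/-- The gradient at `x` of the self-gravity potential `φ` of the domain `Ω`,
`∇φ(x) = ∬_Ω (x - y) / |x - y|² dy`, with `ℝ²` identified with `ℂ`. In complex notation
`∇φ = 2 ∂φ/∂(conj z)`. -/
def gravityGradient (Ω : Set ℂ) (x : ℂ) : ℂ :=
  ∫ y in Ω, (x - y) / ((‖x - y‖ ^ 2 : ℝ) : ℂ)

/-- `z` is a Lagrangian parametrization of the free boundary of a solution of the
incompressible, irrotational Euler-Poisson system during the times in `S`, and the real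
function `a` is the coefficient in `∇P = i a z_α`. -/
structure IsSolution (S : Set ℝ) (z : ℝ → ℝ → ℂ) (a : ℝ → ℝ → ℝ) : Prop where
  curve : ∀ t ∈ S, IsCounterclockwiseParam (z t)
  momentum : ∀ t ∈ S, ∀ α, dt (dt z) t α + Complex.I * a t α * da z t α
    = -gravityGradient (enclosedRegion (z t)) (z t α)
  holomorphic : ∀ t ∈ S, ∀ α, H z (bar (dt z)) t α = bar (dt z) t α

end EulerPoisson

end

open MeasureTheory Filter Topology Set

noncomputable section

namespace EulerPoisson

section

/-! ### Smooth dependence of integrals on parameters -/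

section ParametricIntegral

set_option linter.unusedSectionVars false

variable {E F : Type} [NormedAddCommGroup E] [NormedSpace ℝ E] [NormedAddCommGroup F]
  [NormedSpace ℝ F] {U : Set E} {W : Set (E × ℝ)} {a b : ℝ}

/-! Write A = I - H (`defect`), Ā for its conjugate (`defectBar`), and M(f, g) (`mixed`) for 1/(πi)
times the integral of (f(β) - f(α)) g_β(β) / (z(β) - z(α)). Then M(f, g) = f A(g_α/z_α) - A(f
g_α/z_α) = -[f, H](g_α/z_α), and δ = Aε. The proof rests on calculus, function theory and gravity.

Calculus. Written with increments, all these integrands have removable singularities, so the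
integrals are as smooth as the divided differences (`exists_contDiffOn_sub_eq_mul`) and can be
differentiated under the integral sign. One integration by parts gives ∂_t(Af) = A f_t + M(z_t, f)
(`hasDerivAt_integral_quot`), and translation in place of time gives ∂_α(Af) = z_α A(f_α/z_α)
(`deriv_defect`). Hence δ_tt = A ε_tt + 2M(z_t, ε_t) + M(z_tt, ε) - J₂/(πi).

Function theory. H1 = 1, because winding numbers beside the curve are 0 or 1 and jump by 1 across it
(`integral_kappa`). The central fact is the product formula A(g Ah + h Ag - 2gh) = Ag · Ah
(`defect_mul`): off the curve it is a partial fraction identity for products of Cauchy integrals,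
which is then carried to the curve from outside. It yields A² = 2A, shows that the kernel of A
(interior boundary values) is closed under products, and makes contour integrals of products from
the range of A (exterior boundary values) vanish.

Gravity. The winding number is almost everywhere the indicator of Ω, so area integrals become
contour integrals. This gives ∇φ = (π/2) Āz on the boundary (`gravityGradient_eq`), and area π gives
z A z̄ = Aε + 2 (`curve_mul_defect_conj`).

Combination (`delta_equation`). Momentum reads z_tt + ia z_α = -(π/2) Āz. Inserting it, the linear
terms of A(ε_tt + iaε_α) contribute πδ - (π/2) A Ā ε, and differentiating A(z z̄_t) = 0 in time
removes the terms containing z̄_tt. What is left beyond J₁ and J₂ is -(π/2)(A Ā ε + M(Āz, ε)). An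
exact expansion of the conjugate kernel shows E(f) = 2f - Af - Āf - const + z M(ε, f) (`E_eq`), and
A(z M(ε, ε)) = M(z Aε, ε) (`defect_curve_mul_mixed`) turns the remainder into (π/2)(A E(ε) + M(E(z),
ε)) (`key_identity`), which is the right-hand side.

The equation for δ_t is the time derivative of this identity, with ∂_t carried through A by the same
commutation rule. -/

theorem eventually_forall_norm_le_of_continuousOn (hW : IsOpen W) {Φ : E × ℝ → F}
    (hΦ : ContinuousOn Φ W) {p : E} (hp : ∀ u ∈ uIcc a b, (p, u) ∈ W) :
    ∃ M : ℝ, ∀ᶠ q in 𝓝 p, ∀ u ∈ uIcc a b, (q, u) ∈ W ∧ ‖Φ (q, u)‖ ≤ M := by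
  have hc : ContinuousOn (fun u => Φ (p, u)) (uIcc a b) :=
    hΦ.comp (by fun_prop) hp
  obtain ⟨M, hM⟩ := isCompact_uIcc.exists_bound_of_continuousOn hc
  refine ⟨M + 1, isCompact_uIcc.eventually_forall_of_forall_eventually fun u hu => ?_⟩
  have h1 : ∀ᶠ x in 𝓝 (p, u), x ∈ W := hW.mem_nhds (hp u hu)
  have h2 : ∀ᶠ x in 𝓝 (p, u), ‖Φ x‖ < M + 1 :=
    (hΦ.continuousAt (hW.mem_nhds (hp u hu))).norm.eventually_lt continuousAt_const
      (by have := hM u hu; linarith)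
  filter_upwards [h1, h2] with x hx1 hx2 using ⟨hx1, hx2.le⟩

theorem aestronglyMeasurable_of_continuousOn_slice {Φ : E × ℝ → F} (hΦ : ContinuousOn Φ W) {p : E}
    (hp : ∀ u ∈ uIcc a b, (p, u) ∈ W) :
    AEStronglyMeasurable (fun u => Φ (p, u)) (volume.restrict (uIoc a b)) := by
  have hc : ContinuousOn (fun u => Φ (p, u)) (uIcc a b) := hΦ.comp (by fun_prop) hp
  exact (hc.mono uIoc_subset_uIcc).aestronglyMeasurable measurableSet_uIoc

theorem intervalIntegrable_of_continuousOn_slice {Φ : E × ℝ → F} (hΦ : ContinuousOn Φ W) {p : E}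
    (hp : ∀ u ∈ uIcc a b, (p, u) ∈ W) :
    IntervalIntegrable (fun u => Φ (p, u)) volume a b :=
  ContinuousOn.intervalIntegrable (hΦ.comp (by fun_prop) hp)

theorem continuousOn_intervalIntegral (hW : IsOpen W) {Φ : E × ℝ → F}
    (hΦ : ContinuousOn Φ W) (hUW : ∀ p ∈ U, ∀ u ∈ uIcc a b, (p, u) ∈ W) :
    ContinuousOn (fun p => ∫ u in a..b, Φ (p, u)) U := by
  intro p hp
  obtain ⟨M, hM⟩ := eventually_forall_norm_le_of_continuousOn hW hΦ (hUW p hp)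
  refine (intervalIntegral.continuousAt_of_dominated_interval (bound := fun _ => M) ?_ ?_ ?_
    ?_).continuousWithinAt
  · filter_upwards [hM] with q hq
    exact aestronglyMeasurable_of_continuousOn_slice hΦ fun u hu => (hq u hu).1
  · filter_upwards [hM] with q hq
    exact ae_of_all _ fun u hu => (hq u (uIoc_subset_uIcc hu)).2
  · exact intervalIntegrable_const
  · refine ae_of_all _ fun u hu => ?_
    have := hΦ.continuousAt (hW.mem_nhds (hUW p hp u (uIoc_subset_uIcc hu)))
    exact ContinuousAt.comp (f := fun q : E => (q, u)) this (by fun_prop)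

theorem hasFDerivAt_intervalIntegral (hW : IsOpen W) {Φ : E × ℝ → F} (hΦ : ContDiffOn ℝ 1 Φ W)
    {p : E} (hp : ∀ u ∈ uIcc a b, (p, u) ∈ W) :
    HasFDerivAt (fun p => ∫ u in a..b, Φ (p, u))
      (∫ u in a..b, (fderiv ℝ Φ (p, u)).comp (ContinuousLinearMap.inl ℝ E ℝ)) p := by
  have hc : ContinuousOn (fun x => (fderiv ℝ Φ x).comp (ContinuousLinearMap.inl ℝ E ℝ)) W :=
    (hΦ.continuousOn_fderiv_of_isOpen hW le_rfl).clm_comp continuousOn_const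
  obtain ⟨M, hM⟩ := eventually_forall_norm_le_of_continuousOn hW hc hp
  refine intervalIntegral.hasFDerivAt_integral_of_dominated_of_fderiv_le hM (bound := fun _ => M)
    (F' := fun q u => (fderiv ℝ Φ (q, u)).comp (ContinuousLinearMap.inl ℝ E ℝ)) ?_ ?_ ?_ ?_ ?_ ?_
  · filter_upwards [hM] with q hq
    exact aestronglyMeasurable_of_continuousOn_slice hΦ.continuousOn fun u hu => (hq u hu).1
  · exact intervalIntegrable_of_continuousOn_slice hΦ.continuousOn hp
  · exact aestronglyMeasurable_of_continuousOn_slice hc hp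
  · exact ae_of_all _ fun u hu q hq => (hq u (uIoc_subset_uIcc hu)).2
  · exact intervalIntegrable_const
  · refine ae_of_all _ fun u hu q hq => ?_
    have h1 := ((hΦ.differentiableOn one_ne_zero).differentiableAt
      (hW.mem_nhds (hq u (uIoc_subset_uIcc hu)).1)).hasFDerivAt
    exact h1.comp q (hasFDerivAt_prodMk_left q u)

end ParametricIntegral

/-- The codomain is quantified inside the induction on n: the inductive step replaces the integrand
by its derivative in the parameter, which takes values in a space of linear maps. -/
theorem contDiffOn_intervalIntegral {E : Type} [NormedAddCommGroup E] [NormedSpace ℝ E]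
    {U : Set E} {W : Set (E × ℝ)} {a b : ℝ} (hU : IsOpen U) (hW : IsOpen W)
    (hUW : ∀ p ∈ U, ∀ u ∈ uIcc a b, (p, u) ∈ W) (n : ℕ) :
    ∀ {F : Type} [NormedAddCommGroup F] [NormedSpace ℝ F] {Φ : E × ℝ → F},
      ContDiffOn ℝ n Φ W → ContDiffOn ℝ n (fun p => ∫ u in a..b, Φ (p, u)) U := by
  induction n with
  | zero =>
    intro F _ _ Φ hΦ
    simp only [Nat.cast_zero, contDiffOn_zero] at hΦ ⊢
    exact continuousOn_intervalIntegral hW hΦ hUW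
  | succ n ih =>
    intro F _ _ Φ hΦ
    have h1 : ContDiffOn ℝ 1 Φ W := hΦ.of_le (by simp)
    rw [Nat.cast_succ, contDiffOn_succ_iff_fderiv_of_isOpen hU]
    refine ⟨fun p hp =>
      (hasFDerivAt_intervalIntegral hW h1 (hUW p hp)).differentiableAt.differentiableWithinAt,
      by simp, ?_⟩
    have h2 : ContDiffOn ℝ n
        (fun x => (fderiv ℝ Φ x).comp (ContinuousLinearMap.inl ℝ E ℝ)) W :=
      (hΦ.fderiv_of_isOpen hW (by simp)).clm_comp contDiffOn_const
    refine (ih h2).congr fun p hp => ?_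
    exact (hasFDerivAt_intervalIntegral hW h1 (hUW p hp)).fderiv

/-- The interval `(-2π, 2π)` of admissible increments of the Lagrangian parameter. -/
abbrev increments : Set ℝ := Ioo (-(2 * Real.pi)) (2 * Real.pi)

theorem zero_mem_increments : (0 : ℝ) ∈ increments := by
  constructor <;> linarith [Real.pi_pos]

theorem mem_increments_of_mem_uIcc {u : ℝ} (hu : u ∈ uIcc (-Real.pi) Real.pi) :
    u ∈ increments := by
  rw [uIcc_of_le (by linarith [Real.pi_pos])] at hu
  constructor <;> linarith [Real.pi_pos, hu.1, hu.2]

theorem mul_mem_increments {s u : ℝ} (hs : s ∈ Icc (0 : ℝ) 1) (hu : u ∈ increments) :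
    s * u ∈ increments := by
  have h1 : |u| < 2 * Real.pi := abs_lt.2 hu
  have h2 : |s * u| ≤ |u| := by
    rw [abs_mul, abs_of_nonneg hs.1]
    exact mul_le_of_le_one_left (abs_nonneg u) hs.2
  exact abs_lt.1 (h2.trans_lt h1)

variable {E : Type} [NormedAddCommGroup E] [NormedSpace ℝ E] {U : Set E}

/-- Division with remainder of a smooth function by the increment `u`. -/
theorem exists_contDiffOn_sub_eq_mul (hU : IsOpen U) {n : ℕ} {g : E × ℝ → ℂ}
    (hg : ContDiffOn ℝ (n + 1) g (U ×ˢ increments)) :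
    ∃ Φ : E × ℝ → ℂ, ContDiffOn ℝ n Φ (U ×ˢ increments) ∧
      (∀ p ∈ U, ∀ u ∈ increments, g (p, u) - g (p, 0) = u * Φ (p, u)) ∧
      ∀ p, Φ (p, 0) = fderiv ℝ g (p, 0) (0, 1) := by
  have hO : IsOpen (U ×ˢ increments) := hU.prod isOpen_Ioo
  set G : E × ℝ → ℂ := fun x => fderiv ℝ g x (0, 1) with hG
  have hGs : ContDiffOn ℝ n G (U ×ˢ increments) :=
    (hg.fderiv_of_isOpen hO le_rfl).clm_apply contDiffOn_const
  let m : (E × ℝ) × ℝ → E × ℝ := fun x => (x.1.1, x.2 * x.1.2)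
  have hm : ContDiff ℝ n m := by fun_prop
  have hW : IsOpen (m ⁻¹' (U ×ˢ increments)) := hO.preimage hm.continuous
  have hUW : ∀ p ∈ U ×ˢ increments, ∀ s ∈ uIcc (0 : ℝ) 1, (p, s) ∈ m ⁻¹' (U ×ˢ increments) := by
    intro p hp s hs
    rw [uIcc_of_le zero_le_one] at hs
    exact ⟨hp.1, mul_mem_increments hs hp.2⟩
  -- Hadamard's formula: the quotient is the mean over s in [0, 1] of the u-derivative at (p, su).
  -- This costs one derivative and is smooth across u = 0.
  refine ⟨fun p => ∫ s in (0 : ℝ)..1, G (m (p, s)), ?_, ?_, ?_⟩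
  · exact contDiffOn_intervalIntegral (a := 0) (b := 1) hO hW hUW n (Φ := fun x => G (m x))
      (hGs.comp hm.contDiffOn fun x hx => hx)
  · intro p hp u hu
    have hd : ∀ s ∈ uIcc (0 : ℝ) 1,
        HasDerivAt (fun s : ℝ => g (p, s * u)) (u * G (m ((p, u), s))) s := by
      intro s hs
      have hmem : (p, s * u) ∈ U ×ˢ increments := hUW (p, u) ⟨hp, hu⟩ s hs
      have h1 := ((hg.differentiableOn (by simp)).differentiableAt (hO.mem_nhds hmem)).hasFDerivAt
      have h2 : HasDerivAt (fun s : ℝ => (p, s * u)) ((0 : E), u) s := by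
        simpa using (hasDerivAt_const s p).prodMk ((hasDerivAt_id s).mul_const u)
      have h3 := h1.comp_hasDerivAt s h2
      have h4 : ((0 : E), u) = u • ((0 : E), (1 : ℝ)) := by simp
      rw [h4, map_smul] at h3
      rw [Complex.real_smul] at h3
      exact h3
    have hc : ContinuousOn (fun s : ℝ => (u : ℂ) * G (m ((p, u), s))) (uIcc 0 1) := by
      refine continuousOn_const.mul ((hGs.continuousOn).comp (by fun_prop) fun s hs => ?_)
      exact hUW (p, u) ⟨hp, hu⟩ s hs
    have := intervalIntegral.integral_eq_sub_of_hasDerivAt hd hc.intervalIntegrable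
    rw [intervalIntegral.integral_const_mul] at this
    simp only [one_mul, zero_mul] at this
    exact this.symm
  · intro p
    simp [m, hG]

/-! ### Integrands that are smooth up to a removable singularity -/

/-- `Ψ p u`, for `u ≠ 0`, extends to a function of class `C^n` on `U × (-2π, 2π)`. -/
def Reg (U : Set E) (n : ℕ) (Ψ : E → ℝ → ℂ) : Prop :=
  ∃ Φ : E × ℝ → ℂ, ContDiffOn ℝ n Φ (U ×ˢ increments) ∧
    ∀ p ∈ U, ∀ u ∈ increments, u ≠ 0 → Ψ p u = Φ (p, u)

namespace Reg

variable {n m : ℕ} {Ψ Ψ₁ Ψ₂ : E → ℝ → ℂ}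

theorem of_contDiffOn {Φ : E × ℝ → ℂ} (h : ContDiffOn ℝ n Φ (U ×ˢ increments)) :
    Reg U n (fun p u => Φ (p, u)) := ⟨Φ, h, fun _ _ _ _ _ => rfl⟩

theorem of_le (h : Reg U n Ψ) (hmn : m ≤ n) : Reg U m Ψ := by
  obtain ⟨Φ, h1, h2⟩ := h
  exact ⟨Φ, h1.of_le (by exact_mod_cast hmn), h2⟩

theorem congr (h : Reg U n Ψ) (h' : ∀ p ∈ U, ∀ u ∈ increments, u ≠ 0 → Ψ₁ p u = Ψ p u) :
    Reg U n Ψ₁ := by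
  obtain ⟨Φ, h1, h2⟩ := h
  exact ⟨Φ, h1, fun p hp u hu h0 => (h' p hp u hu h0).trans (h2 p hp u hu h0)⟩

theorem add (h₁ : Reg U n Ψ₁) (h₂ : Reg U n Ψ₂) : Reg U n (fun p u => Ψ₁ p u + Ψ₂ p u) := by
  obtain ⟨Φ₁, h1, h2⟩ := h₁
  obtain ⟨Φ₂, h3, h4⟩ := h₂
  exact ⟨fun x => Φ₁ x + Φ₂ x, h1.add h3, fun p hp u hu h0 => by
    dsimp only
    rw [h2 p hp u hu h0, h4 p hp u hu h0]⟩

theorem neg (h₁ : Reg U n Ψ₁) : Reg U n (fun p u => -Ψ₁ p u) := by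
  obtain ⟨Φ₁, h1, h2⟩ := h₁
  exact ⟨fun x => -Φ₁ x, h1.neg, fun p hp u hu h0 => by
    dsimp only
    rw [h2 p hp u hu h0]⟩

theorem sub (h₁ : Reg U n Ψ₁) (h₂ : Reg U n Ψ₂) : Reg U n (fun p u => Ψ₁ p u - Ψ₂ p u) := by
  simpa [sub_eq_add_neg] using h₁.add h₂.neg

theorem mul (h₁ : Reg U n Ψ₁) (h₂ : Reg U n Ψ₂) : Reg U n (fun p u => Ψ₁ p u * Ψ₂ p u) := by
  obtain ⟨Φ₁, h1, h2⟩ := h₁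
  obtain ⟨Φ₂, h3, h4⟩ := h₂
  exact ⟨fun x => Φ₁ x * Φ₂ x, h1.mul h3, fun p hp u hu h0 => by
    dsimp only
    rw [h2 p hp u hu h0, h4 p hp u hu h0]⟩

theorem conj (h₁ : Reg U n Ψ₁) : Reg U n (fun p u => (starRingEnd ℂ) (Ψ₁ p u)) := by
  obtain ⟨Φ₁, h1, h2⟩ := h₁
  exact ⟨fun x => (starRingEnd ℂ) (Φ₁ x), Complex.conjCLE.contDiff.comp_contDiffOn h1,
    fun p hp u hu h0 => by
    dsimp only
    rw [h2 p hp u hu h0]⟩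

theorem intervalIntegrable (h : Reg U n Ψ) {p : E} (hp : p ∈ U) :
    IntervalIntegrable (Ψ p) volume (-Real.pi) Real.pi := by
  obtain ⟨Φ, h1, h2⟩ := h
  have := intervalIntegrable_of_continuousOn_slice (a := -Real.pi) (b := Real.pi) (p := p)
    h1.continuousOn (fun u hu => ⟨hp, mem_increments_of_mem_uIcc hu⟩)
  refine this.congr_ae ?_
  have h0 : ∀ᵐ u : ℝ ∂volume, u ≠ 0 := by simp [ae_iff]
  filter_upwards [ae_restrict_of_ae h0, ae_restrict_mem measurableSet_uIoc] with u hu1 hu2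
  exact (h2 p hp u (mem_increments_of_mem_uIcc (uIoc_subset_uIcc hu2)) hu1).symm

end Reg

theorem integral_congr_increments {f g : ℝ → ℂ} (h : ∀ u ∈ increments, u ≠ 0 → f u = g u) :
    ∫ u in (-Real.pi)..Real.pi, f u = ∫ u in (-Real.pi)..Real.pi, g u := by
  refine intervalIntegral.integral_congr_ae ?_
  have h0 : ∀ᵐ u : ℝ ∂volume, u ≠ 0 := by simp [ae_iff]
  filter_upwards [h0] with u hu1 hu2
  exact h u (mem_increments_of_mem_uIcc (uIoc_subset_uIcc hu2)) hu1

theorem Reg.contDiffOn_integral {n : ℕ} {Ψ : E → ℝ → ℂ} (hU : IsOpen U) (h : Reg U n Ψ) :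
    ContDiffOn ℝ n (fun p => ∫ u in (-Real.pi)..Real.pi, Ψ p u) U := by
  obtain ⟨Φ, h1, h2⟩ := h
  refine (contDiffOn_intervalIntegral (a := -Real.pi) (b := Real.pi) hU (hU.prod isOpen_Ioo)
    (fun p hp u hu => ⟨hp, mem_increments_of_mem_uIcc hu⟩) n h1).congr fun p hp => ?_
  exact integral_congr_increments fun u hu h0 => h2 p hp u hu h0

/-- Quotient of increments by the increment of the parameter. -/
theorem Reg.div_increment (hU : IsOpen U) {n : ℕ} {g : E × ℝ → ℂ}
    (hg : ContDiffOn ℝ (n + 1) g (U ×ˢ increments)) :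
    Reg U n (fun p u => (g (p, u) - g (p, 0)) / u) := by
  obtain ⟨Φ, h1, h2, -⟩ := exists_contDiffOn_sub_eq_mul hU hg
  refine ⟨Φ, h1, fun p hp u hu h0 => ?_⟩
  dsimp only
  rw [h2 p hp u hu, mul_div_cancel_left₀ _ (by exact_mod_cast h0)]

/-- Inverse quotient of increments. -/
theorem Reg.increment_div (hU : IsOpen U) {n : ℕ} {g : E × ℝ → ℂ}
    (hg : ContDiffOn ℝ (n + 1) g (U ×ˢ increments))
    (h0 : ∀ p ∈ U, ∀ u ∈ increments, u ≠ 0 → g (p, u) ≠ g (p, 0))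
    (h1 : ∀ p ∈ U, fderiv ℝ g (p, 0) (0, 1) ≠ 0) :
    Reg U n (fun p u => u / (g (p, u) - g (p, 0))) := by
  obtain ⟨Φ, h2, h3, h4⟩ := exists_contDiffOn_sub_eq_mul hU hg
  refine ⟨fun x => (Φ x)⁻¹, h2.inv ?_, fun p hp u hu hu0 => ?_⟩
  · rintro ⟨p, u⟩ ⟨hp, hu⟩ h
    by_cases hu0 : u = 0
    · subst hu0
      exact h1 p hp ((h4 p).symm.trans h)
    · have := h3 p hp u hu
      rw [h, mul_zero, sub_eq_zero] at this
      exact h0 p hp u hu hu0 this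
  · have hu0' : (u : ℂ) ≠ 0 := by exact_mod_cast hu0
    dsimp only
    rw [h3 p hp u hu, div_mul_eq_div_div, div_self hu0', one_div]

/-- The derivative is taken of the original integrand, not of its smooth extension; the two differ
only at u = 0, a null set. This allows explicit computation with difference quotients. -/
theorem Reg.hasDerivAt_integral {U : Set ℝ} (hU : IsOpen U) {Ψ : ℝ → ℝ → ℂ} (h : Reg U 1 Ψ)
    {s : ℝ} (hs : s ∈ U) :
    HasDerivAt (fun s => ∫ u in (-Real.pi)..Real.pi, Ψ s u)
      (∫ u in (-Real.pi)..Real.pi, deriv (fun x => Ψ x u) s) s := by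
  obtain ⟨Φ, h1, h2⟩ := h
  have hO : IsOpen (U ×ˢ increments) := hU.prod isOpen_Ioo
  have hW : ∀ u ∈ uIcc (-Real.pi) Real.pi, (s, u) ∈ U ×ˢ increments :=
    fun u hu => ⟨hs, mem_increments_of_mem_uIcc hu⟩
  have h3 := (hasFDerivAt_intervalIntegral hO h1 hW).hasDerivAt
  have hc : ContinuousOn (fun x => (fderiv ℝ Φ x).comp (ContinuousLinearMap.inl ℝ ℝ ℝ))
      (U ×ˢ increments) :=
    (h1.continuousOn_fderiv_of_isOpen hO le_rfl).clm_comp continuousOn_const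
  rw [ContinuousLinearMap.intervalIntegral_apply
    (intervalIntegrable_of_continuousOn_slice hc hW)] at h3
  have h4 : ∫ u in (-Real.pi)..Real.pi,
      (fderiv ℝ Φ (s, u)).comp (ContinuousLinearMap.inl ℝ ℝ ℝ) 1 =
      ∫ u in (-Real.pi)..Real.pi, deriv (fun x => Ψ x u) s := by
    refine integral_congr_increments fun u hu h0 => ?_
    have h5 : HasFDerivAt Φ (fderiv ℝ Φ (s, u)) (s, u) :=
      ((h1.differentiableOn one_ne_zero).differentiableAt
      (hO.mem_nhds (⟨hs, hu⟩ : (s, u) ∈ U ×ˢ increments))).hasFDerivAt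
    have h7 : HasFDerivAt (fun x : ℝ => (x, u)) (ContinuousLinearMap.inl ℝ ℝ ℝ) s :=
      hasFDerivAt_prodMk_left s u
    replace h5 := HasFDerivAt.comp (f := fun x : ℝ => (x, u)) s h5 h7
    have h6 : (fun x => Ψ x u) =ᶠ[𝓝 s] (Φ ∘ fun x => (x, u)) := by
      filter_upwards [hU.mem_nhds hs] with x hx
      exact h2 x hx u hu h0
    rw [h6.deriv_eq]
    exact h5.hasDerivAt.deriv.symm
  rw [h4] at h3
  refine h3.congr_of_eventuallyEq ?_
  filter_upwards [hU.mem_nhds hs] with x hx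
  exact integral_congr_increments fun u hu h0 => h2 x hx u hu h0

/-- This is the form in which integration by parts is used: the fundamental theorem of calculus is
applied to the smooth extension, so the removable singularity leaves no boundary term at u = 0. -/
theorem Reg.integral_deriv_eq_zero {Ψ : E → ℝ → ℂ} (h : Reg U 1 Ψ) (hU : IsOpen U)
    {p : E} (hp : p ∈ U) (hper : Ψ p Real.pi = Ψ p (-Real.pi)) :
    ∫ u in (-Real.pi)..Real.pi, deriv (Ψ p) u = 0 := by
  obtain ⟨Φ, h1, h2⟩ := h
  have hO : IsOpen (U ×ˢ increments) := hU.prod isOpen_Ioo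
  have hs : ContDiffOn ℝ 1 (fun u => Φ (p, u)) increments :=
    h1.comp (by fun_prop) fun u hu => ⟨hp, hu⟩
  have h3 : ∫ u in (-Real.pi)..Real.pi, deriv (Ψ p) u =
      ∫ u in (-Real.pi)..Real.pi, deriv (fun u => Φ (p, u)) u := by
    refine integral_congr_increments fun u hu h0 => ?_
    refine Filter.EventuallyEq.deriv_eq ?_
    filter_upwards [isOpen_Ioo.mem_nhds hu, isOpen_ne.mem_nhds h0] with v hv hv0
    exact h2 p hp v hv hv0
  rw [h3, intervalIntegral.integral_eq_sub_of_hasDerivAt (f := fun u => Φ (p, u))]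
  · have hpi := Real.pi_pos
    rw [← h2 p hp _ ⟨by linarith, by linarith⟩ hpi.ne',
      ← h2 p hp _ ⟨by linarith, by linarith⟩ (by linarith), hper, sub_self]
  · intro u hu
    exact ((hs.differentiableOn one_ne_zero).differentiableAt
      (isOpen_Ioo.mem_nhds (mem_increments_of_mem_uIcc hu))).hasDerivAt
  · refine ContinuousOn.intervalIntegrable ?_
    exact (hs.continuousOn_deriv_of_isOpen isOpen_Ioo le_rfl).mono
      fun u hu => mem_increments_of_mem_uIcc hu

end

/-! ### Periodic functions and curves at a fixed time -/

/-- `2π`-periodic functions of class `C^n`. -/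
structure PerC (n : ℕ) (f : ℝ → ℂ) : Prop where
  smooth : ContDiff ℝ n f
  per : Function.Periodic f (2 * Real.pi)

namespace PerC

variable {n m : ℕ} {f g : ℝ → ℂ}

theorem of_le (hf : PerC n f) (h : m ≤ n) : PerC m f :=
  ⟨hf.smooth.of_le (by exact_mod_cast h), hf.per⟩

theorem add (hf : PerC n f) (hg : PerC n g) : PerC n (fun x => f x + g x) :=
  ⟨hf.smooth.add hg.smooth, fun x => by simp only [hf.per x, hg.per x]⟩

theorem sub (hf : PerC n f) (hg : PerC n g) : PerC n (fun x => f x - g x) :=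
  ⟨hf.smooth.sub hg.smooth, fun x => by simp only [hf.per x, hg.per x]⟩

theorem mul (hf : PerC n f) (hg : PerC n g) : PerC n (fun x => f x * g x) :=
  ⟨hf.smooth.mul hg.smooth, fun x => by simp only [hf.per x, hg.per x]⟩

theorem const (c : ℂ) : PerC n (fun _ => c) := ⟨contDiff_const, fun _ => rfl⟩

theorem inv (hf : PerC n f) (h : ∀ x, f x ≠ 0) : PerC n (fun x => (f x)⁻¹) :=
  ⟨hf.smooth.inv h, fun x => by simp only [hf.per x]⟩

theorem div (hf : PerC n f) (hg : PerC n g) (h : ∀ x, g x ≠ 0) : PerC n (fun x => f x / g x) :=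
  by
  simpa only [div_eq_mul_inv] using hf.mul (hg.inv h)

theorem conj (hf : PerC n f) : PerC n (fun x => (starRingEnd ℂ) (f x)) :=
  ⟨Complex.conjCLE.contDiff.comp hf.smooth, fun x => by simp only [hf.per x]⟩

theorem deriv (hf : PerC (n + 1) f) : PerC n (deriv f) := by
  refine ⟨?_, fun x => ?_⟩
  · have := hf.smooth
    rw [Nat.cast_succ, contDiff_succ_iff_deriv] at this
    exact this.2.2
  · rw [← deriv_comp_add_const]
    congr 1
    exact funext hf.per

theorem differentiable (hf : PerC n f) (h : 1 ≤ n) (x : ℝ) : DifferentiableAt ℝ f x :=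
  (hf.smooth.differentiable (by exact_mod_cast (by omega : n ≠ 0))) x

theorem sub_two_pi (hf : PerC n f) (x : ℝ) : f (x + Real.pi) = f (x + -Real.pi) := by
  rw [← hf.per (x + -Real.pi)]
  congr 1
  ring

end PerC

theorem integral_shift_eq {F : ℝ → ℂ} (hF : Function.Periodic F (2 * Real.pi)) (α : ℝ) :
    ∫ u in (-Real.pi)..Real.pi, F (α + u) = ∫ β in (0 : ℝ)..(2 * Real.pi), F β := by
  rw [intervalIntegral.integral_comp_add_left]
  have := hF.intervalIntegral_add_eq (α + -Real.pi) 0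
  rw [show α + -Real.pi + 2 * Real.pi = α + Real.pi by ring, zero_add] at this
  exact this

theorem integral_shift_eq' {F : ℝ → ℂ} (hF : Function.Periodic F (2 * Real.pi)) (α : ℝ) :
    ∫ u in (-Real.pi)..Real.pi, F (u + α) = ∫ u in (-Real.pi)..Real.pi, F u := by
  have h := integral_shift_eq hF 0
  simp only [zero_add] at h
  rw [h, ← integral_shift_eq hF α]
  simp only [add_comm]

/-- A counterclockwise parametrization of class `C^3`. -/
structure IsSmoothParam (γ : ℝ → ℂ) : Prop extends IsCounterclockwiseParam γ where
  contDiff_three : ContDiff ℝ 3 γ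

namespace IsSmoothParam

variable {γ : ℝ → ℂ} (hγ : IsSmoothParam γ)
include hγ

theorem perC : PerC 3 γ := ⟨hγ.contDiff_three, hγ.periodic⟩

theorem perC_deriv : PerC 2 (deriv γ) := hγ.perC.deriv

end IsSmoothParam

theorem IsCounterclockwiseParam.ne_of_mem_increments {γ : ℝ → ℂ} (hγ : IsCounterclockwiseParam γ)
    (α : ℝ) {u : ℝ} (hu : u ∈ increments) (h0 : u ≠ 0) : γ (α + u) ≠ γ α := by
  intro h
  -- Both parameters are moved into [0, 2π), where injectivity applies. Then u is an integer
  -- multiple of 2π of modulus less than 2π, hence zero.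
  obtain ⟨m, hm, -⟩ := existsUnique_add_zsmul_mem_Ico Real.two_pi_pos α 0
  obtain ⟨k, hk, -⟩ := existsUnique_add_zsmul_mem_Ico Real.two_pi_pos (α + u) 0
  rw [zero_add] at hm hk
  have h1 := hγ.injOn hk hm (by rw [hγ.periodic.zsmul k, hγ.periodic.zsmul m, h])
  simp only [zsmul_eq_mul] at h1
  have h2 : u = (m - k : ℤ) * (2 * Real.pi) := by push_cast; linarith
  have hp := Real.two_pi_pos
  have h3 : ((m - k : ℤ) : ℝ) < 1 := by
    by_contra! hc
    nlinarith [hu.2]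
  have h4 : (-1 : ℝ) < ((m - k : ℤ) : ℝ) := by
    by_contra! hc
    nlinarith [hu.1]
  have h5 : m - k = 0 := by
    have h3' : m - k < 1 := by exact_mod_cast h3
    have h4' : -1 < m - k := by exact_mod_cast h4
    omega
  rw [h5] at h2
  simp at h2
  exact h0 h2

theorem IsCounterclockwiseParam.sub_ne_zero {γ : ℝ → ℂ} (hγ : IsCounterclockwiseParam γ)
    (α : ℝ) {u : ℝ} (hu : u ∈ increments) (h0 : u ≠ 0) : γ (α + u) - γ α ≠ 0 :=
  _root_.sub_ne_zero.2 (hγ.ne_of_mem_increments α hu h0)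

theorem fderiv_shift {f : ℝ → ℂ} {σ : ℝ} (hf : DifferentiableAt ℝ f σ) :
    fderiv ℝ (fun x : ℝ × ℝ => f (x.1 + x.2)) (σ, 0) (0, 1) = deriv f σ := by
  have h1 : HasFDerivAt (fun x : ℝ × ℝ => x.1 + x.2)
    (ContinuousLinearMap.fst ℝ ℝ ℝ + ContinuousLinearMap.snd ℝ ℝ ℝ) (σ, 0) :=
    hasFDerivAt_fst.add hasFDerivAt_snd
  have h2 : HasFDerivAt f (fderiv ℝ f σ) ((fun x : ℝ × ℝ => x.1 + x.2) (σ, 0)) := by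
    simpa using hf.hasFDerivAt
  have h3 : fderiv ℝ (fun x : ℝ × ℝ => f (x.1 + x.2)) (σ, 0) = _ :=
    (HasFDerivAt.comp (f := fun x : ℝ × ℝ => x.1 + x.2) (σ, (0 : ℝ)) h2 h1).fderiv
  rw [h3]
  simp

/-! ### Regular integrands at a fixed time -/

theorem reg_shift {n : ℕ} {f : ℝ → ℂ} (hf : PerC n f) : Reg univ n (fun σ u => f (σ + u)) :=
  Reg.of_contDiffOn (Φ := fun x : ℝ × ℝ => f (x.1 + x.2))
    (hf.smooth.comp (by fun_prop)).contDiffOn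

theorem reg_base {n : ℕ} {f : ℝ → ℂ} (hf : PerC n f) : Reg univ n (fun σ _ => f σ) :=
  Reg.of_contDiffOn (Φ := fun x : ℝ × ℝ => f x.1) (hf.smooth.comp (by fun_prop)).contDiffOn

theorem reg_sub_div {n : ℕ} {f : ℝ → ℂ} (hf : PerC (n + 1) f) :
    Reg univ n (fun σ u => (f (σ + u) - f σ) / u) := by
  have h := Reg.div_increment (U := univ) isOpen_univ (n := n)
    (g := fun x : ℝ × ℝ => f (x.1 + x.2)) (hf.smooth.comp (by fun_prop)).contDiffOn
  simpa using h

section curve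

variable {γ : ℝ → ℂ} (hγ : IsSmoothParam γ)
include hγ

theorem reg_div_sub : Reg univ 2 (fun σ u => u / (γ (σ + u) - γ σ)) := by
  have h := Reg.increment_div (U := univ) isOpen_univ (n := 2)
    (g := fun x : ℝ × ℝ => γ (x.1 + x.2)) (hγ.perC.smooth.comp (by fun_prop)).contDiffOn
    (fun p _ u hu h0 => by simpa using hγ.ne_of_mem_increments p hu h0)
    (fun p _ => by
      rw [fderiv_shift (hγ.perC.differentiable (by norm_num) p)]
      exact hγ.deriv_ne_zero p)
  simpa using h

theorem reg_quot {n : ℕ} (hn : n ≤ 2) {f : ℝ → ℂ} (hf : PerC (n + 1) f) :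
    Reg univ n (fun σ u => (f (σ + u) - f σ) / (γ (σ + u) - γ σ)) := by
  refine ((reg_sub_div hf).mul ((reg_div_sub hγ).of_le hn)).congr fun σ _ u hu h0 => ?_
  have h1 := hγ.sub_ne_zero σ hu h0
  have h2 : (u : ℂ) ≠ 0 := by exact_mod_cast h0
  field_simp

/-- With γ(σ+u) - γ(σ) = u Φ(σ,u) and Φ(σ,0) = γ'(σ), the expression is (γ'(σ+u)/Φ(σ,u) - 1)/u,
again a divided difference. Two divisions take C³ to C¹. -/
theorem reg_kappa : Reg univ 1 (fun σ u => deriv γ (σ + u) / (γ (σ + u) - γ σ) - 1 / u) := by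
  have hs : ContDiffOn ℝ ((2 : ℕ) + 1) (fun x : ℝ × ℝ => γ (x.1 + x.2)) (univ ×ˢ increments) :=
    (hγ.perC.smooth.comp (by fun_prop)).contDiffOn
  obtain ⟨Φ, h1, h2, h3⟩ := exists_contDiffOn_sub_eq_mul isOpen_univ hs
  simp only [add_zero, mem_univ, forall_const] at h2
  have h4 : ∀ p, Φ (p, 0) = deriv γ p := fun p => by
    rw [h3, fderiv_shift (hγ.perC.differentiable (by norm_num) p)]
  have h5 : ∀ x ∈ univ ×ˢ increments, Φ x ≠ 0 := by
    rintro ⟨p, u⟩ ⟨-, hu⟩ h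
    by_cases hu0 : u = 0
    · subst hu0
      exact hγ.deriv_ne_zero p ((h4 p).symm.trans h)
    · have := h2 p u hu
      rw [h, mul_zero] at this
      exact hγ.sub_ne_zero p hu hu0 this
  have h6 : ContDiffOn ℝ ((1 : ℕ) + 1) (fun x : ℝ × ℝ => deriv γ (x.1 + x.2) / Φ x)
      (univ ×ˢ increments) := by
    have h7 : ContDiffOn ℝ ((1 : ℕ) + 1) (fun x : ℝ × ℝ => deriv γ (x.1 + x.2))
        (univ ×ˢ increments) := (hγ.perC_deriv.smooth.comp (by fun_prop)).contDiffOn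
    simp only [div_eq_mul_inv]
    exact h7.mul (h1.inv h5)
  refine (Reg.div_increment isOpen_univ h6).congr fun p _ u hu h0 => ?_
  have h7 := h5 (p, u) ⟨trivial, hu⟩
  have h8 : (u : ℂ) ≠ 0 := by exact_mod_cast h0
  have h9 := hγ.deriv_ne_zero p
  simp only [add_zero, h4, h2 p u hu]
  field_simp

end curve

/-- The function k is the value at u = 0. It splits a kernel with a simple pole into a regular part
and k/u, whose principal value is zero. -/
theorem Reg.exists_sub_div {E : Type} [NormedAddCommGroup E] [NormedSpace ℝ E] {U : Set E}
    {n : ℕ} {Ψ : E → ℝ → ℂ} (hU : IsOpen U) (h : Reg U (n + 1) Ψ) :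
    ∃ k : E → ℂ, Reg U n (fun p u => (Ψ p u - k p) / u) := by
  obtain ⟨Φ, h1, h2⟩ := h
  refine ⟨fun p => Φ (p, 0), (Reg.div_increment hU h1).congr fun p hp u hu h0 => ?_⟩
  rw [h2 p hp u hu h0]

/-! ### Principal values -/

/-- `F` has the principal value `L` at `α`. -/
def HasPV (F : ℝ → ℂ) (α : ℝ) (L : ℂ) : Prop :=
  (∀ r : ℝ, 0 < r → r < Real.pi →
    IntervalIntegrable F volume (α - Real.pi) (α - r) ∧
    IntervalIntegrable F volume (α + r) (α + Real.pi)) ∧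
  Tendsto (truncatedIntegral F α) (𝓝[>] (0 : ℝ)) (𝓝 L)

theorem HasPV.exists {F : ℝ → ℂ} {α : ℝ} {L : ℂ} (h : HasPV F α L) : PVExists F α :=
  ⟨h.1, L, h.2⟩

theorem HasPV.pv_eq {F : ℝ → ℂ} {α : ℝ} {L : ℂ} (h : HasPV F α L) : pv F α = L :=
  h.2.limUnder_eq

/-- The removed interval and the period are both symmetric about α, so the odd term k/u contributes
nothing at any truncation. The remaining truncated integrals converge by continuity of the primitive
of R. -/
theorem hasPV_of_eq_add_div {F R : ℝ → ℂ} {α : ℝ} {k : ℂ}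
    (hR : IntervalIntegrable R volume (-Real.pi) Real.pi)
    (h : ∀ u ∈ increments, u ≠ 0 → F (α + u) = R u + k / u) :
    HasPV F α (∫ u in (-Real.pi)..Real.pi, R u) := by
  have hpi := Real.pi_pos
  have hne : ∀ r : ℝ, 0 < r → r < Real.pi → (∀ u ∈ uIcc (-Real.pi) (-r), u ∈ increments ∧ u ≠ 0) ∧
      ∀ u ∈ uIcc r Real.pi, u ∈ increments ∧ u ≠ 0 := by
    intro r h0 h1
    constructor
    · intro u hu
      rw [uIcc_of_le (by linarith)] at hu
      exact ⟨⟨by linarith [hu.1], by linarith [hu.2]⟩, by linarith [hu.2]⟩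
    · intro u hu
      rw [uIcc_of_le (by linarith)] at hu
      exact ⟨⟨by linarith [hu.1], by linarith [hu.2]⟩, by linarith [hu.1]⟩
  have hsub1 : ∀ r : ℝ, 0 < r → r < Real.pi → uIcc (-Real.pi) (-r) ⊆ uIcc (-Real.pi) Real.pi := by
    intro r h0 h1
    rw [uIcc_of_le (by linarith), uIcc_of_le (by linarith)]
    exact Icc_subset_Icc le_rfl (by linarith)
  have hsub2 : ∀ r : ℝ, 0 < r → r < Real.pi → uIcc r Real.pi ⊆ uIcc (-Real.pi) Real.pi := by
    intro r h0 h1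
    rw [uIcc_of_le (by linarith), uIcc_of_le (by linarith)]
    exact Icc_subset_Icc (by linarith) le_rfl
  have hdiv : ∀ a b : ℝ, (∀ u ∈ uIcc a b, u ≠ 0) →
      IntervalIntegrable (fun u : ℝ => k / (u : ℂ)) volume a b := by
    intro a b hab
    refine ContinuousOn.intervalIntegrable ?_
    exact continuousOn_const.div (by fun_prop) fun u hu => by exact_mod_cast hab u hu
  have hint : ∀ r : ℝ, 0 < r → r < Real.pi →
      IntervalIntegrable (fun u => F (α + u)) volume (-Real.pi) (-r) ∧
      IntervalIntegrable (fun u => F (α + u)) volume r Real.pi := by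
    intro r h0 h1
    constructor
    · refine ((hR.mono_set (hsub1 r h0 h1)).add
        (hdiv _ _ fun u hu => ((hne r h0 h1).1 u hu).2)).congr fun u hu => ?_
      have := (hne r h0 h1).1 u (uIoc_subset_uIcc hu)
      exact (h u this.1 this.2).symm
    · refine ((hR.mono_set (hsub2 r h0 h1)).add
        (hdiv _ _ fun u hu => ((hne r h0 h1).2 u hu).2)).congr fun u hu => ?_
      have := (hne r h0 h1).2 u (uIoc_subset_uIcc hu)
      exact (h u this.1 this.2).symm
  refine ⟨fun r h0 h1 => ?_, ?_⟩
  · obtain ⟨h2, h3⟩ := hint r h0 h1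
    constructor
    · have := h2.comp_add_left (-α)
      simpa [sub_eq_add_neg, add_comm] using this
    · have := h3.comp_add_left (-α)
      simpa [sub_eq_add_neg, add_comm] using this
  · have key : ∀ r : ℝ, 0 < r → r < Real.pi → truncatedIntegral F α r =
        (∫ u in (-Real.pi)..Real.pi, R u) - ∫ u in (-r)..r, R u := by
      intro r h0 h1
      have e1 : ∫ β in (α - Real.pi)..(α - r), F β =
          (∫ u in (-Real.pi)..(-r), R u) + ∫ u in (-Real.pi)..(-r), k / (u : ℂ) := by
        rw [← intervalIntegral.integral_add (hR.mono_set (hsub1 r h0 h1))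
          (hdiv _ _ fun u hu => ((hne r h0 h1).1 u hu).2), sub_eq_add_neg, sub_eq_add_neg,
          ← intervalIntegral.integral_comp_add_left]
        refine intervalIntegral.integral_congr fun u hu => ?_
        have := (hne r h0 h1).1 u hu
        exact h u this.1 this.2
      have e2 : ∫ β in (α + r)..(α + Real.pi), F β =
          (∫ u in r..Real.pi, R u) + ∫ u in r..Real.pi, k / (u : ℂ) := by
        rw [← intervalIntegral.integral_add (hR.mono_set (hsub2 r h0 h1))
          (hdiv _ _ fun u hu => ((hne r h0 h1).2 u hu).2),
          ← intervalIntegral.integral_comp_add_left]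
        refine intervalIntegral.integral_congr fun u hu => ?_
        have := (hne r h0 h1).2 u hu
        exact h u this.1 this.2
      have e3 : ∫ u in (-Real.pi)..(-r), k / (u : ℂ) = -∫ u in r..Real.pi, k / (u : ℂ) := by
        rw [← intervalIntegral.integral_comp_neg, ← intervalIntegral.integral_neg]
        refine intervalIntegral.integral_congr fun u _ => ?_
        push_cast
        rw [div_neg]
      have hm : IntervalIntegrable R volume (-r) r := hR.mono_set (by
        rw [uIcc_of_le (by linarith), uIcc_of_le (by linarith)]
        exact Icc_subset_Icc (by linarith) (by linarith))
      have e4 := intervalIntegral.integral_add_adjacent_intervals (hR.mono_set (hsub1 r h0 h1)) hm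
      have e5 := intervalIntegral.integral_add_adjacent_intervals
        ((hR.mono_set (hsub1 r h0 h1)).trans hm) (hR.mono_set (hsub2 r h0 h1))
      rw [truncatedIntegral, e1, e2, e3, ← e5, ← e4]
      ring
    have hlim : Tendsto (fun r : ℝ => ∫ u in (-r)..r, R u) (𝓝[>] 0) (𝓝 0) := by
      have hc : ContinuousOn (fun x => ∫ u in (0 : ℝ)..x, R u) (uIcc (-Real.pi) Real.pi) :=
        intervalIntegral.continuousOn_primitive_interval' hR (by
          rw [uIcc_of_le (by linarith)]; constructor <;> linarith)
      have hca : ContinuousAt (fun x => ∫ u in (0 : ℝ)..x, R u) 0 := hc.continuousAt (by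
        rw [uIcc_of_le (by linarith)]; exact Icc_mem_nhds (by linarith) (by linarith))
      have h1 : Tendsto (fun r : ℝ => (∫ u in (0 : ℝ)..r, R u) - ∫ u in (0 : ℝ)..(-r), R u)
          (𝓝 0) (𝓝 0) := by
        have ha : Tendsto (fun r : ℝ => ∫ u in (0 : ℝ)..r, R u) (𝓝 0) (𝓝 0) := by
          simpa [ContinuousAt] using hca
        have hb : Tendsto (fun r : ℝ => -r) (𝓝 0) (𝓝 0) := by
          simpa using (continuous_neg (G := ℝ)).tendsto 0
        simpa using ha.sub (ha.comp hb)
      refine (h1.mono_left nhdsWithin_le_nhds).congr' ?_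
      filter_upwards [Ioo_mem_nhdsGT hpi] with r hr
      have hsub : ∀ x ∈ Icc (-r) r, IntervalIntegrable R volume 0 x := fun x hx =>
        hR.mono_set (by
          rw [uIcc_of_le (by linarith : -Real.pi ≤ Real.pi)]
          refine uIcc_subset_Icc ⟨by linarith, by linarith⟩
            ⟨by linarith [hx.1, hr.2], by linarith [hx.2, hr.2]⟩)
      exact intervalIntegral.integral_interval_sub_left
        (hsub r ⟨by linarith [hr.1], le_rfl⟩) (hsub (-r) ⟨le_rfl, by linarith [hr.1]⟩)
    have := (tendsto_const_nhds (x := ∫ u in (-Real.pi)..Real.pi, R u)).sub hlim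
    rw [sub_zero] at this
    refine this.congr' ?_
    filter_upwards [Ioo_mem_nhdsGT hpi] with r hr
    exact (key r hr.1 hr.2).symm

theorem HasPV.add {F G : ℝ → ℂ} {α : ℝ} {L M : ℂ} (hF : HasPV F α L) (hG : HasPV G α M) :
    HasPV (fun x => F x + G x) α (L + M) := by
  refine ⟨fun r h0 h1 => ⟨(hF.1 r h0 h1).1.add (hG.1 r h0 h1).1,
    (hF.1 r h0 h1).2.add (hG.1 r h0 h1).2⟩, (hF.2.add hG.2).congr' ?_⟩
  filter_upwards [Ioo_mem_nhdsGT Real.pi_pos] with r hr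
  simp only [truncatedIntegral]
  rw [intervalIntegral.integral_add (hF.1 r hr.1 hr.2).1 (hG.1 r hr.1 hr.2).1,
    intervalIntegral.integral_add (hF.1 r hr.1 hr.2).2 (hG.1 r hr.1 hr.2).2]
  ring

theorem HasPV.const_mul {F : ℝ → ℂ} {α : ℝ} {L : ℂ} (hF : HasPV F α L) (c : ℂ) :
    HasPV (fun x => c * F x) α (c * L) := by
  refine ⟨fun r h0 h1 => ⟨(hF.1 r h0 h1).1.const_mul c, (hF.1 r h0 h1).2.const_mul c⟩,
    (hF.2.const_mul c).congr fun r => ?_⟩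
  simp only [truncatedIntegral, intervalIntegral.integral_const_mul]
  ring

theorem HasPV.conj {F : ℝ → ℂ} {α : ℝ} {L : ℂ} (hF : HasPV F α L) :
    HasPV (fun x => (starRingEnd ℂ) (F x)) α ((starRingEnd ℂ) L) := by
  have hi : ∀ {a b : ℝ}, IntervalIntegrable F volume a b →
      IntervalIntegrable (fun x => (starRingEnd ℂ) (F x)) volume a b := fun h =>
    ⟨Complex.conjCLE.toContinuousLinearMap.integrable_comp h.1,
      Complex.conjCLE.toContinuousLinearMap.integrable_comp h.2⟩
  refine ⟨fun r h0 h1 => ⟨hi (hF.1 r h0 h1).1, hi (hF.1 r h0 h1).2⟩,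
    ((Complex.continuous_conj.tendsto L).comp hF.2).congr fun r => ?_⟩
  simp only [truncatedIntegral, Function.comp, map_add, intervalIntegral.intervalIntegral_conj]

theorem HasPV.unique {F : ℝ → ℂ} {α : ℝ} {L M : ℂ} (hF : HasPV F α L) (hG : HasPV F α M) :
    L = M := tendsto_nhds_unique hF.2 hG.2

/-! ### The Cauchy integral near the curve -/

/-- The regularized form of `(I - H) f`. -/
def defect (γ f : ℝ → ℂ) (α : ℝ) : ℂ :=
  -(1 / (Real.pi * Complex.I)) *
    ∫ u in (-Real.pi)..Real.pi, (f (α + u) - f α) / (γ (α + u) - γ α) * deriv γ (α + u)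

/-- The Cauchy integral of `f` over the curve `γ`. -/
def cauchyInt (γ f : ℝ → ℂ) (w : ℂ) : ℂ :=
  1 / (2 * Real.pi * Complex.I) * ∫ β in (0 : ℝ)..(2 * Real.pi), f β * (deriv γ β / (γ β - w))

theorem cauchyInt_one (γ : ℝ → ℂ) (w : ℂ) : cauchyInt γ (fun _ => 1) w = windingNumber γ w := by
  simp [cauchyInt, windingNumber]

theorem Reg.exists_bound {E : Type} [NormedAddCommGroup E] [NormedSpace ℝ E] {U : Set E}
    {n : ℕ} {Ψ : E → ℝ → ℂ} (h : Reg U n Ψ) {p : E} (hp : p ∈ U) :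
    ∃ M : ℝ, 0 ≤ M ∧ ∀ u ∈ uIcc (-Real.pi) Real.pi, u ≠ 0 → ‖Ψ p u‖ ≤ M := by
  obtain ⟨Φ, h1, h2⟩ := h
  have hc : ContinuousOn (fun u => Φ (p, u)) (uIcc (-Real.pi) Real.pi) :=
    h1.continuousOn.comp (by fun_prop) fun u hu => ⟨hp, mem_increments_of_mem_uIcc hu⟩
  obtain ⟨M, hM⟩ := isCompact_uIcc.exists_bound_of_continuousOn hc
  refine ⟨max M 0, le_max_right _ _, fun u hu h0 => ?_⟩
  rw [h2 p hp u (mem_increments_of_mem_uIcc hu) h0]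
  exact (hM u hu).trans (le_max_left _ _)

theorem half_abs_add_abs_le (u v : ℝ) : (|u| + |v|) / 2 ≤ ‖(u : ℂ) + Complex.I * v‖ := by
  have h1 := Complex.abs_re_le_norm ((u : ℂ) + Complex.I * v)
  have h2 := Complex.abs_im_le_norm ((u : ℂ) + Complex.I * v)
  simp at h1 h2
  linarith

/-! ### Distance from points on the normal line to the curve -/

section curve

variable {γ : ℝ → ℂ} (hγ : IsSmoothParam γ)
include hγ

/-- Moving a distance proportional to v along the normal separates a point from the curve at a
linear rate. For small u the linear part (u + iv)γ'(α) dominates the Taylor remainder; for the other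
u compactness and injectivity give a positive minimum. This supplies the majorants for all the
boundary limits below. -/
theorem exists_norm_lower_bound (α : ℝ) : ∃ c η : ℝ, 0 < c ∧ 0 < η ∧
    ∀ v : ℝ, |v| < η → ∀ u ∈ uIcc (-Real.pi) Real.pi,
      c * (|u| + |v|) ≤ ‖γ (α + u) - γ α + Complex.I * v * deriv γ α‖ := by
  have hpi := Real.pi_pos
  set g := deriv γ α with hg
  have hg0 : 0 < ‖g‖ := norm_pos_iff.2 (hγ.deriv_ne_zero α)
  have hd : HasDerivAt γ g α := (hγ.perC.differentiable (by norm_num) α).hasDerivAt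
  have h1 := hd.isLittleO.def (show (0 : ℝ) < ‖g‖ / 4 by positivity)
  obtain ⟨ρ, hρ, hρ'⟩ := Metric.eventually_nhds_iff.1 h1
  have h2 : ∀ u : ℝ, |u| < ρ → ‖γ (α + u) - γ α - u * g‖ ≤ ‖g‖ / 4 * |u| := by
    intro u hu
    have := hρ' (y := α + u) (by simpa [Real.dist_eq] using hu)
    simpa using this
  have hcomp : IsCompact (uIcc (-Real.pi) Real.pi ∩ {u | ρ ≤ |u|}) :=
    isCompact_uIcc.inter_right (isClosed_le continuous_const continuous_abs)
  obtain ⟨m, hm0, hm⟩ : ∃ m : ℝ, 0 < m ∧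
      ∀ u ∈ uIcc (-Real.pi) Real.pi ∩ {u | ρ ≤ |u|}, m ≤ ‖γ (α + u) - γ α‖ := by
    rcases (uIcc (-Real.pi) Real.pi ∩ {u | ρ ≤ |u|}).eq_empty_or_nonempty with he | hne
    · exact ⟨1, one_pos, by simp [he]⟩
    · have hcont : Continuous fun u => ‖γ (α + u) - γ α‖ := by
        have := hγ.perC.smooth.continuous
        fun_prop
      obtain ⟨u0, hu0, hmin⟩ := hcomp.exists_isMinOn hne hcont.continuousOn
      refine ⟨_, norm_pos_iff.2 (hγ.sub_ne_zero α (mem_increments_of_mem_uIcc hu0.1) ?_),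
        fun u hu => hmin hu⟩
      rintro rfl
      have : ρ ≤ |(0 : ℝ)| := hu0.2
      rw [abs_zero] at this
      linarith
  -- With this η the normal displacement is at most m/2, half of the minimal distance m attained
  -- away from u = 0.
  set η := m / (2 * ‖g‖) with hη
  have hη0 : 0 < η := by positivity
  refine ⟨min (‖g‖ / 4) (m / (2 * (Real.pi + η))), η, lt_min (by positivity) (by positivity),
    hη0, fun v hv u hu => ?_⟩
  have hs : 0 ≤ |u| + |v| := by positivity
  rcases lt_or_ge |u| ρ with hlt | hge
  · have h3 : (u + Complex.I * v) * g - (-(γ (α + u) - γ α - u * g)) =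
        γ (α + u) - γ α + Complex.I * v * g := by ring
    have h4 := norm_sub_norm_le ((u + Complex.I * v) * g) (-(γ (α + u) - γ α - u * g))
    rw [h3, norm_mul, norm_neg] at h4
    have h5 := h2 u hlt
    have h6 := half_abs_add_abs_le u v
    have h7 : min (‖g‖ / 4) (m / (2 * (Real.pi + η))) * (|u| + |v|) ≤ ‖g‖ / 4 * (|u| + |v|) :=
      mul_le_mul_of_nonneg_right (min_le_left _ _) hs
    nlinarith [abs_nonneg u, abs_nonneg v, mul_le_mul_of_nonneg_right h6 hg0.le,
      mul_nonneg hg0.le (abs_nonneg v), mul_nonneg hg0.le (abs_nonneg u)]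
  · have h3 := hm u ⟨hu, hge⟩
    have h4 : γ (α + u) - γ α - -(Complex.I * v * g) = γ (α + u) - γ α + Complex.I * v * g := by
      ring
    have h5 := norm_sub_norm_le (γ (α + u) - γ α) (-(Complex.I * v * g))
    rw [h4, norm_neg, norm_mul, norm_mul, Complex.norm_I, one_mul, Complex.norm_real,
      Real.norm_eq_abs] at h5
    have h6 : |v| * ‖g‖ ≤ m / 2 := by
      have : |v| * ‖g‖ ≤ η * ‖g‖ := mul_le_mul_of_nonneg_right hv.le hg0.le
      have h' : η * ‖g‖ = m / 2 := by rw [hη]; field_simp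
      linarith
    have h7 : |u| + |v| ≤ Real.pi + η := by
      rw [uIcc_of_le (by linarith)] at hu
      have := abs_le.2 hu
      linarith
    have h8 : min (‖g‖ / 4) (m / (2 * (Real.pi + η))) * (|u| + |v|) ≤
        m / (2 * (Real.pi + η)) * (Real.pi + η) :=
      mul_le_mul (min_le_right _ _) h7 hs (by positivity)
    have h9 : m / (2 * (Real.pi + η)) * (Real.pi + η) = m / 2 := by field_simp
    linarith

theorem eventually_offset_notMem_range (α : ℝ) :
    ∀ᶠ v : ℝ in 𝓝[≠] 0, γ α - Complex.I * v * deriv γ α ∉ range γ := by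
  obtain ⟨c, η, hc, hη, h⟩ := exists_norm_lower_bound hγ α
  have h1 : ∀ᶠ v : ℝ in 𝓝 0, |v| < η := by
    have := (continuous_abs (G := ℝ)).tendsto 0
    rw [abs_zero] at this
    exact this.eventually (gt_mem_nhds hη)
  filter_upwards [nhdsWithin_le_nhds h1, self_mem_nhdsWithin] with v hv hv0
  rintro ⟨β, hβ⟩
  obtain ⟨k, hk, -⟩ := existsUnique_add_zsmul_mem_Ico Real.two_pi_pos (β - α) (-Real.pi)
  have hu : β - α + k • (2 * Real.pi) ∈ uIcc (-Real.pi) Real.pi := by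
    rw [uIcc_of_le (by linarith [Real.pi_pos])]
    exact ⟨hk.1, by linarith [hk.2]⟩
  have h2 := h v hv _ hu
  rw [show α + (β - α + k • (2 * Real.pi)) = β + k • (2 * Real.pi) by ring,
    hγ.periodic.zsmul k, hβ] at h2
  rw [show γ α - Complex.I * v * deriv γ α - γ α + Complex.I * v * deriv γ α = 0 by ring,
    norm_zero] at h2
  have h3 : 0 < |v| := abs_pos.2 hv0
  nlinarith [abs_nonneg (β - α + k • (2 * Real.pi)), mul_pos hc h3,
    mul_nonneg hc.le (abs_nonneg (β - α + k • (2 * Real.pi)))]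

theorem cauchyInt_eq_shift {f : ℝ → ℂ} (hf : Function.Periodic f (2 * Real.pi)) (w : ℂ) (α : ℝ) :
    cauchyInt γ f w = 1 / (2 * Real.pi * Complex.I) * ∫ u in (-Real.pi)..Real.pi,
      f (α + u) * (deriv γ (α + u) / (γ (α + u) - w)) := by
  rw [cauchyInt, integral_shift_eq (F := fun β => f β * (deriv γ β / (γ β - w)))]
  intro x
  simp only [hf x, hγ.periodic x, hγ.perC_deriv.per x]

end curve

/-! ### The model integral of 1/(u + iv) and its one-sided limits -/

theorem integral_one_div_add (v : ℝ) (hv : v ≠ 0) :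
    ∫ u in (-Real.pi)..Real.pi, 1 / ((u : ℂ) + Complex.I * v) =
      Complex.log (Real.pi + Complex.I * v) - Complex.log (-Real.pi + Complex.I * v) := by
  have hne : ∀ u : ℝ, (u : ℂ) + Complex.I * v ∈ Complex.slitPlane := by
    intro u
    rw [Complex.mem_slitPlane_iff]
    right
    simpa using hv
  rw [intervalIntegral.integral_eq_sub_of_hasDerivAt
    (f := fun u : ℝ => Complex.log ((u : ℂ) + Complex.I * v))]
  · push_cast; rfl
  · intro u _
    have h1 : HasDerivAt (fun u : ℝ => (u : ℂ) + Complex.I * v) 1 u :=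
      (Complex.ofRealCLM.hasDerivAt (x := u)).add_const _
    exact h1.clog_real (hne u)
  · refine Continuous.intervalIntegrable ?_ _ _
    refine continuous_const.div (by fun_prop) fun u => Complex.slitPlane_ne_zero (hne u)

theorem tendsto_integral_one_div_add_right :
    Tendsto (fun v : ℝ => ∫ u in (-Real.pi)..Real.pi, 1 / ((u : ℂ) + Complex.I * v))
      (𝓝[>] 0) (𝓝 (-(Real.pi * Complex.I))) := by
  have hpi := Real.pi_pos
  have hc : Tendsto (fun v : ℝ => (Real.pi : ℂ) + Complex.I * v) (𝓝[>] 0) (𝓝 (Real.pi : ℂ)) := by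
    have : Continuous (fun v : ℝ => (Real.pi : ℂ) + Complex.I * v) := by fun_prop
    have h := this.tendsto 0
    simp only [Complex.ofReal_zero, mul_zero, add_zero] at h
    exact h.mono_left nhdsWithin_le_nhds
  have h1 := hc.clog (Complex.mem_slitPlane_iff.2 (Or.inl (by simpa using hpi)))
  -- For v > 0 the point -π + iv reaches the branch cut from above, where the logarithm tends to log
  -- π + πi; this produces the limit -πi.
  have h2 := Complex.tendsto_log_nhdsWithin_im_nonneg_of_re_neg_of_im_zero
    (z := (-Real.pi : ℂ)) (by simpa using hpi) (by simp)
  have hc' : Tendsto (fun v : ℝ => (-Real.pi : ℂ) + Complex.I * v) (𝓝[>] 0)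
      (𝓝[{z : ℂ | 0 ≤ z.im}] (-Real.pi : ℂ)) := by
    refine tendsto_nhdsWithin_iff.2 ⟨?_, ?_⟩
    · have : Continuous (fun v : ℝ => (-Real.pi : ℂ) + Complex.I * v) := by fun_prop
      have h := this.tendsto 0
      simp only [Complex.ofReal_zero, mul_zero, add_zero] at h
      exact h.mono_left nhdsWithin_le_nhds
    · filter_upwards [self_mem_nhdsWithin] with v hv
      simpa using (le_of_lt hv : (0 : ℝ) ≤ v)
  have h3 := h1.sub (h2.comp hc')
  have h4 : Complex.log (Real.pi : ℂ) - ((Real.log ‖(-Real.pi : ℂ)‖ : ℝ) + Real.pi * Complex.I) =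
      -(Real.pi * Complex.I) := by
    rw [norm_neg, Complex.norm_real, Real.norm_eq_abs, abs_of_pos hpi, Complex.ofReal_log hpi.le]
    ring
  rw [h4] at h3
  refine h3.congr' ?_
  filter_upwards [self_mem_nhdsWithin] with v hv
  exact (integral_one_div_add v (ne_of_gt hv)).symm

theorem tendsto_integral_one_div_add_left :
    Tendsto (fun v : ℝ => ∫ u in (-Real.pi)..Real.pi, 1 / ((u : ℂ) + Complex.I * v))
      (𝓝[<] 0) (𝓝 (Real.pi * Complex.I)) := by
  have h1 : Tendsto (fun v : ℝ => -v) (𝓝[<] 0) (𝓝[>] 0) := by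
    simpa using tendsto_neg_nhdsLT (a := (0 : ℝ))
  have h2 := (tendsto_integral_one_div_add_right.comp h1).neg
  rw [neg_neg] at h2
  refine h2.congr fun v => ?_
  simp only [Function.comp]
  rw [← intervalIntegral.integral_neg]
  have h3 := intervalIntegral.integral_comp_neg (a := -Real.pi) (b := Real.pi)
    (f := fun x : ℝ => 1 / ((x : ℂ) + Complex.I * v))
  rw [neg_neg] at h3
  rw [← h3]
  refine intervalIntegral.integral_congr fun u _ => ?_
  rw [← div_neg]
  push_cast
  congr 1
  ring

/-! ### Winding numbers and Cauchy integrals near the curve -/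

section curve

variable {γ : ℝ → ℂ} (hγ : IsSmoothParam γ)
include hγ

/-- Since γ(α+u) - w is approximately (u + iv)γ'(α), subtracting 1/(u + iv) leaves an integrand
bounded uniformly in v, and dominated convergence applies. The whole dependence on the side of
approach is in the limit L of the model integral. -/
theorem tendsto_windingNumber_aux (α : ℝ) {l : Filter ℝ} [l.IsCountablyGenerated]
    (hl : l ≤ 𝓝[≠] 0) {L : ℂ}
    (hL : Tendsto (fun v : ℝ => ∫ u in (-Real.pi)..Real.pi, 1 / ((u : ℂ) + Complex.I * v)) l
      (𝓝 L)) :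
    Tendsto (fun v : ℝ => windingNumber γ (γ α - Complex.I * v * deriv γ α)) l
      (𝓝 (1 / (2 * Real.pi * Complex.I) *
        ((∫ u in (-Real.pi)..Real.pi, (deriv γ (α + u) / (γ (α + u) - γ α) - 1 / u)) + L))) := by
  obtain ⟨c, η, hc, hη, h⟩ := exists_norm_lower_bound hγ α
  obtain ⟨K₁, hK₁, hk₁⟩ := (reg_kappa hγ).exists_bound (mem_univ α)
  obtain ⟨K₂, hK₂, hk₂⟩ := (reg_sub_div (n := 0) (hγ.perC.of_le (by norm_num))).exists_bound
    (mem_univ α)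
  obtain ⟨K₃, hK₃, hk₃⟩ := (reg_sub_div (n := 0) (hγ.perC_deriv.of_le (by norm_num))).exists_bound
    (mem_univ α)
  set g := deriv γ α with hg
  have hev : ∀ᶠ v : ℝ in l, |v| < η ∧ v ≠ 0 := by
    have h1 : ∀ᶠ v : ℝ in 𝓝 0, |v| < η := by
      have := (continuous_abs (G := ℝ)).tendsto 0
      rw [abs_zero] at this
      exact this.eventually (gt_mem_nhds hη)
    exact hl ((eventually_nhdsWithin_of_eventually_nhds h1).and self_mem_nhdsWithin)
  have hpos : ∀ v : ℝ, v ≠ 0 → ∀ u : ℝ, 0 < |u| + |v| := fun v hv u => by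
    have := abs_pos.2 hv
    positivity
  have hden : ∀ v : ℝ, |v| < η → v ≠ 0 → ∀ u ∈ uIcc (-Real.pi) Real.pi,
      γ (α + u) - (γ α - Complex.I * v * g) ≠ 0 := by
    intro v hv hv0 u hu
    have h1 := h v hv u hu
    rw [← norm_pos_iff, show γ (α + u) - (γ α - Complex.I * v * g) =
      γ (α + u) - γ α + Complex.I * v * g by ring]
    exact (mul_pos hc (hpos v hv0 u)).trans_le h1
  have hden' : ∀ v : ℝ, v ≠ 0 → ∀ u : ℝ, (u : ℂ) + Complex.I * v ≠ 0 := by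
    intro v hv0 u
    rw [← norm_pos_iff]
    have := half_abs_add_abs_le u v
    have := hpos v hv0 u
    linarith
  have hint1 : ∀ v : ℝ, |v| < η → v ≠ 0 → IntervalIntegrable
      (fun u => deriv γ (α + u) / (γ (α + u) - (γ α - Complex.I * v * g))) volume
      (-Real.pi) Real.pi := by
    intro v hv hv0
    have h1 := hγ.perC_deriv.smooth.continuous
    have h2 := hγ.perC.smooth.continuous
    exact (ContinuousOn.div (by fun_prop) (by fun_prop) (hden v hv hv0)).intervalIntegrable
  have hint2 : ∀ v : ℝ, v ≠ 0 → IntervalIntegrable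
      (fun u : ℝ => 1 / ((u : ℂ) + Complex.I * v)) volume (-Real.pi) Real.pi := by
    intro v hv0
    exact (ContinuousOn.div (by fun_prop) (by fun_prop) fun u _ =>
      hden' v hv0 u).intervalIntegrable
  have hlim : Tendsto (fun v : ℝ => ∫ u in (-Real.pi)..Real.pi,
      (deriv γ (α + u) / (γ (α + u) - (γ α - Complex.I * v * g)) - 1 / ((u : ℂ) + Complex.I * v)))
      l (𝓝 (∫ u in (-Real.pi)..Real.pi, (deriv γ (α + u) / (γ (α + u) - γ α) - 1 / u))) := by
    refine intervalIntegral.tendsto_integral_filter_of_dominated_convergence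
      (fun _ => 2 * (K₁ * K₂ + K₃) / c) ?_ ?_ intervalIntegrable_const ?_
    · filter_upwards [hev] with v hv
      exact (intervalIntegrable_iff.1 ((hint1 v hv.1 hv.2).sub (hint2 v hv.2))).aestronglyMeasurable
    · filter_upwards [hev] with v ⟨hv, hv0⟩
      have h0 : ∀ᵐ u : ℝ ∂volume, u ≠ 0 := by simp [ae_iff]
      filter_upwards [h0] with u hu0 hu
      replace hu := uIoc_subset_uIcc hu
      have hZ := hγ.sub_ne_zero α (mem_increments_of_mem_uIcc hu) hu0
      have huC : (u : ℂ) ≠ 0 := by exact_mod_cast hu0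
      have hd1 := hden v hv hv0 u hu
      have hd2 := hden' v hv0 u
      have b1 := hk₁ u hu hu0
      have b2 := hk₂ u hu hu0
      have b3 := hk₃ u hu hu0
      have hab : 0 < |u| := abs_pos.2 hu0
      rw [norm_div, Complex.norm_real, Real.norm_eq_abs, div_le_iff₀ hab] at b2 b3
      -- Over the common denominator the numerator is O((|u| + |v|)²), while the denominator is at
      -- least c(|u| + |v|)²/2. Their ratio gives the constant majorant.
      have e1 : deriv γ (α + u) / (γ (α + u) - (γ α - Complex.I * v * g)) -
          1 / ((u : ℂ) + Complex.I * v) =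
          (u * (γ (α + u) - γ α) * (deriv γ (α + u) / (γ (α + u) - γ α) - 1 / u) +
            Complex.I * v * (deriv γ (α + u) - g)) /
          ((γ (α + u) - (γ α - Complex.I * v * g)) * ((u : ℂ) + Complex.I * v)) := by
        rw [div_sub_div _ _ hd1 hd2]
        congr 1
        field_simp
        ring
      rw [e1, norm_div, norm_mul (γ (α + u) - (γ α - Complex.I * v * g))]
      have n1 : c * (|u| + |v|) * ((|u| + |v|) / 2) ≤
          ‖γ (α + u) - (γ α - Complex.I * v * g)‖ * ‖(u : ℂ) + Complex.I * v‖ := by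
        have := h v hv u hu
        rw [show γ (α + u) - γ α + Complex.I * v * g =
          γ (α + u) - (γ α - Complex.I * v * g) by ring] at this
        exact mul_le_mul this (half_abs_add_abs_le u v) (by positivity) (norm_nonneg _)
      have n2 : ‖u * (γ (α + u) - γ α) * (deriv γ (α + u) / (γ (α + u) - γ α) - 1 / u) +
            Complex.I * v * (deriv γ (α + u) - g)‖ ≤ (K₁ * K₂ + K₃) * (|u| + |v|) ^ 2 := by
        refine (norm_add_le _ _).trans ?_
        rw [norm_mul, norm_mul, norm_mul, norm_mul, Complex.norm_I, Complex.norm_real,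
          Complex.norm_real, Real.norm_eq_abs, Real.norm_eq_abs, one_mul]
        have m1 : |u| * ‖γ (α + u) - γ α‖ * ‖deriv γ (α + u) / (γ (α + u) - γ α) - 1 / u‖ ≤
            |u| * (K₂ * |u|) * K₁ :=
          mul_le_mul (mul_le_mul_of_nonneg_left b2 hab.le) b1 (norm_nonneg _) (by positivity)
        have m2 : |v| * ‖deriv γ (α + u) - g‖ ≤ |v| * (K₃ * |u|) :=
          mul_le_mul_of_nonneg_left b3 (abs_nonneg v)
        have m3 : 0 ≤ K₁ * K₂ := by positivity
        have m4 : 0 ≤ |u| * |v| := by positivity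
        nlinarith [mul_nonneg m3 m4, mul_nonneg hK₃ m4, mul_nonneg m3 (sq_nonneg |v|),
          mul_nonneg hK₃ (sq_nonneg |v|), mul_nonneg hK₃ (sq_nonneg |u|)]
      have hp := hpos v hv0 u
      calc _ ≤ (K₁ * K₂ + K₃) * (|u| + |v|) ^ 2 / (c * (|u| + |v|) * ((|u| + |v|) / 2)) :=
            div_le_div₀ (by positivity) n2 (by positivity) n1
        _ = 2 * (K₁ * K₂ + K₃) / c := by field_simp
    · have h0 : ∀ᵐ u : ℝ ∂volume, u ≠ 0 := by simp [ae_iff]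
      filter_upwards [h0] with u hu0 hu
      replace hu := uIoc_subset_uIcc hu
      have hZ := hγ.sub_ne_zero α (mem_increments_of_mem_uIcc hu) hu0
      have huC : (u : ℂ) ≠ 0 := by exact_mod_cast hu0
      have hv : Tendsto (fun v : ℝ => (v : ℂ)) l (𝓝 0) := by
        have := (Complex.continuous_ofReal.tendsto 0)
        rw [Complex.ofReal_zero] at this
        exact this.mono_left (hl.trans nhdsWithin_le_nhds)
      have t1 : Tendsto (fun v : ℝ => γ (α + u) - (γ α - Complex.I * v * g)) l
          (𝓝 (γ (α + u) - γ α)) := by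
        have := ((hv.const_mul Complex.I).mul_const g).const_sub (γ α) |>.const_sub (γ (α + u))
        simpa using this
      have t2 : Tendsto (fun v : ℝ => (u : ℂ) + Complex.I * v) l (𝓝 u) := by
        have := (hv.const_mul Complex.I).const_add (u : ℂ)
        simpa using this
      exact (tendsto_const_nhds.div t1 hZ).sub (tendsto_const_nhds.div t2 huC)
  refine ((hlim.add hL).const_mul (1 / (2 * Real.pi * Complex.I))).congr' ?_
  filter_upwards [hev] with v ⟨hv, hv0⟩
  rw [← cauchyInt_one, cauchyInt_eq_shift hγ (fun _ => rfl) _ α,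
    intervalIntegral.integral_sub (hint1 v hv hv0) (hint2 v hv0), sub_add_cancel]
  simp only [one_mul]

theorem windingNumber_eq_zero_or_one {w : ℂ} (hw : w ∉ range γ) :
    windingNumber γ w = 0 ∨ windingNumber γ w = 1 := by
  by_cases h : windingNumber γ w = 0
  · exact Or.inl h
  · exact Or.inr (hγ.winding w ⟨hw, h⟩)

theorem mem_zero_one_of_tendsto_windingNumber (α : ℝ) {l : Filter ℝ} [l.NeBot]
    (hl : l ≤ 𝓝[≠] 0) {N : ℂ}
    (h : Tendsto (fun v : ℝ => windingNumber γ (γ α - Complex.I * v * deriv γ α)) l (𝓝 N)) :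
    N = 0 ∨ N = 1 := by
  have hc : IsClosed ({0, 1} : Set ℂ) := (Set.toFinite _).isClosed
  refine hc.mem_of_tendsto h ?_
  filter_upwards [hl (eventually_offset_notMem_range hγ α)] with v hv
  exact windingNumber_eq_zero_or_one hγ hv

/-- The winding number tends to (K - πi)/(2πi) on one side of the curve and to (K + πi)/(2πi) on the
other. Both limits lie in {0, 1} and they differ by 1, so the first is 0 and K = πi. This is H1 = 1,
and it identifies the side v > 0 as the exterior. -/
theorem integral_kappa (α : ℝ) :
    ∫ u in (-Real.pi)..Real.pi, (deriv γ (α + u) / (γ (α + u) - γ α) - 1 / u) =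
      Real.pi * Complex.I := by
  have hr := mem_zero_one_of_tendsto_windingNumber hγ α
    (nhdsGT_le_nhdsNE 0)
    (tendsto_windingNumber_aux hγ α (nhdsGT_le_nhdsNE 0)
      tendsto_integral_one_div_add_right)
  have hl := mem_zero_one_of_tendsto_windingNumber hγ α
    (nhdsLT_le_nhdsNE 0)
    (tendsto_windingNumber_aux hγ α (nhdsLT_le_nhdsNE 0)
      tendsto_integral_one_div_add_left)
  set K := ∫ u in (-Real.pi)..Real.pi, (deriv γ (α + u) / (γ (α + u) - γ α) - 1 / u)
  have hne : (2 * Real.pi * Complex.I : ℂ) ≠ 0 := by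
    simp [Real.pi_ne_zero]
  have hpiI : (Real.pi * Complex.I : ℂ) ≠ 0 := by
    simp [Real.pi_ne_zero]
  rw [one_div_mul_eq_div, div_eq_zero_iff, div_eq_one_iff_eq hne] at hr hl
  simp only [hne, or_false] at hr hl
  rcases hr with hr | hr
  · linear_combination hr
  · rcases hl with hl | hl
    · exfalso
      apply hpiI
      linear_combination (hl - hr) / 4
    · exfalso
      apply hpiI
      linear_combination (hl - hr) / 2

theorem eventually_windingNumber_eq_zero (α : ℝ) :
    ∀ᶠ v : ℝ in 𝓝[>] 0, windingNumber γ (γ α - Complex.I * v * deriv γ α) = 0 := by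
  have h1 := tendsto_windingNumber_aux hγ α (nhdsGT_le_nhdsNE 0)
      tendsto_integral_one_div_add_right
  rw [integral_kappa hγ, add_neg_cancel, mul_zero] at h1
  have h2 : ∀ᶠ x : ℂ in 𝓝 0, x ≠ 1 := isOpen_ne.mem_nhds (by simp)
  filter_upwards [h1.eventually h2, nhdsGT_le_nhdsNE 0
    (eventually_offset_notMem_range hγ α)] with v hv1 hv2
  exact (windingNumber_eq_zero_or_one hγ hv2).resolve_right hv1

/-- The exterior boundary values of a Cauchy integral. -/
theorem tendsto_cauchyInt {f : ℝ → ℂ} (hf : PerC 1 f) (α : ℝ) :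
    Tendsto (fun v : ℝ => cauchyInt γ f (γ α - Complex.I * v * deriv γ α)) (𝓝[>] 0)
      (𝓝 (-(1 / 2) * defect γ f α)) := by
  obtain ⟨c, η, hc, hη, h⟩ := exists_norm_lower_bound hγ α
  obtain ⟨K₁, hK₁, hk₁⟩ := (reg_sub_div (n := 0) hf).exists_bound (mem_univ α)
  obtain ⟨K₂, hK₂, hk₂⟩ := (reg_shift hγ.perC_deriv).exists_bound (mem_univ α)
  set g := deriv γ α with hg
  have hev : ∀ᶠ v : ℝ in 𝓝[>] 0, |v| < η ∧ v ≠ 0 := by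
    have h1 : ∀ᶠ v : ℝ in 𝓝 0, |v| < η := by
      have := (continuous_abs (G := ℝ)).tendsto 0
      rw [abs_zero] at this
      exact this.eventually (gt_mem_nhds hη)
    filter_upwards [nhdsWithin_le_nhds h1, self_mem_nhdsWithin] with v h2 h3
      using ⟨h2, ne_of_gt h3⟩
  have hnorm : ∀ v : ℝ, |v| < η → ∀ u ∈ uIcc (-Real.pi) Real.pi,
      c * (|u| + |v|) ≤ ‖γ (α + u) - (γ α - Complex.I * v * g)‖ := by
    intro v hv u hu
    rw [show γ (α + u) - (γ α - Complex.I * v * g) =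
      γ (α + u) - γ α + Complex.I * v * g by ring]
    exact h v hv u hu
  have hden : ∀ v : ℝ, |v| < η → v ≠ 0 → ∀ u ∈ uIcc (-Real.pi) Real.pi,
      γ (α + u) - (γ α - Complex.I * v * g) ≠ 0 := by
    intro v hv hv0 u hu
    rw [← norm_pos_iff]
    have := abs_pos.2 hv0
    exact (mul_pos hc (by positivity)).trans_le (hnorm v hv u hu)
  have hdc : Continuous (deriv γ) := hγ.perC_deriv.smooth.continuous
  have hgc : Continuous γ := hγ.perC.smooth.continuous
  have hfc : Continuous f := hf.smooth.continuous
  have hint1 : ∀ v : ℝ, |v| < η → v ≠ 0 → IntervalIntegrable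
      (fun u => deriv γ (α + u) / (γ (α + u) - (γ α - Complex.I * v * g))) volume
      (-Real.pi) Real.pi := fun v hv hv0 =>
    (ContinuousOn.div (by fun_prop) (by fun_prop) (hden v hv hv0)).intervalIntegrable
  have hint2 : ∀ v : ℝ, |v| < η → v ≠ 0 → IntervalIntegrable
      (fun u => (f (α + u) - f α) * (deriv γ (α + u) / (γ (α + u) - (γ α - Complex.I * v * g))))
      volume (-Real.pi) Real.pi := fun v hv hv0 =>
    (hint1 v hv hv0).continuousOn_mul (by fun_prop)
  have hlim : Tendsto (fun v : ℝ => ∫ u in (-Real.pi)..Real.pi,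
      (f (α + u) - f α) * (deriv γ (α + u) / (γ (α + u) - (γ α - Complex.I * v * g))))
      (𝓝[>] 0) (𝓝 (∫ u in (-Real.pi)..Real.pi,
        (f (α + u) - f α) / (γ (α + u) - γ α) * deriv γ (α + u))) := by
    refine intervalIntegral.tendsto_integral_filter_of_dominated_convergence
      (fun _ => K₁ * K₂ / c) ?_ ?_ intervalIntegrable_const ?_
    · filter_upwards [hev] with v hv
      exact (intervalIntegrable_iff.1 (hint2 v hv.1 hv.2)).aestronglyMeasurable
    · filter_upwards [hev] with v ⟨hv, hv0⟩
      have h0 : ∀ᵐ u : ℝ ∂volume, u ≠ 0 := by simp [ae_iff]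
      filter_upwards [h0] with u hu0 hu
      replace hu := uIoc_subset_uIcc hu
      have b1 := hk₁ u hu hu0
      have b2 := hk₂ u hu hu0
      have hab : 0 < |u| := abs_pos.2 hu0
      rw [norm_div, Complex.norm_real, Real.norm_eq_abs, div_le_iff₀ hab] at b1
      have b3 : c * |u| ≤ ‖γ (α + u) - (γ α - Complex.I * v * g)‖ := by
        have := hnorm v hv u hu
        nlinarith [mul_nonneg hc.le (abs_nonneg v)]
      rw [norm_mul, norm_div]
      calc _ ≤ (K₁ * |u|) * (K₂ / (c * |u|)) := by
            refine mul_le_mul b1 (div_le_div₀ hK₂ b2 (by positivity) b3) (by positivity)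
              (by positivity)
        _ = K₁ * K₂ / c := by field_simp
    · have h0 : ∀ᵐ u : ℝ ∂volume, u ≠ 0 := by simp [ae_iff]
      filter_upwards [h0] with u hu0 hu
      replace hu := uIoc_subset_uIcc hu
      have hZ := hγ.sub_ne_zero α (mem_increments_of_mem_uIcc hu) hu0
      have hv : Tendsto (fun v : ℝ => (v : ℂ)) (𝓝[>] 0) (𝓝 0) := by
        have := (Complex.continuous_ofReal.tendsto 0)
        rw [Complex.ofReal_zero] at this
        exact this.mono_left nhdsWithin_le_nhds
      have t1 : Tendsto (fun v : ℝ => γ (α + u) - (γ α - Complex.I * v * g)) (𝓝[>] 0)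
          (𝓝 (γ (α + u) - γ α)) := by
        have := ((hv.const_mul Complex.I).mul_const g).const_sub (γ α) |>.const_sub (γ (α + u))
        simpa using this
      have t2 : Tendsto (fun v : ℝ => deriv γ (α + u) / (γ (α + u) - (γ α - Complex.I * v * g)))
          (𝓝[>] 0) (𝓝 (deriv γ (α + u) / (γ (α + u) - γ α))) := tendsto_const_nhds.div t1 hZ
      rw [div_mul_eq_mul_div, ← mul_div_assoc']
      exact t2.const_mul _
  have hlim2 := hlim.const_mul (1 / (2 * Real.pi * Complex.I))
  have e0 : -(1 / 2) * defect γ f α = 1 / (2 * Real.pi * Complex.I) *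
      ∫ u in (-Real.pi)..Real.pi, (f (α + u) - f α) / (γ (α + u) - γ α) * deriv γ (α + u) := by
    rw [defect]
    ring
  rw [e0]
  refine hlim2.congr' ?_
  -- Outside the curve the winding number is zero, so the constant f(α) can be subtracted from the
  -- density without changing the Cauchy integral.
  filter_upwards [hev, eventually_windingNumber_eq_zero hγ α] with v ⟨hv, hv0⟩ hw
  rw [← cauchyInt_one, cauchyInt_eq_shift hγ (fun _ => rfl) _ α] at hw
  simp only [one_mul] at hw
  rw [cauchyInt_eq_shift hγ hf.per _ α]
  have e1 : ∫ u in (-Real.pi)..Real.pi,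
      f (α + u) * (deriv γ (α + u) / (γ (α + u) - (γ α - Complex.I * v * g))) =
      (∫ u in (-Real.pi)..Real.pi,
      (f (α + u) - f α) * (deriv γ (α + u) / (γ (α + u) - (γ α - Complex.I * v * g)))) +
      f α * ∫ u in (-Real.pi)..Real.pi,
        deriv γ (α + u) / (γ (α + u) - (γ α - Complex.I * v * g)) := by
    rw [← intervalIntegral.integral_const_mul,
      ← intervalIntegral.integral_add (hint2 v hv hv0) ((hint1 v hv hv0).const_mul _)]
    exact intervalIntegral.integral_congr fun u _ => by ring
  rw [e1]
  linear_combination -f α * hw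

end curve

/-! ### Products of Cauchy integrals -/

theorem Reg.integral_integral_comm {Ψ : ℝ → ℝ → ℂ} (h : Reg univ 0 Ψ) :
    ∫ σ in (-Real.pi)..Real.pi, ∫ u in (-Real.pi)..Real.pi, Ψ σ u =
      ∫ u in (-Real.pi)..Real.pi, ∫ σ in (-Real.pi)..Real.pi, Ψ σ u := by
  obtain ⟨Φ, h1, h2⟩ := h
  have hc : ContinuousOn (Function.uncurry fun σ u => Φ (σ, u))
      (uIcc (-Real.pi) Real.pi ×ˢ uIcc (-Real.pi) Real.pi) :=
    h1.continuousOn.mono fun x hx => ⟨mem_univ _, mem_increments_of_mem_uIcc hx.2⟩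
  have e1 : ∫ σ in (-Real.pi)..Real.pi, ∫ u in (-Real.pi)..Real.pi, Ψ σ u =
      ∫ σ in (-Real.pi)..Real.pi, ∫ u in (-Real.pi)..Real.pi, Φ (σ, u) :=
    intervalIntegral.integral_congr fun σ _ =>
      integral_congr_increments fun u hu h0 => h2 σ (mem_univ _) u hu h0
  have e2 : ∫ u in (-Real.pi)..Real.pi, ∫ σ in (-Real.pi)..Real.pi, Ψ σ u =
      ∫ u in (-Real.pi)..Real.pi, ∫ σ in (-Real.pi)..Real.pi, Φ (σ, u) :=
    integral_congr_increments fun u hu h0 =>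
      intervalIntegral.integral_congr fun σ _ => h2 σ (mem_univ _) u hu h0
  rw [e1, e2]
  exact intervalIntegral_intervalIntegral_swap
    ((hc.integrableOn_compact (isCompact_uIcc.prod isCompact_uIcc)).mono_set
      (prod_mono uIoc_subset_uIcc uIoc_subset_uIcc))

theorem Reg.swap {n : ℕ} {Ψ : ℝ → ℝ → ℂ} (h : Reg univ n Ψ) :
    Reg univ n (fun σ u => Ψ (σ + u) (-u)) := by
  obtain ⟨Φ, h1, h2⟩ := h
  have hm : ∀ u ∈ increments, -u ∈ increments := fun u hu =>
    ⟨by linarith [hu.2], by linarith [hu.1]⟩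
  exact ⟨fun x => Φ (x.1 + x.2, -x.2), h1.comp (by fun_prop) fun x hx => ⟨mem_univ _, hm _ hx.2⟩,
    fun σ _ u hu h0 => h2 (σ + u) (mem_univ _) (-u) (hm u hu) (neg_ne_zero.2 h0)⟩

/-- Exchanging two points σ and σ + u of the curve, in the coordinates (base point, increment), is
the map (σ, u) ↦ (σ + u, -u). It is used to symmetrize double contour integrals. -/
theorem Reg.integral_swap {Ψ : ℝ → ℝ → ℂ} (h : Reg univ 0 Ψ)
    (hper : ∀ u, Function.Periodic (fun σ => Ψ σ u) (2 * Real.pi)) :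
    ∫ σ in (-Real.pi)..Real.pi, ∫ u in (-Real.pi)..Real.pi, Ψ σ u =
      ∫ σ in (-Real.pi)..Real.pi, ∫ u in (-Real.pi)..Real.pi, Ψ (σ + u) (-u) := by
  rw [h.integral_integral_comm, h.swap.integral_integral_comm]
  have h3 := intervalIntegral.integral_comp_neg (a := -Real.pi) (b := Real.pi)
    (f := fun u => ∫ σ in (-Real.pi)..Real.pi, Ψ σ u)
  rw [neg_neg] at h3
  rw [← h3]
  exact intervalIntegral.integral_congr fun u _ => (integral_shift_eq' (hper (-u)) u).symm

section curve

variable {γ : ℝ → ℂ} (hγ : IsSmoothParam γ)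
include hγ

theorem PerC.defect {n : ℕ} (hn : n ≤ 2) {f : ℝ → ℂ} (hf : PerC (n + 1) f) :
    PerC n (defect γ f) := by
  refine ⟨?_, fun x => ?_⟩
  · have h := ((reg_quot hγ hn hf).mul
      ((reg_shift hγ.perC_deriv).of_le hn)).contDiffOn_integral isOpen_univ
    rw [contDiffOn_univ] at h
    exact contDiff_const.mul h
  · simp only [EulerPoisson.defect]
    congr 1
    refine intervalIntegral.integral_congr fun u _ => ?_
    simp only [show x + 2 * Real.pi + u = x + u + 2 * Real.pi by ring, hf.per _, hγ.periodic _,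
      hγ.perC_deriv.per _]

theorem perC_kernel {w : ℂ} (hw : w ∉ range γ) : PerC 2 (fun σ => deriv γ σ / (γ σ - w)) :=
  hγ.perC_deriv.div ((hγ.perC.of_le (by norm_num)).sub (PerC.const w)) fun x h =>
    hw ⟨x, sub_eq_zero.1 h⟩

theorem cauchyInt_eq {f : ℝ → ℂ} (hf : Function.Periodic f (2 * Real.pi)) (w : ℂ) :
    2 * Real.pi * Complex.I * cauchyInt γ f w =
      ∫ σ in (-Real.pi)..Real.pi, f σ * (deriv γ σ / (γ σ - w)) := by
  rw [cauchyInt_eq_shift hγ hf w 0]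
  simp only [zero_add]
  have hne : (2 * Real.pi * Complex.I : ℂ) ≠ 0 := by simp [Real.pi_ne_zero]
  field_simp

/-- The factor Cauchy(1) - 1 depends on the side of the curve. The two singular densities cannot be
integrated separately, so the pole is first split as 1/u plus the regular kernel κ, whose integral
is known to be πi. -/
theorem integral_integral_defect_kernel {w : ℂ} (hw : w ∉ range γ) {k : ℝ → ℂ} (hk : PerC 1 k) :
    ∫ σ in (-Real.pi)..Real.pi, ∫ u in (-Real.pi)..Real.pi, deriv γ σ / (γ σ - w) *
      ((k (σ + u) - k σ) / (γ (σ + u) - γ σ) * deriv γ (σ + u)) =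
    (2 * Real.pi * Complex.I) ^ 2 * ((cauchyInt γ (fun _ => 1) w - 1) * cauchyInt γ k w) := by
  set φ : ℝ → ℂ := fun σ => deriv γ σ / (γ σ - w) with hφ
  have hφC : PerC 2 φ := perC_kernel hγ hw
  have hφ1 : PerC 1 φ := hφC.of_le (by norm_num)
  have hφ0 : PerC 0 φ := hφC.of_le (by norm_num)
  have hk0 : PerC 0 k := hk.of_le (by norm_num)
  have hwne : ∀ x, γ x - w ≠ 0 := fun x h => hw ⟨x, sub_eq_zero.1 h⟩
  set κ : ℝ → ℝ → ℂ := fun σ u => deriv γ (σ + u) / (γ (σ + u) - γ σ) - 1 / u with hκ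
  have hκR : Reg univ 0 κ := (reg_kappa hγ).of_le (by norm_num)
  have hκper : ∀ u, Function.Periodic (fun σ => κ σ u) (2 * Real.pi) := fun u x => by
    simp only [hκ, show x + 2 * Real.pi + u = x + u + 2 * Real.pi by ring, hγ.periodic _,
      hγ.perC_deriv.per _]
  have hsh : ∀ {f : ℝ → ℂ}, PerC 0 f → ∀ x u : ℝ, f (x + 2 * Real.pi + u) = f (x + u) :=
    fun hf x u => by rw [show x + 2 * Real.pi + u = x + u + 2 * Real.pi by ring, hf.per]
  -- the three parts of the integrand
  have R1 : Reg univ 0 (fun σ u => φ σ * k (σ + u) * κ σ u) :=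
    ((reg_base hφ0).mul (reg_shift hk0)).mul hκR
  have R2 : Reg univ 0 (fun σ u => φ σ * k σ * κ σ u) :=
    ((reg_base hφ0).mul (reg_base hk0)).mul hκR
  have R3 : Reg univ 0 (fun σ u => (φ (σ + u) * k (σ + u) - φ σ * k σ) / u) :=
    reg_sub_div (hφ1.mul hk)
  have R4 : Reg univ 0 (fun σ u => k (σ + u) * ((φ (σ + u) - φ σ) / u)) :=
    (reg_shift hk0).mul (reg_sub_div hφ1)
  have R5 : Reg univ 0 (fun σ u => φ σ * k σ * φ (σ + u)) :=
    ((reg_base hφ0).mul (reg_base hk0)).mul (reg_shift hφ0)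
  -- For fixed u the numerator is a translate of a periodic function minus the function itself, so
  -- its σ-integral vanishes.
  have I3 : ∫ σ in (-Real.pi)..Real.pi, ∫ u in (-Real.pi)..Real.pi,
      (φ (σ + u) * k (σ + u) - φ σ * k σ) / u = 0 := by
    rw [R3.integral_integral_comm]
    have : ∀ u ∈ uIcc (-Real.pi) Real.pi, ∫ σ in (-Real.pi)..Real.pi,
        (φ (σ + u) * k (σ + u) - φ σ * k σ) / u = 0 := by
      intro u _
      have hc : Continuous fun σ => φ σ * k σ := (hφ0.mul hk0).smooth.continuous
      have hc' : Continuous fun σ => φ (σ + u) * k (σ + u) := hc.comp (continuous_add_const u)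
      rw [intervalIntegral.integral_div, intervalIntegral.integral_sub
        (hc'.intervalIntegrable _ _) (hc.intervalIntegrable _ _),
        integral_shift_eq' (F := fun σ => φ σ * k σ) (hφ0.mul hk0).per, sub_self, zero_div]
    rw [intervalIntegral.integral_congr this]
    simp
  have hii : ∀ {Ψ : ℝ → ℝ → ℂ}, Reg univ 0 Ψ → IntervalIntegrable
      (fun σ => ∫ u in (-Real.pi)..Real.pi, Ψ σ u) volume (-Real.pi) Real.pi := fun h => by
    have := h.contDiffOn_integral isOpen_univ
    rw [contDiffOn_univ] at this
    exact this.continuous.intervalIntegrable _ _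
  have hadd : ∀ {Ψ₁ Ψ₂ : ℝ → ℝ → ℂ}, Reg univ 0 Ψ₁ → Reg univ 0 Ψ₂ →
      ∫ σ in (-Real.pi)..Real.pi, ∫ u in (-Real.pi)..Real.pi, (Ψ₁ σ u + Ψ₂ σ u) =
      (∫ σ in (-Real.pi)..Real.pi, ∫ u in (-Real.pi)..Real.pi, Ψ₁ σ u) +
      ∫ σ in (-Real.pi)..Real.pi, ∫ u in (-Real.pi)..Real.pi, Ψ₂ σ u := fun h1 h2 => by
    rw [← intervalIntegral.integral_add (hii h1) (hii h2)]
    exact intervalIntegral.integral_congr fun σ _ => intervalIntegral.integral_add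
      (h1.intervalIntegrable (mem_univ _)) (h2.intervalIntegrable (mem_univ _))
  have E1 : ∫ σ in (-Real.pi)..Real.pi, ∫ u in (-Real.pi)..Real.pi, φ σ *
      ((k (σ + u) - k σ) / (γ (σ + u) - γ σ) * deriv γ (σ + u)) =
      ∫ σ in (-Real.pi)..Real.pi, ∫ u in (-Real.pi)..Real.pi,
        ((φ σ * k (σ + u) * κ σ u + (-(k (σ + u) * ((φ (σ + u) - φ σ) / u)))) +
        (-(φ σ * k σ * κ σ u) + (φ (σ + u) * k (σ + u) - φ σ * k σ) / u)) := by
    refine intervalIntegral.integral_congr fun σ _ => integral_congr_increments fun u hu h0 => ?_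
    have h1 := hγ.sub_ne_zero σ hu h0
    have h2 : (u : ℂ) ≠ 0 := by exact_mod_cast h0
    simp only [hκ]
    field_simp
    ring
  -- The two points of the curve are exchanged; partial fractions in γ(σ) - w and γ(σ+u) - w then
  -- leave a product of two Cauchy kernels and a second copy of the κ term.
  have E2 : ∫ σ in (-Real.pi)..Real.pi, ∫ u in (-Real.pi)..Real.pi,
      (φ σ * k (σ + u) * κ σ u + (-(k (σ + u) * ((φ (σ + u) - φ σ) / u)))) =
      ∫ σ in (-Real.pi)..Real.pi, ∫ u in (-Real.pi)..Real.pi,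
        (φ σ * k σ * φ (σ + u) + (-(φ σ * k σ * κ σ u))) := by
    rw [(R1.add R4.neg).integral_swap fun u x => by
      have a1 := hκper u x
      simp only at a1 ⊢
      rw [a1, hsh hk0, hsh hφ0, hφ0.per]]
    refine intervalIntegral.integral_congr fun σ _ => integral_congr_increments fun u hu h0 => ?_
    have h1 := hγ.sub_ne_zero σ hu h0
    have h1' : γ σ - γ (σ + u) ≠ 0 := fun h => h1 (by linear_combination -h)
    have h2 : (u : ℂ) ≠ 0 := by exact_mod_cast h0
    have h3 := hwne σ
    have h4 := hwne (σ + u)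
    simp only [hκ, hφ, add_neg_cancel_right, Complex.ofReal_neg]
    field_simp
    ring
  rw [E1, hadd (R1.add R4.neg) (R2.neg.add R3), E2, hadd R5 R2.neg, hadd R2.neg R3, I3]
  have E3 : ∫ σ in (-Real.pi)..Real.pi, ∫ u in (-Real.pi)..Real.pi, φ σ * k σ * φ (σ + u) =
      (2 * Real.pi * Complex.I) ^ 2 * (cauchyInt γ (fun _ => 1) w * cauchyInt γ k w) := by
    have e : (2 * Real.pi * Complex.I : ℂ) ^ 2 * (cauchyInt γ (fun _ => 1) w * cauchyInt γ k w) =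
      (2 * Real.pi * Complex.I * cauchyInt γ k w) *
        (2 * Real.pi * Complex.I * cauchyInt γ (fun _ => 1) w) := by ring
    rw [e, cauchyInt_eq hγ hk.per, cauchyInt_eq hγ (fun _ => rfl),
      ← intervalIntegral.integral_mul_const]
    refine intervalIntegral.integral_congr fun σ _ => ?_
    rw [intervalIntegral.integral_const_mul]
    have := integral_shift_eq' (F := φ) hφ0.per σ
    simp only [add_comm _ σ] at this
    rw [this]
    simp only [one_mul, hφ]
    ring
  have E4 : ∫ σ in (-Real.pi)..Real.pi, ∫ u in (-Real.pi)..Real.pi, -(φ σ * k σ * κ σ u) =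
      -((2 * Real.pi * Complex.I) ^ 2 * (cauchyInt γ k w) / 2) := by
    have e : -((2 * Real.pi * Complex.I : ℂ) ^ 2 * (cauchyInt γ k w) / 2) =
      (2 * Real.pi * Complex.I * cauchyInt γ k w) * (-(Real.pi * Complex.I)) := by ring
    rw [e, cauchyInt_eq hγ hk.per, ← intervalIntegral.integral_mul_const]
    refine intervalIntegral.integral_congr fun σ _ => ?_
    rw [intervalIntegral.integral_neg, intervalIntegral.integral_const_mul]
    have := integral_kappa hγ σ
    simp only [hκ]
    rw [this]
    simp only [hφ]
    ring
  rw [E3, E4]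
  ring

/-- The product formula for Cauchy integrals. -/
theorem cauchyInt_mul {w : ℂ} (hw : w ∉ range γ) {g h : ℝ → ℂ} (hg : PerC 1 g) (hh : PerC 1 h)
    (hAg : PerC 0 (defect γ g)) (hAh : PerC 0 (defect γ h)) :
    cauchyInt γ (fun x => g x * defect γ h x + h x * defect γ g x - 2 * (g x * h x)) w =
      -2 * (cauchyInt γ g w * cauchyInt γ h w) := by
  set φ : ℝ → ℂ := fun σ => deriv γ σ / (γ σ - w) with hφ
  have hφC : PerC 2 φ := perC_kernel hγ hw
  have hφ0 : PerC 0 φ := hφC.of_le (by norm_num)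
  have hg0 : PerC 0 g := hg.of_le (by norm_num)
  have hh0 : PerC 0 h := hh.of_le (by norm_num)
  have hd0 : PerC 0 (deriv γ) := hγ.perC_deriv.of_le (by norm_num)
  have hwne : ∀ x, γ x - w ≠ 0 := fun x h => hw ⟨x, sub_eq_zero.1 h⟩
  have hsh : ∀ {f : ℝ → ℂ}, PerC 0 f → ∀ x u : ℝ, f (x + 2 * Real.pi + u) = f (x + u) :=
    fun hf x u => by rw [show x + 2 * Real.pi + u = x + u + 2 * Real.pi by ring, hf.per]
  have hγ0 : PerC 0 γ := hγ.perC.of_le (by norm_num)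
  have hQ : ∀ {f : ℝ → ℂ}, PerC 1 f →
      Reg univ 0 (fun σ u => (f (σ + u) - f σ) / (γ (σ + u) - γ σ)) := fun hf =>
    reg_quot hγ (by norm_num) hf
  have hii : ∀ {Ψ : ℝ → ℝ → ℂ}, Reg univ 0 Ψ → IntervalIntegrable
      (fun σ => ∫ u in (-Real.pi)..Real.pi, Ψ σ u) volume (-Real.pi) Real.pi := fun h => by
    have := h.contDiffOn_integral isOpen_univ
    rw [contDiffOn_univ] at this
    exact this.continuous.intervalIntegrable _ _
  have hadd : ∀ {Ψ₁ Ψ₂ : ℝ → ℝ → ℂ}, Reg univ 0 Ψ₁ → Reg univ 0 Ψ₂ →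
      ∫ σ in (-Real.pi)..Real.pi, ∫ u in (-Real.pi)..Real.pi, (Ψ₁ σ u + Ψ₂ σ u) =
      (∫ σ in (-Real.pi)..Real.pi, ∫ u in (-Real.pi)..Real.pi, Ψ₁ σ u) +
      ∫ σ in (-Real.pi)..Real.pi, ∫ u in (-Real.pi)..Real.pi, Ψ₂ σ u := fun h1 h2 => by
    rw [← intervalIntegral.integral_add (hii h1) (hii h2)]
    exact intervalIntegral.integral_congr fun σ _ => intervalIntegral.integral_add
      (h1.intervalIntegrable (mem_univ _)) (h2.intervalIntegrable (mem_univ _))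
  -- the double integrals for `g A h` and `h A g`
  have RA : Reg univ 0 (fun σ u => φ σ * g σ *
      ((h (σ + u) - h σ) / (γ (σ + u) - γ σ) * deriv γ (σ + u))) :=
    ((reg_base hφ0).mul (reg_base hg0)).mul ((hQ hh).mul (reg_shift hd0))
  have RB : Reg univ 0 (fun σ u => φ σ * h σ *
      ((g (σ + u) - g σ) / (γ (σ + u) - γ σ) * deriv γ (σ + u))) :=
    ((reg_base hφ0).mul (reg_base hh0)).mul ((hQ hg).mul (reg_shift hd0))
  have RC : Reg univ 0 (fun σ u => φ σ * g σ * (φ (σ + u) * h (σ + u))) :=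
    ((reg_base hφ0).mul (reg_base hg0)).mul ((reg_shift hφ0).mul (reg_shift hh0))
  have RD : Reg univ 0 (fun σ u => -(φ σ * (g σ * h σ) * φ (σ + u))) :=
    (((reg_base hφ0).mul ((reg_base hg0).mul (reg_base hh0))).mul (reg_shift hφ0)).neg
  have RE : Reg univ 0 (fun σ u => φ σ * ((g (σ + u) * h (σ + u) - g σ * h σ) /
      (γ (σ + u) - γ σ) * deriv γ (σ + u))) :=
    (reg_base hφ0).mul ((hQ (hg.mul hh)).mul (reg_shift hd0))
  have hX := integral_integral_defect_kernel hγ hw (hg.mul hh)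
  have hgA : ∫ σ in (-Real.pi)..Real.pi, g σ * defect γ h σ * φ σ = -(1 / (Real.pi * Complex.I)) *
      ∫ σ in (-Real.pi)..Real.pi, ∫ u in (-Real.pi)..Real.pi, φ σ * g σ *
      ((h (σ + u) - h σ) / (γ (σ + u) - γ σ) * deriv γ (σ + u)) := by
    rw [← intervalIntegral.integral_const_mul]
    refine intervalIntegral.integral_congr fun σ _ => ?_
    simp only [intervalIntegral.integral_const_mul, defect]
    ring
  have hhA : ∫ σ in (-Real.pi)..Real.pi, h σ * defect γ g σ * φ σ = -(1 / (Real.pi * Complex.I)) *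
      ∫ σ in (-Real.pi)..Real.pi, ∫ u in (-Real.pi)..Real.pi, φ σ * h σ *
      ((g (σ + u) - g σ) / (γ (σ + u) - γ σ) * deriv γ (σ + u)) := by
    rw [← intervalIntegral.integral_const_mul]
    refine intervalIntegral.integral_congr fun σ _ => ?_
    simp only [intervalIntegral.integral_const_mul, defect]
    ring
  have hprod : ∀ {a b : ℝ → ℂ}, PerC 0 a → PerC 0 b →
      ∫ σ in (-Real.pi)..Real.pi, ∫ u in (-Real.pi)..Real.pi, φ σ * a σ * (φ (σ + u) * b (σ + u)) =
      (2 * Real.pi * Complex.I) ^ 2 * (cauchyInt γ a w * cauchyInt γ b w) := by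
    intro a b ha hb
    have e : (2 * Real.pi * Complex.I : ℂ) ^ 2 * (cauchyInt γ a w * cauchyInt γ b w) =
      (2 * Real.pi * Complex.I * cauchyInt γ a w) *
        (2 * Real.pi * Complex.I * cauchyInt γ b w) := by ring
    rw [e, cauchyInt_eq hγ ha.per, cauchyInt_eq hγ hb.per, ← intervalIntegral.integral_mul_const]
    refine intervalIntegral.integral_congr fun σ _ => ?_
    rw [intervalIntegral.integral_const_mul]
    have := integral_shift_eq' (F := fun x => φ x * b x) (hφ0.mul hb).per σ
    simp only [add_comm _ σ] at this
    rw [this]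
    simp only [hφ, mul_comm]
  have hsum : (∫ σ in (-Real.pi)..Real.pi, ∫ u in (-Real.pi)..Real.pi, φ σ * g σ *
      ((h (σ + u) - h σ) / (γ (σ + u) - γ σ) * deriv γ (σ + u))) +
      (∫ σ in (-Real.pi)..Real.pi, ∫ u in (-Real.pi)..Real.pi, φ σ * h σ *
      ((g (σ + u) - g σ) / (γ (σ + u) - γ σ) * deriv γ (σ + u))) =
      (2 * Real.pi * Complex.I) ^ 2 * (cauchyInt γ g w * cauchyInt γ h w -
        cauchyInt γ (fun x => g x * h x) w) := by
    have hE : ∫ σ in (-Real.pi)..Real.pi, ∫ u in (-Real.pi)..Real.pi,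
        φ σ * ((g (σ + u) * h (σ + u) - g σ * h σ) / (γ (σ + u) - γ σ) * deriv γ (σ + u)) =
        ∫ σ in (-Real.pi)..Real.pi, ∫ u in (-Real.pi)..Real.pi,
        φ (σ + u) * ((g (σ + u + -u) * h (σ + u + -u) - g (σ + u) * h (σ + u)) /
          (γ (σ + u + -u) - γ (σ + u)) * deriv γ (σ + u + -u)) :=
      RE.integral_swap fun u x => by
        simp only [hsh hg0, hsh hh0, hsh hγ0, hsh hd0, hg.per x, hh.per x, hφ0.per x,
          hγ.periodic x]
    have RE' := RE.swap
    have hD : ∫ σ in (-Real.pi)..Real.pi, ∫ u in (-Real.pi)..Real.pi,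
        -(φ σ * (g σ * h σ) * φ (σ + u)) =
        -((2 * Real.pi * Complex.I) ^ 2 * (cauchyInt γ (fun x => g x * h x) w *
          cauchyInt γ (fun _ => 1) w)) := by
      have := hprod (hg0.mul hh0) (PerC.const 1)
      simp only [mul_one] at this
      rw [← this, ← intervalIntegral.integral_neg]
      refine intervalIntegral.integral_congr fun σ _ => ?_
      exact intervalIntegral.integral_neg
    have hB := RB.integral_swap fun u x => by
        simp only [hsh hg0, hsh hγ0, hsh hd0, hg.per x, hh.per x, hφ0.per x, hγ.periodic x]
    rw [hB, ← hadd RA RB.swap]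
    -- After exchanging the points in the second integral, both integrands carry the same pole
    -- 1/(γ(σ+u) - γ(σ)). Expanding the numerators leaves a pure product of Cauchy kernels and terms
    -- in gh alone, covered by the preceding lemma. The side-dependent Cauchy integrals of 1 cancel,
    -- so the formula holds on both sides of the curve.
    have e3 : ∫ σ in (-Real.pi)..Real.pi, ∫ u in (-Real.pi)..Real.pi, (φ σ * g σ *
        ((h (σ + u) - h σ) / (γ (σ + u) - γ σ) * deriv γ (σ + u)) + φ (σ + u) * h (σ + u) *
        ((g (σ + u + -u) - g (σ + u)) / (γ (σ + u + -u) - γ (σ + u)) * deriv γ (σ + u + -u))) =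
        ∫ σ in (-Real.pi)..Real.pi, ∫ u in (-Real.pi)..Real.pi,
          ((φ σ * g σ * (φ (σ + u) * h (σ + u)) + -(φ σ * (g σ * h σ) * φ (σ + u))) +
          φ (σ + u) * ((g (σ + u + -u) * h (σ + u + -u) - g (σ + u) * h (σ + u)) /
          (γ (σ + u + -u) - γ (σ + u)) * deriv γ (σ + u + -u))) := by
      refine intervalIntegral.integral_congr fun σ _ => integral_congr_increments fun u hu h0 => ?_
      have h1 := hγ.sub_ne_zero σ hu h0
      have h1' : γ σ - γ (σ + u) ≠ 0 := fun h => h1 (by linear_combination -h)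
      have h3 := hwne σ
      have h4 := hwne (σ + u)
      simp only [hφ, add_neg_cancel_right]
      field_simp
      ring
    rw [e3, hadd (RC.add RD) RE', ← hE, hadd RC RD, hX, hD, hprod hg0 hh0]
    ring
  have hφc := hφ0.smooth.continuous
  have hgc := hg0.smooth.continuous
  have hhc := hh0.smooth.continuous
  have hAgc := hAg.smooth.continuous
  have hAhc := hAh.smooth.continuous
  have hne : (2 * Real.pi * Complex.I : ℂ) ≠ 0 := by simp [Real.pi_ne_zero]
  have hpi : (Real.pi : ℂ) ≠ 0 := by simp [Real.pi_ne_zero]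
  have hPper : Function.Periodic
      (fun x => g x * defect γ h x + h x * defect γ g x - 2 * (g x * h x)) (2 * Real.pi) :=
    (((hg0.mul hAh).add (hh0.mul hAg)).sub ((PerC.const 2).mul (hg0.mul hh0))).per
  apply mul_left_cancel₀ hne
  rw [cauchyInt_eq hγ hPper]
  have e4 : ∫ σ in (-Real.pi)..Real.pi, (g σ * defect γ h σ + h σ * defect γ g σ -
      2 * (g σ * h σ)) * (deriv γ σ / (γ σ - w)) =
      (∫ σ in (-Real.pi)..Real.pi, g σ * defect γ h σ * φ σ) +
      (∫ σ in (-Real.pi)..Real.pi, h σ * defect γ g σ * φ σ) -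
      2 * ∫ σ in (-Real.pi)..Real.pi, g σ * h σ * φ σ := by
    rw [← intervalIntegral.integral_const_mul, ← intervalIntegral.integral_add
      (Continuous.intervalIntegrable (by fun_prop) _ _)
      (Continuous.intervalIntegrable (by fun_prop) _ _), ← intervalIntegral.integral_sub
      (Continuous.intervalIntegrable (by fun_prop) _ _)
      (Continuous.intervalIntegrable (by fun_prop) _ _)]
    refine intervalIntegral.integral_congr fun σ _ => ?_
    simp only [hφ]
    ring
  rw [e4, hgA, hhA, ← mul_add, hsum, ← cauchyInt_eq hγ (hg0.mul hh0).per]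
  field_simp
  ring

/-- The product formula for the defect `I - H`. -/
theorem defect_mul {g h : ℝ → ℂ} (hg : PerC 1 g) (hh : PerC 1 h) (hAg : PerC 1 (defect γ g))
    (hAh : PerC 1 (defect γ h)) (α : ℝ) :
    defect γ (fun x => g x * defect γ h x + h x * defect γ g x - 2 * (g x * h x)) α =
      defect γ g α * defect γ h α := by
  -- Each Cauchy integral tends to -1/2 times A of its density from the exterior, so the factor -2
  -- in the product formula becomes -2 · (1/4) = -1/2 and matches the left-hand side.
  have h1 := tendsto_cauchyInt hγ
    (((hg.mul hAh).add (hh.mul hAg)).sub ((PerC.const 2).mul (hg.mul hh))) α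
  have h2 := ((tendsto_cauchyInt hγ hg α).mul (tendsto_cauchyInt hγ hh α)).const_mul (-2)
  have h3 := tendsto_nhds_unique (h1.congr' ?_) h2
  · linear_combination -2 * h3
  · filter_upwards [nhdsGT_le_nhdsNE 0 (eventually_offset_notMem_range hγ α)] with v hv
    exact cauchyInt_mul hγ hv hg hh (hAg.of_le (by norm_num)) (hAh.of_le (by norm_num))

end curve

/-! ### Smooth functions of time and the Lagrangian parameter -/

/-- `f t α` is of class `C^n` on `S × ℝ`. -/
def Sm (S : Set ℝ) (n : ℕ) (f : ℝ → ℝ → ℂ) : Prop :=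
  ContDiffOn ℝ n (fun p : ℝ × ℝ => f p.1 p.2) (S ×ˢ univ)

namespace Sm

variable {S : Set ℝ} {n m : ℕ} {f g : ℝ → ℝ → ℂ}

theorem of_le (hf : Sm S n f) (h : m ≤ n) : Sm S m f := ContDiffOn.of_le hf (by exact_mod_cast h)

theorem congr (hf : Sm S n f) (h : ∀ t ∈ S, ∀ α, g t α = f t α) : Sm S n g :=
  ContDiffOn.congr hf fun p hp => h p.1 hp.1 p.2

theorem add (hf : Sm S n f) (hg : Sm S n g) : Sm S n (f + g) := ContDiffOn.add hf hg

theorem sub (hf : Sm S n f) (hg : Sm S n g) : Sm S n (f - g) := ContDiffOn.sub hf hg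

theorem mul (hf : Sm S n f) (hg : Sm S n g) : Sm S n (f * g) := ContDiffOn.mul hf hg

theorem const (c : ℂ) : Sm S n (fun _ _ => c) := contDiffOn_const

theorem inv (hf : Sm S n f) (h : ∀ t ∈ S, ∀ α, f t α ≠ 0) : Sm S n f⁻¹ :=
  ContDiffOn.inv hf fun p hp => h p.1 hp.1 p.2

theorem div (hf : Sm S n f) (hg : Sm S n g) (h : ∀ t ∈ S, ∀ α, g t α ≠ 0) : Sm S n (f / g) := by
  rw [div_eq_mul_inv]
  exact hf.mul (hg.inv h)

theorem bar (hf : Sm S n f) : Sm S n (bar f) := Complex.conjCLE.contDiff.comp_contDiffOn hf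

section calculus

variable (hS : IsOpen S)
include hS

theorem hasFDerivAt (hf : Sm S n f) (hn : 1 ≤ n) {t : ℝ} (ht : t ∈ S) (α : ℝ) :
    HasFDerivAt (fun p : ℝ × ℝ => f p.1 p.2) (fderiv ℝ (fun p : ℝ × ℝ => f p.1 p.2) (t, α))
      (t, α) :=
  ((ContDiffOn.differentiableOn hf (by exact_mod_cast (by omega : n ≠ 0))).differentiableAt
    ((hS.prod isOpen_univ).mem_nhds ⟨ht, mem_univ α⟩)).hasFDerivAt

theorem hasDerivAt_fst (hf : Sm S n f) (hn : 1 ≤ n) {t : ℝ} (ht : t ∈ S) (α : ℝ) :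
    HasDerivAt (fun s => f s α) (fderiv ℝ (fun p : ℝ × ℝ => f p.1 p.2) (t, α) (1, 0)) t := by
  have h2 : HasDerivAt (fun s : ℝ => (s, α)) ((1 : ℝ), (0 : ℝ)) t :=
    (hasDerivAt_id t).prodMk (hasDerivAt_const t α)
  exact HasFDerivAt.comp_hasDerivAt (f := fun s : ℝ => (s, α)) t
    (hf.hasFDerivAt hS hn ht α) h2

theorem hasDerivAt_snd (hf : Sm S n f) (hn : 1 ≤ n) {t : ℝ} (ht : t ∈ S) (α : ℝ) :
    HasDerivAt (f t) (fderiv ℝ (fun p : ℝ × ℝ => f p.1 p.2) (t, α) (0, 1)) α := by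
  have h2 : HasDerivAt (fun s : ℝ => (t, s)) ((0 : ℝ), (1 : ℝ)) α :=
    (hasDerivAt_const α t).prodMk (hasDerivAt_id α)
  exact HasFDerivAt.comp_hasDerivAt (f := fun s : ℝ => (t, s)) α
    (hf.hasFDerivAt hS hn ht α) h2

theorem hasDerivAt_dt (hf : Sm S n f) (hn : 1 ≤ n) {t : ℝ} (ht : t ∈ S) (α : ℝ) :
    HasDerivAt (fun s => f s α) (EulerPoisson.dt f t α) t :=
  (hf.hasDerivAt_fst hS hn ht α).differentiableAt.hasDerivAt

theorem hasDerivAt_da (hf : Sm S n f) (hn : 1 ≤ n) {t : ℝ} (ht : t ∈ S) (α : ℝ) :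
    HasDerivAt (f t) (EulerPoisson.da f t α) α :=
  (hf.hasDerivAt_snd hS hn ht α).differentiableAt.hasDerivAt

theorem dt_eq (hf : Sm S n f) (hn : 1 ≤ n) {t : ℝ} (ht : t ∈ S) (α : ℝ) :
    EulerPoisson.dt f t α = fderiv ℝ (fun p : ℝ × ℝ => f p.1 p.2) (t, α) (1, 0) :=
  (hf.hasDerivAt_fst hS hn ht α).deriv

theorem da_eq (hf : Sm S n f) (hn : 1 ≤ n) {t : ℝ} (ht : t ∈ S) (α : ℝ) :
    EulerPoisson.da f t α = fderiv ℝ (fun p : ℝ × ℝ => f p.1 p.2) (t, α) (0, 1) :=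
  (hf.hasDerivAt_snd hS hn ht α).deriv

theorem dt (hf : Sm S (n + 1) f) : Sm S n (EulerPoisson.dt f) := by
  have h1 : ContDiffOn ℝ n (fun p => fderiv ℝ (fun p : ℝ × ℝ => f p.1 p.2) p (1, 0))
      (S ×ˢ univ) :=
    (ContDiffOn.fderiv_of_isOpen hf (hS.prod isOpen_univ) (by simp)).clm_apply contDiffOn_const
  exact h1.congr fun p hp => hf.dt_eq hS (by omega) hp.1 p.2

theorem da (hf : Sm S (n + 1) f) : Sm S n (EulerPoisson.da f) := by
  have h1 : ContDiffOn ℝ n (fun p => fderiv ℝ (fun p : ℝ × ℝ => f p.1 p.2) p (0, 1))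
      (S ×ˢ univ) :=
    (ContDiffOn.fderiv_of_isOpen hf (hS.prod isOpen_univ) (by simp)).clm_apply contDiffOn_const
  exact h1.congr fun p hp => hf.da_eq hS (by omega) hp.1 p.2

theorem dt_da (hf : Sm S 2 f) {t : ℝ} (ht : t ∈ S) (α : ℝ) :
    EulerPoisson.dt (EulerPoisson.da f) t α = EulerPoisson.da (EulerPoisson.dt f) t α := by
  have hO : IsOpen (S ×ˢ (univ : Set ℝ)) := hS.prod isOpen_univ
  set F : ℝ × ℝ → ℂ := fun p => f p.1 p.2 with hF
  have hm : S ×ˢ (univ : Set ℝ) ∈ 𝓝 (t, α) := hO.mem_nhds ⟨ht, mem_univ α⟩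
  have hsymm : IsSymmSndFDerivAt ℝ F (t, α) :=
    (ContDiffOn.contDiffAt hf hm).isSymmSndFDerivAt (by simp)
  have hd : HasFDerivAt (fderiv ℝ F) (fderiv ℝ (fderiv ℝ F) (t, α)) (t, α) :=
    (((ContDiffOn.fderiv_of_isOpen hf hO (m := 1) (by norm_num)).differentiableOn
      one_ne_zero).differentiableAt hm).hasFDerivAt
  have h1 : HasDerivAt (fun s : ℝ => (s, α)) ((1 : ℝ), (0 : ℝ)) t :=
    (hasDerivAt_id t).prodMk (hasDerivAt_const t α)
  have h2 : HasDerivAt (fun s : ℝ => (t, s)) ((0 : ℝ), (1 : ℝ)) α :=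
    (hasDerivAt_const α t).prodMk (hasDerivAt_id α)
  have h3 : HasDerivAt (fun s => fderiv ℝ F (s, α)) (fderiv ℝ (fderiv ℝ F) (t, α) (1, 0)) t :=
    HasFDerivAt.comp_hasDerivAt (f := fun s : ℝ => (s, α)) t hd h1
  have h4 : HasDerivAt (fun s => fderiv ℝ F (t, s)) (fderiv ℝ (fderiv ℝ F) (t, α) (0, 1)) α :=
    HasFDerivAt.comp_hasDerivAt (f := fun s : ℝ => (t, s)) α hd h2
  have h5 : HasDerivAt (fun s => fderiv ℝ F (s, α) (0, 1))
      (fderiv ℝ (fderiv ℝ F) (t, α) (1, 0) (0, 1)) t := by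
    simpa using h3.clm_apply (hasDerivAt_const t ((0 : ℝ), (1 : ℝ)))
  have h6 : HasDerivAt (fun s => fderiv ℝ F (t, s) (1, 0))
      (fderiv ℝ (fderiv ℝ F) (t, α) (0, 1) (1, 0)) α := by
    simpa using h4.clm_apply (hasDerivAt_const α ((1 : ℝ), (0 : ℝ)))
  have h7 : (fun s => EulerPoisson.da f s α) =ᶠ[𝓝 t] fun s => fderiv ℝ F (s, α) (0, 1) := by
    filter_upwards [hS.mem_nhds ht] with s hs
    exact hf.da_eq hS (by norm_num) hs α
  have h8 : EulerPoisson.dt f t = fun s => fderiv ℝ F (t, s) (1, 0) :=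
    funext fun s => hf.dt_eq hS (by norm_num) ht s
  have e1 : EulerPoisson.dt (EulerPoisson.da f) t α =
      fderiv ℝ (fderiv ℝ F) (t, α) (1, 0) (0, 1) := by
    rw [EulerPoisson.dt, h7.deriv_eq, h5.deriv]
  have e2 : EulerPoisson.da (EulerPoisson.dt f) t α =
      fderiv ℝ (fderiv ℝ F) (t, α) (0, 1) (1, 0) := by
    rw [EulerPoisson.da, h8, h6.deriv]
  rw [e1, e2]
  exact hsymm (1, 0) (0, 1)

end calculus

theorem slice (hf : Sm S n f) {t : ℝ} (ht : t ∈ S) : ContDiff ℝ n (f t) := by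
  have h : ContDiffOn ℝ n (fun α => f t α) univ :=
    ContDiffOn.comp (g := fun p : ℝ × ℝ => f p.1 p.2) hf (f := fun α => (t, α))
      (by fun_prop) fun α _ => ⟨ht, mem_univ α⟩
  exact contDiffOn_univ.1 h

end Sm

/-- Regular integrands depending on one parameter `s` and the increment `u`. -/
theorem Sm.reg {S : Set ℝ} {n : ℕ} {f : ℝ → ℝ → ℂ} (hf : Sm S n f) : Reg S n f :=
  Reg.of_contDiffOn (Φ := fun p : ℝ × ℝ => f p.1 p.2)
    (ContDiffOn.mono hf (prod_mono le_rfl (subset_univ _)))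

/-! ### Differentiation of singular integrals with respect to a parameter -/

section parameter

variable {S : Set ℝ} (hS : IsOpen S) {ζ f : ℝ → ℝ → ℂ}
include hS

theorem reg_quot_param {n : ℕ} (hζ : Sm S (n + 1) ζ) (hf : Sm S (n + 1) f)
    (h0 : ∀ s ∈ S, ∀ u ∈ increments, u ≠ 0 → ζ s u ≠ ζ s 0) (h1 : ∀ s ∈ S, da ζ s 0 ≠ 0) :
    Reg S n (fun s u => (f s u - f s 0) / (ζ s u - ζ s 0)) := by
  have hsub : S ×ˢ increments ⊆ S ×ˢ univ := prod_mono le_rfl (subset_univ _)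
  have a1 := Reg.div_increment hS (n := n) (g := fun p : ℝ × ℝ => f p.1 p.2)
    (ContDiffOn.mono hf hsub)
  have a2 := Reg.increment_div hS (n := n) (g := fun p : ℝ × ℝ => ζ p.1 p.2)
    (ContDiffOn.mono hζ hsub) h0
    (fun s hs => by rw [← hζ.da_eq hS (by omega) hs]; exact h1 s hs)
  refine (a1.mul a2).congr fun s hs u hu hu0 => ?_
  have b1 : ζ s u - ζ s 0 ≠ 0 := sub_ne_zero.2 (h0 s hs u hu hu0)
  have b2 : (u : ℂ) ≠ 0 := by exact_mod_cast hu0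
  field_simp

/-- Differentiating the quotient directly gives a term with the squared denominator and one with
ζ_tu. Together they equal the u-derivative of Θ = Δf Δζ_t / Δζ minus Δζ_t f_u / Δζ, where Δ is the
increment from 0 to u. Periodicity makes the integral of Θ_u vanish. The same lemma serves for time
derivatives and, with translation as the parameter, for derivatives along the curve. -/
theorem hasDerivAt_integral_quot (hζ : Sm S 2 ζ) (hf : Sm S 2 f)
    (h0 : ∀ s ∈ S, ∀ u ∈ increments, u ≠ 0 → ζ s u ≠ ζ s 0) (h1 : ∀ s ∈ S, da ζ s 0 ≠ 0)
    (hζp : ∀ s ∈ S, ζ s Real.pi = ζ s (-Real.pi)) (hfp : ∀ s ∈ S, f s Real.pi = f s (-Real.pi))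
    {s : ℝ} (hs : s ∈ S) :
    HasDerivAt (fun s => ∫ u in (-Real.pi)..Real.pi,
        (f s u - f s 0) / (ζ s u - ζ s 0) * da ζ s u)
      ((∫ u in (-Real.pi)..Real.pi, (dt f s u - dt f s 0) / (ζ s u - ζ s 0) * da ζ s u) -
        ∫ u in (-Real.pi)..Real.pi, (dt ζ s u - dt ζ s 0) / (ζ s u - ζ s 0) * da f s u) s := by
  have hζ1 : Sm S 1 ζ := hζ.of_le (by norm_num)
  have hda : Sm S 1 (da ζ) := hζ.da hS
  have hdt : Sm S 1 (dt ζ) := hζ.dt hS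
  have hdf : Sm S 1 (dt f) := hf.dt hS
  have hdaf : Sm S 1 (da f) := hf.da hS
  have R := (reg_quot_param hS (n := 1) hζ hf h0 h1).mul hda.reg
  have Ra : Reg S 0 (fun s u => (dt f s u - dt f s 0) / (ζ s u - ζ s 0) * da ζ s u) :=
    (reg_quot_param hS (n := 0) hζ1 hdf h0 h1).mul (hda.reg.of_le (by norm_num))
  have Rb : Reg S 0 (fun s u => (dt ζ s u - dt ζ s 0) / (ζ s u - ζ s 0) * da f s u) :=
    (reg_quot_param hS (n := 0) hζ1 hdt h0 h1).mul (hdaf.reg.of_le (by norm_num))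
  have Rbase : Reg S 1 (fun s _ => dt ζ s 0) := by
    refine Reg.of_contDiffOn (Φ := fun p : ℝ × ℝ => dt ζ p.1 0) ?_
    exact ContDiffOn.comp (g := fun p : ℝ × ℝ => dt ζ p.1 p.2) hdt
      (f := fun p : ℝ × ℝ => (p.1, 0)) (by fun_prop) fun p hp => ⟨hp.1, mem_univ _⟩
  -- Θ is the function whose total u-derivative is discarded.
  have RΘ : Reg S 1 (fun s u => (f s u - f s 0) / (ζ s u - ζ s 0) * (dt ζ s u - dt ζ s 0)) :=
    (reg_quot_param hS (n := 1) hζ hf h0 h1).mul (hdt.reg.sub Rbase)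
  have hper : dt ζ s Real.pi = dt ζ s (-Real.pi) := by
    have : (fun x => ζ x Real.pi) =ᶠ[𝓝 s] fun x => ζ x (-Real.pi) := by
      filter_upwards [hS.mem_nhds hs] with x hx using hζp x hx
    exact this.deriv_eq
  have hΘ := RΘ.integral_deriv_eq_zero hS hs (by
    simp only [hζp s hs, hfp s hs, hper])
  refine (R.hasDerivAt_integral hS hs).congr_deriv ?_
  rw [← intervalIntegral.integral_sub (Ra.intervalIntegrable hs) (Rb.intervalIntegrable hs)]
  have hder : ∀ u ∈ increments, u ≠ 0 → HasDerivAt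
      (fun u => (f s u - f s 0) / (ζ s u - ζ s 0) * (dt ζ s u - dt ζ s 0))
      ((da f s u * (ζ s u - ζ s 0) - (f s u - f s 0) * da ζ s u) / (ζ s u - ζ s 0) ^ 2 *
        (dt ζ s u - dt ζ s 0) + (f s u - f s 0) / (ζ s u - ζ s 0) * da (dt ζ) s u) u := by
    intro u hu hu0
    have b1 : ζ s u - ζ s 0 ≠ 0 := sub_ne_zero.2 (h0 s hs u hu hu0)
    have c1 := (hf.hasDerivAt_da hS (by norm_num) hs u).sub_const (f s 0)
    have c2 := (hζ.hasDerivAt_da hS (by norm_num) hs u).sub_const (ζ s 0)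
    have c3 := (hdt.hasDerivAt_da hS (by norm_num) hs u).sub_const (dt ζ s 0)
    exact (c1.div c2 b1).mul c3
  have hI : IntervalIntegrable (fun u => deriv (fun u => (f s u - f s 0) / (ζ s u - ζ s 0) *
      (dt ζ s u - dt ζ s 0)) u) volume (-Real.pi) Real.pi := by
    have Rc : Reg S 0 (fun s u => (da f s u * ((dt ζ s u - dt ζ s 0) / (ζ s u - ζ s 0)) -
        (f s u - f s 0) / (ζ s u - ζ s 0) * ((dt ζ s u - dt ζ s 0) / (ζ s u - ζ s 0)) * da ζ s u) +
        (f s u - f s 0) / (ζ s u - ζ s 0) * da (dt ζ) s u) :=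
      (((hdaf.reg.of_le (by norm_num)).mul (reg_quot_param hS (n := 0) hζ1 hdt h0 h1)).sub
        (((reg_quot_param hS (n := 0) hζ1 (hf.of_le (by norm_num)) h0 h1).mul
          (reg_quot_param hS (n := 0) hζ1 hdt h0 h1)).mul (hda.reg.of_le (by norm_num)))).add
        ((reg_quot_param hS (n := 0) hζ1 (hf.of_le (by norm_num)) h0 h1).mul (hdt.da hS).reg)
    refine (Rc.intervalIntegrable hs).congr_ae ?_
    have hz : ∀ᵐ u : ℝ ∂volume, u ≠ 0 := by simp [ae_iff]
    filter_upwards [ae_restrict_of_ae hz, ae_restrict_mem measurableSet_uIoc] with u hu0 hu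
    have hu' := mem_increments_of_mem_uIcc (uIoc_subset_uIcc hu)
    have b1 : ζ s u - ζ s 0 ≠ 0 := sub_ne_zero.2 (h0 s hs u hu' hu0)
    rw [(hder u hu' hu0).deriv]
    field_simp
  have hRab := (Ra.sub Rb).intervalIntegrable hs
  rw [← add_zero (∫ u in (-Real.pi)..Real.pi, _ - _), ← hΘ,
    ← intervalIntegral.integral_add hRab hI]
  refine integral_congr_increments fun u hu hu0 => ?_
  have b1 : ζ s u - ζ s 0 ≠ 0 := sub_ne_zero.2 (h0 s hs u hu hu0)
  have c1 := (hf.hasDerivAt_dt hS (by norm_num) hs u).sub (hf.hasDerivAt_dt hS (by norm_num) hs 0)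
  have c2 := (hζ.hasDerivAt_dt hS (by norm_num) hs u).sub (hζ.hasDerivAt_dt hS (by norm_num) hs 0)
  have c3 := hda.hasDerivAt_dt hS (by norm_num) hs u
  have c4 := ((c1.div c2 b1).mul c3).deriv
  rw [hζ.dt_da hS hs u] at c4
  refine c4.trans ?_
  rw [(hder u hu hu0).deriv]
  simp only [Pi.sub_apply, Pi.div_apply]
  field_simp
  ring

end parameter

/-! ### Algebra of the operator `I - H` at a fixed time -/

/-- The integral of `f` along the curve. -/
def contour (γ f : ℝ → ℂ) : ℂ := ∫ β in (0 : ℝ)..(2 * Real.pi), f β * deriv γ β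

/-- The singular integral `(1 / π i) ∫ (f(β) - f(α)) / (γ(β) - γ(α)) g_β(β) dβ`. -/
def mixed (γ f g : ℝ → ℂ) (α : ℝ) : ℂ :=
  1 / (Real.pi * Complex.I) *
    ∫ u in (-Real.pi)..Real.pi, (f (α + u) - f α) / (γ (α + u) - γ α) * deriv g (α + u)

theorem pi_mul_I_ne_zero : (Real.pi * Complex.I : ℂ) ≠ 0 := by simp [Real.pi_ne_zero]

theorem defect_congr {γ f g : ℝ → ℂ} (h : ∀ x, f x = g x) (α : ℝ) :
    defect γ f α = defect γ g α := by rw [funext h]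

theorem defect_const_mul (γ f : ℝ → ℂ) (c : ℂ) (α : ℝ) :
    defect γ (fun x => c * f x) α = c * defect γ f α := by
  simp only [defect, ← mul_sub, mul_div_assoc, mul_assoc, intervalIntegral.integral_const_mul]
  ring

theorem defect_const (γ : ℝ → ℂ) (c : ℂ) (α : ℝ) : defect γ (fun _ => c) α = 0 := by
  simp [defect]

theorem integral_deriv_shift {f : ℝ → ℂ} (hf : PerC 1 f) (α : ℝ) :
    ∫ u in (-Real.pi)..Real.pi, deriv f (α + u) = 0 := by
  have h := (reg_shift hf).integral_deriv_eq_zero isOpen_univ (mem_univ α) (hf.sub_two_pi α)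
  rw [← h]
  exact intervalIntegral.integral_congr fun u _ => (deriv_comp_const_add f α u).symm

section curve

variable {γ : ℝ → ℂ} (hγ : IsSmoothParam γ)
include hγ

theorem intervalIntegrable_quot_mul {f k : ℝ → ℂ} (hf : PerC 1 f) (hk : PerC 0 k) (α : ℝ) :
    IntervalIntegrable (fun u => (f (α + u) - f α) / (γ (α + u) - γ α) * k (α + u)) volume
      (-Real.pi) Real.pi :=
  ((reg_quot hγ (by norm_num) hf).mul (reg_shift hk)).intervalIntegrable (mem_univ α)

theorem defect_add {f g : ℝ → ℂ} (hf : PerC 1 f) (hg : PerC 1 g) (α : ℝ) :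
    defect γ (fun x => f x + g x) α = defect γ f α + defect γ g α := by
  have hd : PerC 0 (deriv γ) := hγ.perC_deriv.of_le (by norm_num)
  simp only [defect]
  rw [← mul_add, ← intervalIntegral.integral_add (intervalIntegrable_quot_mul hγ hf hd α)
    (intervalIntegrable_quot_mul hγ hg hd α)]
  congr 1
  exact intervalIntegral.integral_congr fun u _ => by ring

theorem defect_sub {f g : ℝ → ℂ} (hf : PerC 1 f) (hg : PerC 1 g) (α : ℝ) :
    defect γ (fun x => f x - g x) α = defect γ f α - defect γ g α := by
  have := defect_add hγ hf ((PerC.const (-1)).mul hg) α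
  rw [defect_const_mul] at this
  rw [sub_eq_add_neg, ← neg_one_mul, ← this]
  exact defect_congr (fun x => by ring) α

theorem defect_curve (α : ℝ) : defect γ γ α = 0 := by
  rw [defect, integral_congr_increments (g := fun u => deriv γ (α + u)),
    integral_deriv_shift (hγ.perC.of_le (by norm_num)), mul_zero]
  intro u hu h0
  rw [div_self (hγ.sub_ne_zero α hu h0), one_mul]

theorem contour_eq_shift {f : ℝ → ℂ} (hf : Function.Periodic f (2 * Real.pi)) (α : ℝ) :
    contour γ f = ∫ u in (-Real.pi)..Real.pi, f (α + u) * deriv γ (α + u) := by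
  rw [contour, integral_shift_eq (F := fun β => f β * deriv γ β)]
  intro x
  simp only [hf x, hγ.perC_deriv.per x]

theorem contour_add {f g : ℝ → ℂ} (hf : PerC 0 f) (hg : PerC 0 g) :
    contour γ (fun x => f x + g x) = contour γ f + contour γ g := by
  have h1 := hf.smooth.continuous
  have h2 := hg.smooth.continuous
  have h3 := hγ.perC_deriv.smooth.continuous
  rw [contour, contour, contour, ← intervalIntegral.integral_add
    (Continuous.intervalIntegrable (by fun_prop) _ _)
    (Continuous.intervalIntegrable (by fun_prop) _ _)]
  exact intervalIntegral.integral_congr fun u _ => by ring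

omit hγ in
theorem contour_const_mul (f : ℝ → ℂ) (c : ℂ) :
    contour γ (fun x => c * f x) = c * contour γ f := by
  simp only [contour, mul_assoc, intervalIntegral.integral_const_mul]

theorem contour_sub {f g : ℝ → ℂ} (hf : PerC 0 f) (hg : PerC 0 g) :
    contour γ (fun x => f x - g x) = contour γ f - contour γ g := by
  have := contour_add hγ hf ((PerC.const (-1)).mul hg)
  rw [contour_const_mul] at this
  rw [sub_eq_add_neg, ← neg_one_mul, ← this]
  congr 1
  funext x
  ring

/-- From γ(β)f(β) - γ(α)f(α) = γ(α)(f(β) - f(α)) + (γ(β) - γ(α))f(β), the last term cancels the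
denominator and leaves a contour integral independent of α. Contour integrals are thus read off from
A. -/
theorem defect_curve_mul {f : ℝ → ℂ} (hf : PerC 1 f) (α : ℝ) :
    defect γ (fun x => γ x * f x) α =
      γ α * defect γ f α - 1 / (Real.pi * Complex.I) * contour γ f := by
  have hd : PerC 0 (deriv γ) := hγ.perC_deriv.of_le (by norm_num)
  have h1 := hf.smooth.continuous
  have h3 := hγ.perC_deriv.smooth.continuous
  have e : ∫ u in (-Real.pi)..Real.pi, (γ (α + u) * f (α + u) - γ α * f α) /
      (γ (α + u) - γ α) * deriv γ (α + u) = γ α * (∫ u in (-Real.pi)..Real.pi,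
        (f (α + u) - f α) / (γ (α + u) - γ α) * deriv γ (α + u)) +
      ∫ u in (-Real.pi)..Real.pi, f (α + u) * deriv γ (α + u) := by
    rw [← intervalIntegral.integral_const_mul, ← intervalIntegral.integral_add
      ((intervalIntegrable_quot_mul hγ hf hd α).const_mul _)
      (Continuous.intervalIntegrable (by fun_prop) _ _)]
    refine integral_congr_increments fun u hu h0 => ?_
    have := hγ.sub_ne_zero α hu h0
    field_simp
    ring
  rw [contour_eq_shift hγ hf.per α, defect, e, defect]
  ring

/-- This is H² = I, obtained from the product formula with the second factor 1, since A annihilates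
constants. -/
theorem defect_defect {f : ℝ → ℂ} (hf : PerC 1 f) (hAf : PerC 1 (defect γ f)) (α : ℝ) :
    defect γ (defect γ f) α = 2 * defect γ f α := by
  have h0 : defect γ (fun _ => (1 : ℂ)) = fun _ => 0 := funext fun x => defect_const γ 1 x
  have h1 := defect_mul hγ hf (PerC.const 1) hAf (by rw [h0]; exact PerC.const 0) α
  simp only [h0, mul_zero, zero_add, one_mul, mul_one] at h1
  rw [defect_sub hγ hAf ((PerC.const 2).mul hf), defect_const_mul] at h1
  linear_combination h1

/-- The product formula with the first factor γ, which A annihilates, together with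
`defect_curve_mul` and A² = 2A, leaves only the two constants. -/
theorem contour_defect {f : ℝ → ℂ} (hf : PerC 1 f) (hAf : PerC 1 (defect γ f)) :
    contour γ (defect γ f) = 2 * contour γ f := by
  have h0 : defect γ γ = fun _ => 0 := funext fun x => defect_curve hγ x
  have hγ1 : PerC 1 γ := hγ.perC.of_le (by norm_num)
  have h1 := defect_mul hγ hγ1 hf (by rw [h0]; exact PerC.const 0) hAf 0
  simp only [h0, mul_zero, add_zero, zero_mul] at h1
  rw [defect_sub hγ (hγ1.mul hAf) ((PerC.const 2).mul (hγ1.mul hf)), defect_const_mul,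
    defect_curve_mul hγ hAf, defect_curve_mul hγ hf, defect_defect hγ hf hAf] at h1
  have h2 := pi_mul_I_ne_zero
  have h3 : 1 / (Real.pi * Complex.I) * (contour γ (defect γ f) - 2 * contour γ f) = 0 := by
    linear_combination -h1
  rcases mul_eq_zero.1 h3 with h | h
  · exact absurd h (one_div_ne_zero h2)
  · linear_combination h

theorem contour_eq_zero {f : ℝ → ℂ} (hf : PerC 1 f) (h : ∀ x, defect γ f x = 0) :
    contour γ f = 0 := by
  have h0 : defect γ f = fun _ => 0 := funext h
  have h1 := contour_defect hγ hf (by rw [h0]; exact PerC.const 0)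
  rw [h0] at h1
  simp [contour] at h1 ⊢
  exact h1

/-- The kernel of A consists of boundary values of functions holomorphic inside, so it should be
closed under products. Here this is the product formula with Af = Ag = 0, where only -2fg survives.
-/
theorem defect_mul_eq_zero {f g : ℝ → ℂ} (hf : PerC 1 f) (hg : PerC 1 g)
    (hAf : ∀ x, defect γ f x = 0) (hAg : ∀ x, defect γ g x = 0) (α : ℝ) :
    defect γ (fun x => f x * g x) α = 0 := by
  have h1 : defect γ f = fun _ => 0 := funext hAf
  have h2 : defect γ g = fun _ => 0 := funext hAg
  have h := defect_mul hγ hf hg (by rw [h1]; exact PerC.const 0) (by rw [h2]; exact PerC.const 0) α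
  simp only [h1, h2, mul_zero, add_zero, zero_sub] at h
  have h3 := defect_const_mul γ (fun x => f x * g x) (-2) α
  rw [defect_congr (g := fun x => -(2 * (f x * g x))) (fun x => by ring), h] at h3
  linear_combination h3 / 2

theorem defect_curve_mul_eq_zero {f : ℝ → ℂ} (hf : PerC 1 f) (hAf : ∀ x, defect γ f x = 0)
    (α : ℝ) : defect γ (fun x => γ x * f x) α = 0 :=
  defect_mul_eq_zero hγ (hγ.perC.of_le (by norm_num)) hf (defect_curve hγ) hAf α

theorem perC_deriv_div {n : ℕ} (hn : n ≤ 2) {g : ℝ → ℂ} (hg : PerC (n + 1) g) :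
    PerC n (fun x => deriv g x / deriv γ x) :=
  hg.deriv.div (hγ.perC_deriv.of_le hn) hγ.deriv_ne_zero

/-- With h = g_α/γ_α, subtracting f(α)(h(β) - h(α)) from f(β)h(β) - f(α)h(α) leaves (f(β) -
f(α))h(β), so the integral is a commutator of A with multiplication by f. -/
theorem mixed_eq {f g : ℝ → ℂ} (hf : PerC 1 f) (hg : PerC 2 g) (α : ℝ) :
    mixed γ f g α = f α * defect γ (fun x => deriv g x / deriv γ x) α -
      defect γ (fun x => f x * (deriv g x / deriv γ x)) α := by
  have hh : PerC 1 (fun x => deriv g x / deriv γ x) := perC_deriv_div hγ (by norm_num) hg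
  have hd : PerC 0 (deriv γ) := hγ.perC_deriv.of_le (by norm_num)
  have e : ∫ u in (-Real.pi)..Real.pi, (f (α + u) - f α) / (γ (α + u) - γ α) * deriv g (α + u) =
      (∫ u in (-Real.pi)..Real.pi, (f (α + u) * (deriv g (α + u) / deriv γ (α + u)) -
        f α * (deriv g α / deriv γ α)) / (γ (α + u) - γ α) * deriv γ (α + u)) -
      f α * ∫ u in (-Real.pi)..Real.pi, (deriv g (α + u) / deriv γ (α + u) -
        deriv g α / deriv γ α) / (γ (α + u) - γ α) * deriv γ (α + u) := by
    rw [← intervalIntegral.integral_const_mul, ← intervalIntegral.integral_sub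
      (intervalIntegrable_quot_mul hγ (hf.mul hh) hd α)
      ((intervalIntegrable_quot_mul hγ hh hd α).const_mul _)]
    refine integral_congr_increments fun u hu h0 => ?_
    have h1 := hγ.sub_ne_zero α hu h0
    have h2 := hγ.deriv_ne_zero (α + u)
    have h3 := hγ.deriv_ne_zero α
    field_simp
    ring
  rw [mixed, e, defect, defect]
  ring

/-- A shift of the base point is treated as a time variable: for the family γ(s + u) the time and
space derivatives coincide, and the parameter lemma gives A(F_α) + M(γ_α, F). -/
theorem deriv_defect {F : ℝ → ℂ} (hF : PerC 2 F) (α : ℝ) :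
    deriv (defect γ F) α = deriv γ α * defect γ (fun x => deriv F x / deriv γ x) α := by
  have hd : PerC 1 (deriv γ) := hγ.perC_deriv.of_le (by norm_num)
  have hsm : ∀ {f : ℝ → ℂ}, PerC 2 f → Sm univ 2 (fun s u => f (s + u)) := fun hf =>
    (hf.smooth.comp (by fun_prop : ContDiff ℝ 2 fun p : ℝ × ℝ => p.1 + p.2)).contDiffOn
  have hda : ∀ f : ℝ → ℂ, da (fun s u => f (s + u)) = fun s u => deriv f (s + u) := fun f => by
    funext s u
    exact deriv_comp_const_add f s u
  have hdt : ∀ f : ℝ → ℂ, dt (fun s u => f (s + u)) = fun s u => deriv f (s + u) := fun f => by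
    funext s u
    exact deriv_comp_add_const f u s
  have h := hasDerivAt_integral_quot isOpen_univ (hsm (hγ.perC.of_le (by norm_num))) (hsm hF)
    (fun s _ u hu h0 => by simpa using hγ.ne_of_mem_increments s hu h0)
    (fun s _ => by simpa [hda] using hγ.deriv_ne_zero s)
    (fun s _ => hγ.perC.sub_two_pi s) (fun s _ => hF.sub_two_pi s) (mem_univ α)
  simp only [hda, hdt, add_zero] at h
  have h2 := (h.const_mul (-(1 / (Real.pi * Complex.I)))).deriv
  have h3 := mixed_eq hγ hd hF α
  have e : (fun x => deriv γ x * (deriv F x / deriv γ x)) = deriv F := by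
    funext x
    have := hγ.deriv_ne_zero x
    field_simp
  rw [e] at h3
  simp only [mixed, defect] at h3
  change deriv (defect γ F) α = _ at h2
  rw [h2, sub_eq_add_neg, mul_add]
  simp only [defect]
  linear_combination h3

theorem defect_deriv_div_eq_zero {F : ℝ → ℂ} (hF : PerC 2 F) (h : ∀ x, defect γ F x = 0)
    (α : ℝ) : defect γ (fun x => deriv F x / deriv γ x) α = 0 := by
  have h1 := deriv_defect hγ hF α
  rw [show defect γ F = fun _ => 0 from funext h, deriv_const] at h1
  exact (mul_eq_zero.1 h1.symm).resolve_left (hγ.deriv_ne_zero α)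

/-- For boundary values of a holomorphic function `q` the integrand
`(q(β) - q(α)) / (γ(β) - γ(α)) (γ q)_β(β)` has vanishing integral. -/
theorem mixed_curve_mul_eq_zero {q : ℝ → ℂ} (hq : PerC 2 q) (h : ∀ x, defect γ q x = 0) (α : ℝ) :
    mixed γ q (fun x => q x * γ x) α = 0 ∧ contour γ (fun x => q x *
      (deriv (fun x => q x * γ x) x / deriv γ x)) = 0 := by
  have hγ2 : PerC 2 γ := hγ.perC.of_le (by norm_num)
  have hq1 : PerC 1 q := hq.of_le (by norm_num)
  have h1 : ∀ x, defect γ (fun x => q x * γ x) x = 0 :=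
    defect_mul_eq_zero hγ hq1 (hγ2.of_le (by norm_num)) h (defect_curve hγ)
  have h2 := defect_deriv_div_eq_zero hγ (hq.mul hγ2) h1
  have h3 := perC_deriv_div hγ (n := 1) (by norm_num) (hq.mul hγ2)
  have h4 := defect_mul_eq_zero hγ hq1 h3 h h2
  exact ⟨by rw [mixed_eq hγ hq1 (hq.mul hγ2), h2, h4]; ring, contour_eq_zero hγ (hq1.mul h3) h4⟩

/-- Functions in the range of A are boundary values of exterior functions vanishing at infinity, so
a product decays like the inverse square and has no residue there. Algebraically, the product
formula gives A(γpq) = 2γpq for p and q in that range, while A(pq) = 2pq; comparison with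
`defect_curve_mul` kills the contour integral. -/
theorem contour_defect_mul_defect {f h : ℝ → ℂ} (hf : PerC 1 f) (hh : PerC 1 h)
    (hAf : PerC 1 (defect γ f)) (hAh : PerC 1 (defect γ h)) :
    contour γ (fun x => defect γ f x * defect γ h x) = 0 := by
  have hγ1 : PerC 1 γ := hγ.perC.of_le (by norm_num)
  set p := defect γ f with hp
  set q := defect γ h with hq
  have hAp : defect γ p = fun x => 2 * p x := funext (defect_defect hγ hf hAf)
  have hAq : defect γ q = fun x => 2 * q x := funext (defect_defect hγ hh hAh)
  set κ := 1 / (Real.pi * Complex.I) * contour γ p with hκ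
  have hzp : defect γ (fun x => γ x * p x) = fun x => 2 * (γ x * p x) - κ := by
    funext x
    rw [defect_curve_mul hγ hAf, hAp]
    ring
  have e1 : ∀ x, defect γ (fun x => p x * q x) x = 2 * (p x * q x) := by
    intro x
    have h1 := defect_mul hγ hAf hAh (by rw [hAp]; exact (PerC.const 2).mul hAf)
      (by rw [hAq]; exact (PerC.const 2).mul hAh) x
    rw [hAp, hAq, defect_congr (g := fun x => 2 * (p x * q x)) (fun x => by ring),
      defect_const_mul] at h1
    linear_combination h1 / 2
  have e2 : defect γ (fun x => γ x * (p x * q x)) 0 = 2 * (γ 0 * (p 0 * q 0)) := by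
    have h1 := defect_mul hγ (hγ1.mul hAf) hAh
      (by rw [hzp]; exact ((PerC.const 2).mul (hγ1.mul hAf)).sub (PerC.const κ))
      (by rw [hAq]; exact (PerC.const 2).mul hAh) 0
    rw [hzp, hAq, defect_congr (g := fun x => 2 * (γ x * (p x * q x)) - κ * q x)
      (fun x => by ring), defect_sub hγ ((PerC.const 2).mul (hγ1.mul (hAf.mul hAh)))
      ((PerC.const κ).mul hAh), defect_const_mul, defect_const_mul, hAq] at h1
    linear_combination h1 / 2
  rw [defect_curve_mul hγ (hAf.mul hAh), e1] at e2
  have h3 : 1 / (Real.pi * Complex.I) * contour γ (fun x => p x * q x) = 0 := by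
    linear_combination -e2
  exact (mul_eq_zero.1 h3).resolve_left (one_div_ne_zero pi_mul_I_ne_zero)

/-- The identity behind the cancellation of the quadratic terms that `E` does not contain. -/
theorem defect_curve_mul_mixed {e : ℝ → ℂ} (he : PerC 3 e) (α : ℝ) :
    defect γ (fun x => γ x * mixed γ e e x) α =
      mixed γ (fun x => γ x * defect γ e x) e α := by
  have hγ1 : PerC 1 γ := hγ.perC.of_le (by norm_num)
  have he1 : PerC 1 e := he.of_le (by norm_num)
  have he2 : PerC 2 e := he.of_le (by norm_num)
  set h : ℝ → ℂ := fun x => deriv e x / deriv γ x with hh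
  have hhC : PerC 2 h := perC_deriv_div hγ (by norm_num) he
  have hh1 : PerC 1 h := hhC.of_le (by norm_num)
  have hAe : PerC 1 (defect γ e) := PerC.defect hγ (by norm_num) he2
  have hAh : PerC 1 (defect γ h) := PerC.defect hγ (by norm_num) hhC
  have hAeh : PerC 1 (defect γ (fun x => e x * h x)) :=
    PerC.defect hγ (by norm_num) (he2.mul hhC)
  have hM : mixed γ e e = fun x => e x * defect γ h x - defect γ (fun x => e x * h x) x :=
    funext (mixed_eq hγ he1 he2)
  have hMC : PerC 1 (mixed γ e e) := by rw [hM]; exact (he1.mul hAh).sub hAeh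
  set P : ℝ → ℂ := fun x => e x * defect γ h x + h x * defect γ e x - 2 * (e x * h x) with hP
  have hPC : PerC 1 P := ((he1.mul hAh).add (hh1.mul hAe)).sub ((PerC.const 2).mul (he1.mul hh1))
  have hAP : defect γ P = fun x => defect γ e x * defect γ h x :=
    funext (defect_mul hγ he1 hh1 hAe hAh)
  have hcP : contour γ P = 0 := by
    have h1 := contour_defect hγ hPC (by rw [hAP]; exact hAe.mul hAh)
    rw [hAP, contour_defect_mul_defect hγ he1 hh1 hAe hAh] at h1
    linear_combination -h1 / 2
  -- A(M(e, e)) = A(e Ah) - 2A(eh) is A(P) without the term A(h Ae), and A(P) is the product Ae ·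
  -- Ah.
  have k1 : defect γ (mixed γ e e) α = defect γ e α * defect γ h α -
      defect γ (fun x => defect γ e x * h x) α := by
    rw [hM, defect_sub hγ (he1.mul hAh) hAeh, defect_defect hγ (he1.mul hh1) hAeh]
    have h1 := congrFun hAP α
    rw [hP, defect_sub hγ ((he1.mul hAh).add (hh1.mul hAe)) ((PerC.const 2).mul (he1.mul hh1)),
      defect_add hγ (he1.mul hAh) (hh1.mul hAe), defect_const_mul,
      defect_congr (f := fun x => h x * defect γ e x) (g := fun x => defect γ e x * h x)
        (fun x => by ring)] at h1
    linear_combination h1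
  -- The factor γ in the claim adds one contour integral on each side; they agree because P has zero
  -- contour integral.
  have k2 : contour γ (mixed γ e e) = -contour γ (fun x => defect γ e x * h x) := by
    have h0 : ∀ {f : ℝ → ℂ}, PerC 1 f → PerC 0 f := fun hf => hf.of_le (by norm_num)
    rw [hM, contour_sub hγ (h0 (he1.mul hAh)) (h0 hAeh), contour_defect hγ (he1.mul hh1) hAeh]
    rw [hP, contour_sub hγ (h0 ((he1.mul hAh).add (hh1.mul hAe)))
      (h0 ((PerC.const 2).mul (he1.mul hh1))), contour_add hγ (h0 (he1.mul hAh))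
      (h0 (hh1.mul hAe)), contour_const_mul,
      show (fun x => h x * defect γ e x) = fun x => defect γ e x * h x by funext x; ring] at hcP
    linear_combination hcP
  rw [defect_curve_mul hγ hMC, k1, k2, mixed_eq hγ (hγ1.mul hAe) he2,
    defect_congr (f := fun x => γ x * defect γ e x * (deriv e x / deriv γ x))
      (g := fun x => γ x * (defect γ e x * h x)) (fun x => by simp only [hh]; ring),
    defect_curve_mul hγ (hAe.mul hh1)]
  ring

end curve

/-! ### The operators of the statement at a fixed time -/

/-- The regularized form of `(I - Hbar) f`. -/
def defectBar (γ f : ℝ → ℂ) (α : ℝ) : ℂ :=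
  (starRingEnd ℂ) (defect γ (fun x => (starRingEnd ℂ) (f x)) α)

theorem eps_eq (z : ℝ → ℝ → ℂ) (t α : ℝ) :
    eps z t α = z t α * (starRingEnd ℂ) (z t α) - 1 := by
  rw [eps, Complex.mul_conj']
  push_cast
  rfl

theorem ofReal_norm_sq (x : ℂ) : ((‖x‖ ^ 2 : ℝ) : ℂ) = x * (starRingEnd ℂ) x := by
  rw [Complex.mul_conj']
  push_cast
  rfl

theorem deriv_conj {f : ℝ → ℂ} {x : ℝ} (hf : DifferentiableAt ℝ f x) :
    deriv (fun y => (starRingEnd ℂ) (f y)) x = (starRingEnd ℂ) (deriv f x) :=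
  (Complex.conjCLE.toContinuousLinearMap.hasFDerivAt.comp_hasDerivAt x hf.hasDerivAt).deriv

theorem exists_hasPV {F : ℝ → ℝ → ℂ} (h : Reg univ 1 (fun σ u => u * F σ (σ + u))) (α : ℝ) :
    ∃ L, HasPV (F α) α L := by
  obtain ⟨k, hk⟩ := Reg.exists_sub_div (n := 0) isOpen_univ h
  refine ⟨_, hasPV_of_eq_add_div (hk.intervalIntegrable (mem_univ α)) (k := k α) ?_⟩
  intro u hu h0
  have : (u : ℂ) ≠ 0 := by exact_mod_cast h0
  field_simp
  ring

/-- The values of z (g₀, g₁, g) and of its conjugate (b₀, b₁, b) are independent variables here, so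
the kernel identity is purely rational. Its origin is explained at `kernel_identity`. -/
theorem kernel_algebra {g₀ g₁ b₀ b₁ : ℂ} (h₁ : g₁ - g₀ ≠ 0) (h₂ : b₁ - b₀ ≠ 0) (h₃ : g₀ ≠ 0)
    (h₄ : g₁ ≠ 0) (f f' g b : ℂ) :
    f / (g₁ - g₀) * g + -1 * (f / (b₁ - b₀) * b) +
      (f * ((g₀ * b₀ - 1) / g₀ - (g₁ * b₁ - 1) / g₁) * (g₀ * g₁) ^ 2 / (g₀ - g₁) ^ 2 *
        (((g * b₁ + g₁ * b) * g₁ - (g₁ * b₁ - 1) * g) / g₁ ^ 2) +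
      (f * ((g₁ * b₁ - 1) / g₁ - (g₀ * b₀ - 1) / g₀) ^ 2 * (g₀ * g₁) ^ 2 /
        ((g₁ - g₀) * ((g₁ - g₀) * (b₁ - b₀))) *
        (((g * b₁ + g₁ * b) * g₁ - (g₁ * b₁ - 1) * g) / g₁ ^ 2) +
      f * ((g₁ * b₁ - 1) / g₁ - (g₀ * b₀ - 1) / g₀) ^ 2 * (g₀ * g₁) ^ 2 /
        ((g₁ - g₀) * ((g₁ - g₀) * (b₁ - b₀))) * (-g / g₁ ^ 2))) =
    (f * (g / g₁) + (f' * (g₀ * b₀ - 1) - g₀ *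
      ((g₁ * b₁ - 1 - (g₀ * b₀ - 1)) / (g₁ - g₀) * f'))) -
      (f' * ((g₀ * b₀ - 1) - g₀ * ((g₁ * b₁ - 1 - (g₀ * b₀ - 1)) / (g₁ - g₀))) +
      f * -(g₀ * (((g * b₁ + g₁ * b) * (g₁ - g₀) - (g₁ * b₁ - 1 - (g₀ * b₀ - 1)) * g) /
        (g₁ - g₀) ^ 2))) := by
  have e : (g₀ - g₁) ^ 2 = (g₁ - g₀) ^ 2 := by ring
  rw [e]
  field_simp
  ring

section slice

variable {z : ℝ → ℝ → ℂ} {t : ℝ} (hγ : IsSmoothParam (z t))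
include hγ

theorem hasPV_hilbertKernel {f : ℝ → ℝ → ℂ} (hf : PerC 1 (f t)) (α : ℝ) :
    HasPV (hilbertKernel z f t α) α
      (Real.pi * Complex.I * (f t α - defect (z t) (f t) α)) := by
  have hd : PerC 0 (deriv (z t)) := hγ.perC_deriv.of_le (by norm_num)
  have h1 := intervalIntegrable_quot_mul hγ hf hd α
  have h2 := ((reg_kappa hγ).intervalIntegrable (mem_univ α)).const_mul (f t α)
  have h := hasPV_of_eq_add_div (F := hilbertKernel z f t α) (α := α) (k := f t α) (h1.add h2) ?_
  · rw [intervalIntegral.integral_add h1 h2, intervalIntegral.integral_const_mul,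
      integral_kappa hγ] at h
    convert h using 1
    have := pi_mul_I_ne_zero
    rw [defect]
    field_simp
    ring
  · intro u hu h0
    have h3 := hγ.sub_ne_zero α hu h0
    have h4 : (u : ℂ) ≠ 0 := by exact_mod_cast h0
    simp only [hilbertKernel, da]
    field_simp
    ring

theorem H_eq {f : ℝ → ℝ → ℂ} (hf : PerC 1 (f t)) (α : ℝ) :
    H z f t α = f t α - defect (z t) (f t) α := by
  rw [H, (hasPV_hilbertKernel hγ hf α).pv_eq]
  have := pi_mul_I_ne_zero
  field_simp

theorem da_bar (α : ℝ) : da (bar z) t α = (starRingEnd ℂ) (deriv (z t) α) :=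
  deriv_conj (hγ.perC.differentiable (by norm_num) α)

theorem hasPV_hilbertBarKernel {f : ℝ → ℝ → ℂ} (hf : PerC 1 (f t)) (α : ℝ) :
    HasPV (hilbertBarKernel z f t α) α
      (-(Real.pi * Complex.I) * (f t α - defectBar (z t) (f t) α)) := by
  have h := (hasPV_hilbertKernel hγ (f := bar f) hf.conj α).conj
  convert h using 1
  · funext β
    simp only [hilbertKernel, hilbertBarKernel, da_bar hγ]
    simp [bar, da]
  · simp only [defectBar, map_mul, map_sub, Complex.conj_ofReal, Complex.conj_I, bar,
      Complex.conj_conj, mul_neg, neg_mul]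
    rfl

theorem Hbar_eq {f : ℝ → ℝ → ℂ} (hf : PerC 1 (f t)) (α : ℝ) :
    Hbar z f t α = f t α - defectBar (z t) (f t) α := by
  rw [Hbar, (hasPV_hilbertBarKernel hγ hf α).pv_eq]
  have := pi_mul_I_ne_zero
  field_simp

theorem perC_eps : PerC 3 (eps z t) := by
  have h : PerC 3 (fun x => z t x * (starRingEnd ℂ) (z t x) - 1) :=
    (hγ.perC.mul hγ.perC.conj).sub (PerC.const 1)
  rwa [← funext (eps_eq z t)] at h

theorem delta_eq (α : ℝ) : delta z t α = defect (z t) (eps z t) α := by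
  change eps z t α - H z (eps z) t α = _
  rw [H_eq hγ ((perC_eps hγ).of_le (by norm_num))]
  ring

variable (h0 : ∀ x, z t x ≠ 0)
include h0

theorem perC_eps_div : PerC 3 ((eps z / z) t) := (perC_eps hγ).div hγ.perC h0

theorem perC_inv : PerC 3 (z⁻¹ t) := hγ.perC.inv h0

theorem exists_hasPV_E1Kernel {f : ℝ → ℝ → ℂ} (hf : PerC 1 (f t)) (α : ℝ) :
    ∃ L, HasPV (E1Kernel z f t α) α L := by
  have hY := perC_eps_div hγ h0
  have hQ := reg_quot hγ (n := 1) (by norm_num) (hY.of_le (by norm_num))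
  have hI := (reg_div_sub hγ).of_le (m := 1) (by norm_num)
  have hY' : PerC 1 (deriv ((eps z / z) t)) := hY.deriv.of_le (by norm_num)
  have hz : PerC 1 (z t) := hγ.perC.of_le (by norm_num)
  have h1 := ((((reg_shift hf).mul hQ).mul hI).mul (((reg_base hz).mul (reg_shift hz)).mul
    ((reg_base hz).mul (reg_shift hz)))).mul (reg_shift hY')
  refine exists_hasPV (F := E1Kernel z f t) (h1.neg.congr fun σ _ u hu hu0 => ?_) α
  have b1 := hγ.sub_ne_zero σ hu hu0
  have b2 : z t σ - z t (σ + u) ≠ 0 := fun h => b1 (by linear_combination -h)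
  simp only [E1Kernel, da, Pi.div_apply]
  have e : (z t σ - z t (σ + u)) ^ 2 = (z t (σ + u) - z t σ) ^ 2 := by ring
  rw [e]
  field_simp
  ring

/-- Three difference factors in the denominator are met by two increments of ε/z in the numerator.
Only a simple pole remains, which multiplication by u removes. -/
theorem reg_cubic {f : ℝ → ℝ → ℂ} (hf : PerC 1 (f t)) {k : ℝ → ℂ} (hk : PerC 1 k) :
    Reg univ 1 (fun σ u => u * (f t (σ + u) *
      (eps z t (σ + u) / z t (σ + u) - eps z t σ / z t σ) ^ 2 * (z t σ * z t (σ + u)) ^ 2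
      / ((z t (σ + u) - z t σ) * ((‖z t (σ + u) - z t σ‖ ^ 2 : ℝ) : ℂ)) * k (σ + u))) := by
  have hY := perC_eps_div hγ h0
  have hQ := reg_quot hγ (n := 1) (by norm_num) (hY.of_le (by norm_num))
  have hI := ((reg_div_sub hγ).of_le (m := 1) (by norm_num)).conj
  have hz : PerC 1 (z t) := hγ.perC.of_le (by norm_num)
  have h1 := ((((reg_shift hf).mul (hQ.mul hQ)).mul hI).mul (((reg_base hz).mul (reg_shift hz)).mul
    ((reg_base hz).mul (reg_shift hz)))).mul (reg_shift hk)
  refine h1.congr fun σ _ u hu hu0 => ?_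
  have b1 := hγ.sub_ne_zero σ hu hu0
  have b2 : (starRingEnd ℂ) (z t (σ + u) - z t σ) ≠ 0 :=
    (map_ne_zero _).2 b1
  rw [ofReal_norm_sq]
  simp only [Pi.div_apply, map_div₀, Complex.conj_ofReal]
  field_simp

theorem exists_hasPV_E2Kernel {f : ℝ → ℝ → ℂ} (hf : PerC 1 (f t)) (α : ℝ) :
    ∃ L, HasPV (E2Kernel z f t α) α L :=
  exists_hasPV (F := E2Kernel z f t)
    (reg_cubic hγ h0 hf ((perC_eps_div hγ h0).deriv.of_le (by norm_num))) α

theorem exists_hasPV_E3Kernel {f : ℝ → ℝ → ℂ} (hf : PerC 1 (f t)) (α : ℝ) :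
    ∃ L, HasPV (E3Kernel z f t α) α L :=
  exists_hasPV (F := E3Kernel z f t)
    (reg_cubic hγ h0 hf ((perC_inv hγ h0).deriv.of_le (by norm_num))) α

/-- Since z̄ = 1/z + Y with Y = ε/z, an increment of z̄ is X + ΔY with X the increment of 1/z. The
exact expansion 1/(X + ΔY) = 1/X - ΔY/X² + ΔY²/(X²(X + ΔY)) is inserted in the conjugate kernel. The
cubic remainder is cancelled by the kernels of E₂ and E₃, the quadratic term by that of E₁. The term
free of Y combines with the kernel of H to f z_β/z. The linear terms form -f ∂_β(ΔY/X), and ΔY/X =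
ε(α) - z(α) Δε/Δz; the product rule then exposes a total derivative. -/
theorem kernel_identity {f : ℝ → ℝ → ℂ} (hf : PerC 1 (f t)) (α : ℝ) {u : ℝ}
    (hu : u ∈ increments) (hu0 : u ≠ 0) :
    hilbertKernel z f t α (α + u) + -1 * hilbertBarKernel z f t α (α + u) +
      (E1Kernel z f t α (α + u) + (E2Kernel z f t α (α + u) + E3Kernel z f t α (α + u))) =
    (f t (α + u) * (deriv (z t) (α + u) / z t (α + u)) +
      (deriv (f t) (α + u) * eps z t α - z t α *
        ((eps z t (α + u) - eps z t α) / (z t (α + u) - z t α) * deriv (f t) (α + u)))) -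
      deriv (fun v => f t (α + v) *
        (eps z t α - z t α * ((eps z t (α + v) - eps z t α) / (z t (α + v) - z t α)))) u := by
  have b1 := hγ.sub_ne_zero α hu hu0
  have b2 : (starRingEnd ℂ) (z t (α + u) - z t α) ≠ 0 :=
    (map_ne_zero _).2 b1
  have b3 := h0 α
  have b4 := h0 (α + u)
  have b5 : z t α - z t (α + u) ≠ 0 := fun h => b1 (by linear_combination -h)
  have hsh : ∀ {k : ℝ → ℂ}, DifferentiableAt ℝ k (α + u) →
      HasDerivAt (fun v => k (α + v)) (deriv k (α + u)) u := fun hk => by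
    exact hk.hasDerivAt.comp_const_add α u
  have dz : HasDerivAt (z t) (deriv (z t) (α + u)) (α + u) :=
    (hγ.perC.differentiable (by norm_num) _).hasDerivAt
  have dzb : HasDerivAt (fun x => (starRingEnd ℂ) (z t x)) ((starRingEnd ℂ) (deriv (z t) (α + u)))
      (α + u) := by
    rw [← deriv_conj dz.differentiableAt]
    exact (hγ.perC.conj.differentiable (by norm_num) _).hasDerivAt
  have de : HasDerivAt (eps z t) (deriv (z t) (α + u) * (starRingEnd ℂ) (z t (α + u)) +
      z t (α + u) * (starRingEnd ℂ) (deriv (z t) (α + u))) (α + u) := by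
    have := (dz.mul dzb).sub_const 1
    rw [show eps z t = fun x => (z t * fun x => (starRingEnd ℂ) (z t x)) x - 1 from
      funext (eps_eq z t)]
    exact this
  have dY : da (eps z / z) t (α + u) = ((deriv (z t) (α + u) * (starRingEnd ℂ) (z t (α + u)) +
      z t (α + u) * (starRingEnd ℂ) (deriv (z t) (α + u))) * z t (α + u) -
      eps z t (α + u) * deriv (z t) (α + u)) / z t (α + u) ^ 2 := (de.div dz b4).deriv
  have dI : da z⁻¹ t (α + u) = -deriv (z t) (α + u) / z t (α + u) ^ 2 := (dz.inv b4).deriv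
  have dq := (((hsh de.differentiableAt).sub_const (eps z t α)).div
    ((hsh dz.differentiableAt).sub_const (z t α)) b1)
  have dΘ := ((hsh (hf.differentiable le_rfl _)).mul ((dq.const_mul (z t α)).const_sub
    (eps z t α))).deriv
  have dΘ' : deriv (fun v => f t (α + v) *
      (eps z t α - z t α * ((eps z t (α + v) - eps z t α) / (z t (α + v) - z t α)))) u = _ := dΘ
  rw [dΘ', de.deriv]
  simp only [hilbertKernel, hilbertBarKernel, E1Kernel, E2Kernel, E3Kernel]
  rw [dY, dI, da_bar hγ]
  simp only [ofReal_norm_sq, eps_eq, bar, da, map_sub, Pi.div_apply]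
  rw [map_sub] at b2
  exact kernel_algebra b1 b2 b3 b4 _ _ _ _

/-- The operator `E` in terms of `I - H` and its conjugate. -/
theorem E_eq {f : ℝ → ℝ → ℂ} (hf : PerC 1 (f t)) (α : ℝ) :
    E z f t α = 2 * f t α - defect (z t) (f t) α - defectBar (z t) (f t) α -
      1 / (Real.pi * Complex.I) * (∫ u in (-Real.pi)..Real.pi,
        f t (α + u) * (deriv (z t) (α + u) / z t (α + u))) +
      z t α * mixed (z t) (eps z t) (f t) α := by
  obtain ⟨L₁, h₁⟩ := exists_hasPV_E1Kernel hγ h0 hf α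
  obtain ⟨L₂, h₂⟩ := exists_hasPV_E2Kernel hγ h0 hf α
  obtain ⟨L₃, h₃⟩ := exists_hasPV_E3Kernel hγ h0 hf α
  have hsum := ((hasPV_hilbertKernel hγ hf α).add
    ((hasPV_hilbertBarKernel hγ hf α).const_mul (-1))).add (h₁.add (h₂.add h₃))
  have he := perC_eps hγ
  have hf' : PerC 0 (deriv (f t)) := hf.deriv
  have hz : PerC 1 (z t) := hγ.perC.of_le (by norm_num)
  have hQ := reg_quot hγ (n := 1) (by norm_num) (he.of_le (by norm_num))
  have RΘ : Reg univ 1 (fun α v => f t (α + v) *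
      (eps z t α - z t α * ((eps z t (α + v) - eps z t α) / (z t (α + v) - z t α)))) :=
    (reg_shift hf).mul ((reg_base (he.of_le (by norm_num))).sub ((reg_base hz).mul hQ))
  have R1 : Reg univ 0 (fun α u => f t (α + u) * (deriv (z t) (α + u) / z t (α + u))) :=
    reg_shift (f := fun x => f t x * (deriv (z t) x / z t x))
      ((hf.of_le (by norm_num)).mul ((hγ.perC_deriv.of_le (by norm_num)).div
        (hz.of_le (by norm_num)) h0))
  have R2 : Reg univ 0 (fun α u => deriv (f t) (α + u) * eps z t α) :=
    (reg_shift hf').mul (reg_base (he.of_le (by norm_num)))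
  have R3 : Reg univ 0 (fun α u =>
      (eps z t (α + u) - eps z t α) / (z t (α + u) - z t α) * deriv (f t) (α + u)) :=
    (hQ.of_le (by norm_num)).mul (reg_shift hf')
  have i1 := R1.intervalIntegrable (mem_univ α)
  have i2 := R2.intervalIntegrable (mem_univ α)
  have i3 := (R3.intervalIntegrable (mem_univ α)).const_mul (z t α)
  have hper : f t (α + Real.pi) * (eps z t α - z t α * ((eps z t (α + Real.pi) - eps z t α) /
      (z t (α + Real.pi) - z t α))) = f t (α + -Real.pi) * (eps z t α - z t α *
      ((eps z t (α + -Real.pi) - eps z t α) / (z t (α + -Real.pi) - z t α))) := by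
    rw [hf.sub_two_pi, he.sub_two_pi, hz.sub_two_pi]
  have hΘ0 := RΘ.integral_deriv_eq_zero isOpen_univ (mem_univ α) hper
  have iΘ : IntervalIntegrable (deriv (fun v => f t (α + v) *
      (eps z t α - z t α * ((eps z t (α + v) - eps z t α) / (z t (α + v) - z t α))))) volume
      (-Real.pi) Real.pi := by
    have hd : PerC 0 (deriv (z t)) := hγ.perC_deriv.of_le (by norm_num)
    have hed : PerC 0 (deriv (eps z t)) := he.deriv.of_le (by norm_num)
    obtain ⟨Φ, h1, h2⟩ := RΘ
    have hs : ContDiffOn ℝ 1 (fun u => Φ (α, u)) increments :=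
      ContDiffOn.comp (f := fun u => (α, u)) h1 (by fun_prop) fun u hu => ⟨mem_univ _, hu⟩
    have hc := (hs.continuousOn_deriv_of_isOpen isOpen_Ioo le_rfl).mono
      fun u hu => mem_increments_of_mem_uIcc hu
    refine hc.intervalIntegrable.congr_ae ?_
    have hz0 : ∀ᵐ u : ℝ ∂volume, u ≠ 0 := by simp [ae_iff]
    filter_upwards [ae_restrict_of_ae hz0, ae_restrict_mem measurableSet_uIoc] with u hu0 hu
    refine (Filter.EventuallyEq.deriv_eq ?_).symm
    filter_upwards [isOpen_Ioo.mem_nhds (mem_increments_of_mem_uIcc (uIoc_subset_uIcc hu)),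
      isOpen_ne.mem_nhds hu0] with v hv hv0
    exact h2 α (mem_univ α) v hv hv0
  -- The simple poles of the five kernels cancel in the sum, so the residue k is zero.
  have hreg := hasPV_of_eq_add_div (F := fun β => hilbertKernel z f t α β +
    -1 * hilbertBarKernel z f t α β + (E1Kernel z f t α β + (E2Kernel z f t α β +
      E3Kernel z f t α β))) (k := 0) ((i1.add (i2.sub i3)).sub iΘ) (α := α) (by
    intro u hu hu0
    rw [kernel_identity hγ h0 hf α hu hu0, zero_div, add_zero])
  have key := hsum.unique hreg
  rw [intervalIntegral.integral_sub (i1.add (i2.sub i3)) iΘ, hΘ0,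
    intervalIntegral.integral_add i1 (i2.sub i3), intervalIntegral.integral_sub i2 i3,
    intervalIntegral.integral_const_mul, intervalIntegral.integral_mul_const,
    integral_deriv_shift hf] at key
  have hpi := pi_mul_I_ne_zero
  rw [E, h₁.pv_eq, h₂.pv_eq, h₃.pv_eq, mixed]
  apply mul_left_cancel₀ hpi
  have e1 : ∀ x : ℂ, Real.pi * Complex.I * (1 / (Real.pi * Complex.I) * x) = x := fun x => by
    field_simp
  have e2 : (Real.pi * Complex.I : ℂ) * (1 / (Real.pi * Complex.I)) = 1 := by field_simp
  linear_combination -key + (-(L₁ + L₂ + L₃) + (∫ u in (-Real.pi)..Real.pi,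
        f t (α + u) * (deriv (z t) (α + u) / z t (α + u))) - z t α *
        (∫ u in (-Real.pi)..Real.pi, (eps z t (α + u) - eps z t α) / (z t (α + u) - z t α) *
          deriv (f t) (α + u))) * e2

end slice

/-! ### Commutators and the quadratic terms at a fixed time -/

theorem intervalIntegrable_of_shift {F : ℝ → ℂ} (hF : Function.Periodic F (2 * Real.pi)) {α : ℝ}
    (h : IntervalIntegrable (fun u => F (α + u)) volume (-Real.pi) Real.pi) :
    IntervalIntegrable F volume 0 (2 * Real.pi) := by
  have h1 := h.comp_add_left (-α)
  simp only [add_neg_cancel_left, sub_neg_eq_add] at h1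
  refine hF.intervalIntegrable Real.two_pi_pos.ne' (t := -Real.pi + α) ?_ _ _
  rwa [show -Real.pi + α + 2 * Real.pi = Real.pi + α by ring]

section slice

variable {γ : ℝ → ℂ} (hγ : IsSmoothParam γ)
include hγ

theorem PerC.defectBar {n : ℕ} (hn : n ≤ 2) {f : ℝ → ℂ} (hf : PerC (n + 1) f) :
    PerC n (defectBar γ f) := (PerC.defect hγ hn hf.conj).conj

theorem reg_mixed {n : ℕ} (hn : n ≤ 2) {f g : ℝ → ℂ} (hf : PerC (n + 1) f) (hg : PerC (n + 1) g) :
    Reg univ n (fun α u => (f (α + u) - f α) / (γ (α + u) - γ α) * deriv g (α + u)) :=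
  (reg_quot hγ hn hf).mul (reg_shift hg.deriv)

theorem mixed_add {f₁ f₂ g : ℝ → ℂ} (h₁ : PerC 1 f₁) (h₂ : PerC 1 f₂) (hg : PerC 2 g) (α : ℝ) :
    mixed γ (fun x => f₁ x + f₂ x) g α = mixed γ f₁ g α + mixed γ f₂ g α := by
  have hh : PerC 1 (fun x => deriv g x / deriv γ x) := perC_deriv_div hγ (by norm_num) hg
  rw [mixed_eq hγ (h₁.add h₂) hg, mixed_eq hγ h₁ hg, mixed_eq hγ h₂ hg,
    defect_congr (f := fun x => (f₁ x + f₂ x) * (deriv g x / deriv γ x))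
      (g := fun x => f₁ x * (deriv g x / deriv γ x) + f₂ x * (deriv g x / deriv γ x))
      (fun x => by ring), defect_add hγ (h₁.mul hh) (h₂.mul hh)]
  ring

theorem mixed_add_right {f g₁ g₂ : ℝ → ℂ} (hf : PerC 1 f) (h₁ : PerC 1 g₁) (h₂ : PerC 1 g₂)
    (α : ℝ) : mixed γ f (fun x => g₁ x + g₂ x) α = mixed γ f g₁ α + mixed γ f g₂ α := by
  have i1 := (reg_mixed hγ (n := 0) (by norm_num) hf h₁).intervalIntegrable (mem_univ α)
  have i2 := (reg_mixed hγ (n := 0) (by norm_num) hf h₂).intervalIntegrable (mem_univ α)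
  simp only [mixed]
  rw [← mul_add, ← intervalIntegral.integral_add i1 i2]
  congr 1
  refine intervalIntegral.integral_congr fun u _ => ?_
  have : deriv (fun x => g₁ x + g₂ x) (α + u) = deriv g₁ (α + u) + deriv g₂ (α + u) :=
    deriv_fun_add (h₁.differentiable le_rfl _) (h₂.differentiable le_rfl _)
  simp only [this]
  ring

omit hγ in
theorem mixed_const_mul (f g : ℝ → ℂ) (c : ℂ) (α : ℝ) :
    mixed γ (fun x => c * f x) g α = c * mixed γ f g α := by
  simp only [mixed, ← mul_sub, mul_div_assoc, mul_assoc, intervalIntegral.integral_const_mul]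
  ring

omit hγ in
theorem mixed_const (g : ℝ → ℂ) (c : ℂ) (α : ℝ) : mixed γ (fun _ => c) g α = 0 := by
  simp [mixed]

theorem mixed_curve {g : ℝ → ℂ} (hg : PerC 1 g) (α : ℝ) : mixed γ γ g α = 0 := by
  rw [mixed, integral_congr_increments (g := fun u => deriv g (α + u)), integral_deriv_shift hg,
    mul_zero]
  intro u hu h0
  rw [div_self (hγ.sub_ne_zero α hu h0), one_mul]

omit hγ in
theorem mixed_curve_right (f : ℝ → ℂ) (α : ℝ) : mixed γ f γ α = -defect γ f α := by
  rw [mixed, defect]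
  ring

end slice

section slice

variable {z : ℝ → ℝ → ℂ} {t : ℝ} (hγ : IsSmoothParam (z t))
include hγ

theorem comm_H {f g : ℝ → ℝ → ℂ} (hf : PerC 1 (f t)) (hg : PerC 1 (g t)) (α : ℝ) :
    comm f (H z) g t α =
      defect (z t) (fun x => f t x * g t x) α - f t α * defect (z t) (g t) α := by
  change f t α * H z g t α - H z (f * g) t α = _
  rw [H_eq hγ hg, H_eq hγ (f := f * g) (hf.mul hg)]
  change f t α * (g t α - _) - (f t α * g t α - defect (z t) (fun x => f t x * g t x) α) = _
  ring

theorem comm_H_div {f g : ℝ → ℝ → ℂ} (hf : PerC 1 (f t)) (hg : PerC 2 (g t)) (α : ℝ) :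
    comm f (H z) (da g / da z) t α = -mixed (z t) (f t) (g t) α := by
  rw [comm_H hγ (g := da g / da z) hf (perC_deriv_div hγ (by norm_num) hg), mixed_eq hγ hf hg]
  change defect (z t) (fun x => f t x * (deriv (g t) x / deriv (z t) x)) α -
    f t α * defect (z t) (fun x => deriv (g t) x / deriv (z t) x) α = _
  ring

/-- Only the H part of the commutator survives. The conjugate of the other part is M(q, qz) up to
sign, with q the conjugate of w; q and z are interior boundary values, so it vanishes by
`mixed_curve_mul_eq_zero`. -/
theorem comm_Hsum {w : ℝ → ℝ → ℂ} (hw : PerC 2 (w t))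
    (h : ∀ x, defect (z t) (fun y => (starRingEnd ℂ) (w t y)) x = 0) (α : ℝ) :
    comm w (Hsum z) (da (w * bar z)) t α =
      -mixed (z t) (w t) (fun x => w t x * (starRingEnd ℂ) (z t x)) α := by
  have hz : PerC 2 (z t) := hγ.perC.of_le (by norm_num)
  have hw1 : PerC 1 (w t) := hw.of_le (by norm_num)
  have hG : PerC 2 ((w * bar z) t) := hw.mul hz.conj
  have hd : ∀ x, da (bar z) t x = (starRingEnd ℂ) (deriv (z t) x) := da_bar hγ
  have hq : PerC 1 ((da (w * bar z) / da (bar z)) t) := by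
    have : (da (w * bar z) / da (bar z)) t = fun x =>
        deriv ((w * bar z) t) x / (starRingEnd ℂ) (deriv (z t) x) := by
      funext x
      change da (w * bar z) t x / da (bar z) t x = _
      rw [hd]
      rfl
    rw [this]
    exact hG.deriv.div (hγ.perC_deriv.of_le (by norm_num)).conj fun x =>
      (map_ne_zero _).2 (hγ.deriv_ne_zero x)
  have e1 : comm w (Hsum z) (da (w * bar z)) t α = comm w (H z) (da (w * bar z) / da z) t α +
      (w t α * Hbar z (da (w * bar z) / da (bar z)) t α -
        Hbar z (w * (da (w * bar z) / da (bar z))) t α) := by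
    have h1 : w * da (w * bar z) / da z = w * (da (w * bar z) / da z) := mul_div_assoc _ _ _
    have h2 : w * da (w * bar z) / da (bar z) = w * (da (w * bar z) / da (bar z)) :=
      mul_div_assoc _ _ _
    simp only [comm, Hsum, h1, h2, Pi.mul_apply, Pi.sub_apply, Pi.add_apply]
    ring
  rw [e1, comm_H_div hγ hw1 hG, Hbar_eq hγ hq, Hbar_eq hγ (f := w * _) (hw1.mul hq)]
  set q : ℝ → ℂ := fun y => (starRingEnd ℂ) (w t y) with hqdef
  have hqC : PerC 2 q := hw.conj
  have h2 := (mixed_curve_mul_eq_zero hγ hqC h α).1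
  rw [mixed_eq hγ (hqC.of_le (by norm_num)) (hqC.mul hz)] at h2
  have e2 : ∀ x, (starRingEnd ℂ) ((da (w * bar z) / da (bar z)) t x) =
      deriv (fun x => q x * z t x) x / deriv (z t) x := by
    intro x
    change (starRingEnd ℂ) (da (w * bar z) t x / da (bar z) t x) = _
    rw [hd, map_div₀, Complex.conj_conj, da, ← deriv_conj (hG.differentiable (by norm_num) x)]
    congr 2
    funext y
    simp [hqdef, bar]
  have e3 : defectBar (z t) ((da (w * bar z) / da (bar z)) t) α = (starRingEnd ℂ)
      (defect (z t) (fun x => deriv (fun x => q x * z t x) x / deriv (z t) x) α) := by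
    rw [defectBar, defect_congr e2]
  have e4 : defectBar (z t) ((w * (da (w * bar z) / da (bar z))) t) α = (starRingEnd ℂ)
      (defect (z t) (fun x => q x * (deriv (fun x => q x * z t x) x / deriv (z t) x)) α) := by
    rw [defectBar]
    congr 1
    refine defect_congr (fun x => ?_) α
    rw [← e2]
    change (starRingEnd ℂ) (w t x * (da (w * bar z) / da (bar z)) t x) = _
    rw [map_mul]
  rw [e3, e4]
  have h3 := congrArg (starRingEnd ℂ) h2
  rw [map_sub, map_mul, map_zero] at h3
  simp only [hqdef, Complex.conj_conj] at h3
  change -mixed (z t) (w t) (fun x => w t x * (starRingEnd ℂ) (z t x)) α +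
    (w t α * ((da (w * bar z) / da (bar z)) t α - _) -
      (w t α * (da (w * bar z) / da (bar z)) t α - _)) = _
  linear_combination -h3

theorem J1Integrand_periodic (hw : PerC 2 (dt z t)) (α : ℝ) :
    Function.Periodic (J1Integrand z t α) (2 * Real.pi) := by
  intro β
  have hG : PerC 2 ((dt z * bar z) t) := hw.mul (hγ.perC.of_le (by norm_num)).conj
  have h1 : da (dt z * bar z) t (β + 2 * Real.pi) = da (dt z * bar z) t β := hG.deriv.per β
  simp only [J1Integrand, h1, hw.per β, hγ.periodic β, (perC_eps hγ).per β, bar]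

/-- The weighted increment of ε/z̄ in the numerator equals -z̄(α)z̄(β)Δz - Δz̄, where Δ denotes the
value at β minus that at α. Dividing by |Δz|² and writing z̄(β) = z̄(α) + Δz̄ gives the integrand of
M plus two terms whose integrals vanish. -/
theorem J1Integrand_eq (h0 : ∀ x, z t x ≠ 0) (α : ℝ) {u : ℝ}
    (hu : u ∈ increments) (hu0 : u ≠ 0) :
    J1Integrand z t α (α + u) = (dt z t (α + u) - dt z t α) / (z t (α + u) - z t α) *
        deriv ((dt z * bar z) t) (α + u) +
      ((starRingEnd ℂ) (z t α) ^ 2 * (starRingEnd ℂ) (((starRingEnd ℂ) (dt z t (α + u)) -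
        (starRingEnd ℂ) (dt z t α)) / (z t (α + u) - z t α) *
          (starRingEnd ℂ) (deriv ((dt z * bar z) t) (α + u))) +
      (starRingEnd ℂ) (z t α) * ((dt z t (α + u) - dt z t α) *
        deriv ((dt z * bar z) t) (α + u))) := by
  have b1 := hγ.sub_ne_zero α hu hu0
  have b2 : (starRingEnd ℂ) (z t (α + u) - z t α) ≠ 0 := (map_ne_zero _).2 b1
  have b3 : (starRingEnd ℂ) (z t α) ≠ 0 := (map_ne_zero _).2 (h0 α)
  have b4 : (starRingEnd ℂ) (z t (α + u)) ≠ 0 := (map_ne_zero _).2 (h0 (α + u))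
  simp only [J1Integrand, ofReal_norm_sq, bar, eps_eq, map_mul, map_sub, map_div₀,
    Complex.conj_conj, da]
  rw [map_sub] at b2
  field_simp
  ring

/-- The two extra integrals vanish because the conjugate velocity is an interior boundary value: one
is a conjugated M(q, qz), the other a conjugated contour integral of an element of the kernel of A,
up to the integral of a derivative. -/
theorem J1_eq (h0 : ∀ x, z t x ≠ 0) (hw : PerC 2 (dt z t))
    (h : ∀ x, defect (z t) (fun y => (starRingEnd ℂ) (dt z t y)) x = 0) (α : ℝ) :
    IntervalIntegrable (J1Integrand z t α) volume 0 (2 * Real.pi) ∧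
    1 / (Real.pi * Complex.I) * J1 z t α =
      mixed (z t) (dt z t) (fun x => dt z t x * (starRingEnd ℂ) (z t x)) α := by
  have hz : PerC 2 (z t) := hγ.perC.of_le (by norm_num)
  have hG : PerC 2 ((dt z * bar z) t) := hw.mul hz.conj
  have hw1 : PerC 1 (dt z t) := hw.of_le (by norm_num)
  have R1 : Reg univ 0 (fun α u => (dt z t (α + u) - dt z t α) / (z t (α + u) - z t α) *
        deriv ((dt z * bar z) t) (α + u)) :=
    reg_mixed hγ (by norm_num) hw1 (hG.of_le (by norm_num))
  have R2 : Reg univ 0 (fun α u => (((starRingEnd ℂ) (dt z t (α + u)) -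
      (starRingEnd ℂ) (dt z t α)) / (z t (α + u) - z t α) *
        (starRingEnd ℂ) (deriv ((dt z * bar z) t) (α + u)))) :=
    (reg_quot hγ (by norm_num) hw1.conj).mul
      ((reg_shift (hG.deriv.of_le (by norm_num))).conj)
  have R3 : Reg univ 0 (fun α u => (dt z t (α + u) - dt z t α) *
        deriv ((dt z * bar z) t) (α + u)) :=
    ((reg_shift (hw1.of_le (by norm_num))).sub (reg_base (hw1.of_le (by norm_num)))).mul
      (reg_shift (hG.deriv.of_le (by norm_num)))
  have i1 := R1.intervalIntegrable (mem_univ α)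
  have i2 := (R2.conj.intervalIntegrable (mem_univ α)).const_mul ((starRingEnd ℂ) (z t α) ^ 2)
  have i3 := (R3.intervalIntegrable (mem_univ α)).const_mul ((starRingEnd ℂ) (z t α))
  have hii : IntervalIntegrable (fun u => J1Integrand z t α (α + u)) volume (-Real.pi) Real.pi := by
    refine (i1.add (i2.add i3)).congr_ae ?_
    have hz0 : ∀ᵐ u : ℝ ∂volume, u ≠ 0 := by simp [ae_iff]
    filter_upwards [ae_restrict_of_ae hz0, ae_restrict_mem measurableSet_uIoc] with u hu0 hu
    exact (J1Integrand_eq hγ h0 α (mem_increments_of_mem_uIcc (uIoc_subset_uIcc hu)) hu0).symm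
  refine ⟨intervalIntegrable_of_shift (J1Integrand_periodic hγ hw α) hii, ?_⟩
  rw [J1, ← integral_shift_eq (J1Integrand_periodic hγ hw α) α, mixed]
  congr 1
  set q : ℝ → ℂ := fun y => (starRingEnd ℂ) (dt z t y) with hqdef
  have hqC : PerC 2 q := hw.conj
  have eG : ∀ x, (starRingEnd ℂ) (deriv ((dt z * bar z) t) x) =
      deriv (fun x => q x * z t x) x := by
    intro x
    rw [← deriv_conj (hG.differentiable (by norm_num) x)]
    congr 1
    funext y
    simp [hqdef, bar]
  obtain ⟨h2, h3⟩ := mixed_curve_mul_eq_zero hγ hqC h α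
  have h2' : ∫ u in (-Real.pi)..Real.pi, ((starRingEnd ℂ) (dt z t (α + u)) -
      (starRingEnd ℂ) (dt z t α)) / (z t (α + u) - z t α) *
        (starRingEnd ℂ) (deriv ((dt z * bar z) t) (α + u)) = 0 := by
    rw [mixed] at h2
    simp only [eG]
    exact (mul_eq_zero.1 h2).resolve_left (one_div_ne_zero pi_mul_I_ne_zero)
  have h3' : ∫ u in (-Real.pi)..Real.pi, (dt z t (α + u) - dt z t α) *
        deriv ((dt z * bar z) t) (α + u) = 0 := by
    have hc1 : Continuous (dt z t) := hw.smooth.continuous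
    have hc2 : Continuous (deriv ((dt z * bar z) t)) :=
      (hG.deriv.of_le (m := 0) (by norm_num)).smooth.continuous
    have e5 : ∫ u in (-Real.pi)..Real.pi, dt z t (α + u) * deriv ((dt z * bar z) t) (α + u) =
        0 := by
      rw [contour_eq_shift hγ (((hqC.of_le (m := 1) (by norm_num)).mul
        (perC_deriv_div hγ (n := 1) (by norm_num) (hqC.mul hz))).per) α] at h3
      have h4 := congrArg (starRingEnd ℂ) h3
      rw [← intervalIntegral.intervalIntegral_conj, map_zero] at h4
      rw [← h4]
      refine intervalIntegral.integral_congr fun u _ => ?_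
      have h5 := hγ.deriv_ne_zero (α + u)
      rw [mul_assoc, div_mul_cancel₀ _ h5, map_mul, ← eG, Complex.conj_conj]
      simp only [Complex.conj_conj]
    simp only [sub_mul]
    rw [intervalIntegral.integral_sub (Continuous.intervalIntegrable (by fun_prop) _ _)
      (Continuous.intervalIntegrable (by fun_prop) _ _), e5,
      intervalIntegral.integral_const_mul, integral_deriv_shift (hG.of_le (by norm_num))]
    ring
  rw [integral_congr_increments fun u hu hu0 => J1Integrand_eq hγ h0 α hu hu0,
    intervalIntegral.integral_add i1 (i2.add i3), intervalIntegral.integral_add i2 i3,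
    intervalIntegral.integral_const_mul, intervalIntegral.integral_const_mul, h3',
    intervalIntegral.intervalIntegral_conj, h2']
  simp only [map_zero, mul_zero, add_zero]
  rfl

theorem J2Integrand_periodic (hw : PerC 2 (dt z t)) (α : ℝ) :
    Function.Periodic (J2Integrand z t α) (2 * Real.pi) := by
  intro β
  have h1 : da (eps z) t (β + 2 * Real.pi) = da (eps z) t β := (perC_eps hγ).deriv.per β
  simp only [J2Integrand, h1, hw.per β, hγ.periodic β]

theorem J2_eq (hw : PerC 2 (dt z t)) (α : ℝ) :
    IntervalIntegrable (J2Integrand z t α) volume 0 (2 * Real.pi) ∧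
    J2 z t α = ∫ u in (-Real.pi)..Real.pi,
      ((dt z t (α + u) - dt z t α) / (z t (α + u) - z t α)) ^ 2 * da (eps z) t (α + u) := by
  have hQ := reg_quot hγ (n := 0) (by norm_num) (hw.of_le (by norm_num))
  have R := (hQ.mul hQ).mul (reg_shift ((perC_eps hγ).deriv.of_le (m := 0) (by norm_num)))
  refine ⟨intervalIntegrable_of_shift (J2Integrand_periodic hγ hw α) (α := α) ?_, ?_⟩
  · refine (R.intervalIntegrable (mem_univ α)).congr fun u _ => ?_
    simp only [J2Integrand, da, pow_two]
  · rw [J2, ← integral_shift_eq (J2Integrand_periodic hγ hw α) α]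
    rfl

/-- In A E(ε), the terms 2Aε and A²ε cancel and the constant disappears. In M(E(z), ε), the
contributions of 2z and of the constant vanish and -M(z Aε, ε) remains. This cancels A(z M(ε, ε)) by
`defect_curve_mul_mixed`. -/
theorem key_identity (h0 : ∀ x, z t x ≠ 0) (α : ℝ) :
    -defect (z t) (defectBar (z t) (eps z t)) α -
      mixed (z t) (defectBar (z t) (z t)) (eps z t) α =
    defect (z t) (E z (eps z) t) α + mixed (z t) (E z z t) (eps z t) α := by
  have he := perC_eps hγ
  set e := eps z t with hedef
  set γ := z t with hγdef
  have he1 : PerC 1 e := he.of_le (by norm_num)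
  have he2 : PerC 2 e := he.of_le (by norm_num)
  have hz1 : PerC 1 γ := hγ.perC.of_le (by norm_num)
  have hAe : PerC 1 (defect γ e) := PerC.defect hγ (by norm_num) he2
  have hBe : PerC 1 (defectBar γ e) := PerC.defectBar hγ (by norm_num) he2
  have hBz : PerC 1 (defectBar γ γ) := PerC.defectBar hγ (by norm_num)
    (hγ.perC.of_le (by norm_num))
  have hC : ∀ {f : ℝ → ℂ}, PerC 1 f → ∃ c : ℂ, ∀ α, 1 / (Real.pi * Complex.I) *
      (∫ u in (-Real.pi)..Real.pi, f (α + u) * (deriv γ (α + u) / γ (α + u))) = c := by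
    intro f hf
    have hP : PerC 0 (fun x => f x * (deriv γ x / γ x)) :=
      (hf.of_le (by norm_num)).mul ((hγ.perC_deriv.of_le (by norm_num)).div
        (hz1.of_le (by norm_num)) h0)
    exact ⟨_, fun α => by rw [integral_shift_eq hP.per α]⟩
  obtain ⟨c₁, hc₁⟩ := hC he1
  obtain ⟨c₂, hc₂⟩ := hC hz1
  have hMC : PerC 1 (mixed γ e e) := by
    have hh : PerC 2 (fun x => deriv e x / deriv γ x) := perC_deriv_div hγ (by norm_num) he
    rw [show mixed γ e e = _ from funext (mixed_eq hγ he1 he2)]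
    exact (he1.mul (PerC.defect hγ (by norm_num) hh)).sub
      (PerC.defect hγ (by norm_num) (he2.mul hh))
  have hE1 : E z (eps z) t = fun x => (2 * e x - defect γ e x) - defectBar γ e x - c₁ +
      γ x * mixed γ e e x := by
    funext x
    rw [E_eq hγ h0 (f := eps z) he1, hc₁]
  have hE2 : E z z t = fun x => (2 * γ x + -1 * defectBar γ γ x) + (-c₂) +
      -1 * (γ x * defect γ e x) := by
    funext x
    rw [E_eq hγ h0 (f := z) hz1, hc₂, defect_curve hγ, mixed_curve_right]
    ring
  have p2e := (PerC.const 2 (n := 1)).mul he1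
  have p2z := (PerC.const 2 (n := 1)).mul hz1
  have pm {f : ℝ → ℂ} (hf : PerC 1 f) : PerC 1 (fun x => -1 * f x) := (PerC.const (-1)).mul hf
  rw [hE1, hE2, defect_add hγ (((p2e.sub hAe).sub hBe).sub (PerC.const c₁)) (hz1.mul hMC),
    defect_sub hγ ((p2e.sub hAe).sub hBe) (PerC.const c₁), defect_sub hγ (p2e.sub hAe) hBe,
    defect_sub hγ p2e hAe, defect_const_mul, defect_defect hγ he1 hAe, defect_const,
    defect_curve_mul_mixed hγ he,
    mixed_add hγ ((p2z.add (pm hBz)).add (PerC.const _)) (pm (hz1.mul hAe)) he2,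
    mixed_add hγ (p2z.add (pm hBz)) (PerC.const _) he2, mixed_add hγ p2z (pm hBz) he2,
    mixed_const_mul, mixed_const_mul, mixed_const_mul, mixed_const, mixed_curve hγ he1]
  ring

end slice

/-! ### The self-gravity of the enclosed region -/

theorem measurable_indicator_norm_rpow (s ρ : ℝ) :
    Measurable (indicator (Metric.ball (0 : ℂ) ρ) fun v => ‖v‖ ^ (-s)) :=
  (measurable_norm.pow_const (-s)).indicator measurableSet_ball

theorem integrable_indicator_norm_rpow {s : ℝ} (hs : s < 2) (ρ : ℝ) :
    Integrable (indicator (Metric.ball (0 : ℂ) ρ) fun v => ‖v‖ ^ (-s)) := by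
  rw [integrable_indicator_iff measurableSet_ball]
  refine integrableOn_ball_of_norm_le_rpow (C := 1) (α := s) (by simp) (by simpa using hs) ?_
    (measurable_norm.pow_const (-s)).aestronglyMeasurable
  refine Eventually.of_forall fun x => ?_
  rw [one_mul, Real.norm_of_nonneg (by positivity)]

theorem integrable_prod_comp_sub {k : ℂ → ℝ} (hkm : Measurable k) (hk : Integrable k) {a b : ℝ}
    {w : ℝ → ℝ} (hw : IntervalIntegrable w volume a b) {φ : ℝ → ℂ} (hφ : Continuous φ) :
    Integrable (fun q : ℝ × ℂ => w q.1 * k (φ q.1 - q.2))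
      ((volume.restrict (uIoc a b)).prod volume) := by
  rw [intervalIntegrable_iff] at hw
  have hm : AEStronglyMeasurable (fun q : ℝ × ℂ => w q.1 * k (φ q.1 - q.2))
      ((volume.restrict (uIoc a b)).prod volume) := by
    refine hw.aestronglyMeasurable.comp_fst.mul ?_
    exact (hkm.comp (((hφ.comp continuous_fst).sub continuous_snd).measurable)).aestronglyMeasurable
  refine (integrable_prod_iff hm).2 ⟨Eventually.of_forall fun u =>
    (hk.comp_sub_left (φ u)).const_mul (w u), ?_⟩
  have h : (fun u => ∫ y, ‖w u * k (φ u - y)‖) = fun u => ‖w u‖ * ∫ y, ‖k y‖ := by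
    funext u
    simp only [norm_mul, integral_const_mul]
    rw [integral_sub_left_eq_self (fun y => ‖k y‖)]
  simp only [h]
  exact hw.norm.mul_const _

theorem integrable_prod_div_sub {a b R : ℝ} {w φ : ℝ → ℂ} (hw : Continuous w) (hφ : Continuous φ)
    {ρ : ℝ} (hρ : ∀ u, ‖φ u‖ ≤ ρ) :
    Integrable (fun q : ℝ × ℂ => w q.1 / (φ q.1 - q.2))
      ((volume.restrict (uIoc a b)).prod (volume.restrict (Metric.ball 0 R))) := by
  have h1 := integrable_prod_comp_sub (measurable_indicator_norm_rpow 1 (ρ + R))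
    (integrable_indicator_norm_rpow (by norm_num) (ρ + R))
    (w := fun u => ‖w u‖) (a := a) (b := b) (hw.norm.intervalIntegrable a b) hφ
  have h2 := h1.mono_measure (Measure.prod_mono le_rfl
    (Measure.restrict_le_self (s := Metric.ball (0 : ℂ) R)))
  refine h2.mono' (Measurable.aestronglyMeasurable (by fun_prop)) ?_
  have h3 : ∀ᵐ q ∂((volume.restrict (uIoc a b)).prod
      (volume.restrict (Metric.ball (0 : ℂ) R))), q.2 ∈ Metric.ball (0 : ℂ) R :=
    Measure.quasiMeasurePreserving_snd.ae (ae_restrict_mem measurableSet_ball)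
  filter_upwards [h3] with q hq
  have h4 : φ q.1 - q.2 ∈ Metric.ball (0 : ℂ) (ρ + R) := by
    rw [mem_ball_zero_iff] at hq ⊢
    linarith [norm_sub_le (φ q.1) q.2, hρ q.1]
  rw [indicator_of_mem h4, norm_div, Real.rpow_neg_one, div_eq_mul_inv]

theorem integrableOn_inv_sub (p : ℂ) (R : ℝ) :
    IntegrableOn (fun y => (p - y)⁻¹) (Metric.ball (0 : ℂ) R) := by
  have h1 := ((integrable_indicator_norm_rpow (s := 1) (by norm_num) (‖p‖ + R)).comp_sub_left p)
  refine (h1.mono_measure (Measure.restrict_le_self (s := Metric.ball (0 : ℂ) R))).mono'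
    (Measurable.aestronglyMeasurable (by fun_prop)) ?_
  filter_upwards [ae_restrict_mem measurableSet_ball] with y hy
  have h4 : p - y ∈ Metric.ball (0 : ℂ) (‖p‖ + R) := by
    rw [mem_ball_zero_iff] at hy ⊢
    linarith [norm_sub_le p y]
  rw [indicator_of_mem h4, norm_inv, Real.rpow_neg_one]

theorem integral_circleMap_of_diffContOnCl {f : ℂ → ℂ} (hf : DiffContOnCl ℂ f (Metric.ball 0 1)) :
    ∫ θ in (0 : ℝ)..(2 * Real.pi), f (circleMap 0 1 θ) = 2 * Real.pi * f 0 := by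
  have h := DiffContOnCl.circleAverage (f := f) (c := 0) (R := 1) (by simpa using hf)
  rw [Real.circleAverage_def, Complex.real_smul] at h
  rw [← h]
  have := Real.pi_ne_zero
  push_cast
  field_simp

theorem integral_inv_sub_circleMap_mul_of_lt {p y : ℂ} (h : ‖y‖ < ‖p‖) :
    ∫ θ in (0 : ℝ)..(2 * Real.pi), (p - circleMap 0 1 θ * y)⁻¹ = 2 * Real.pi * p⁻¹ := by
  have hd : DiffContOnCl ℂ (fun ζ : ℂ => (p - ζ * y)⁻¹) (Metric.ball 0 1) := by
    refine DifferentiableOn.diffContOnCl fun ζ hζ => ?_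
    rw [closure_ball _ one_ne_zero, mem_closedBall_zero_iff] at hζ
    refine (DifferentiableAt.inv (by fun_prop) fun h0 => ?_).differentiableWithinAt
    rw [sub_eq_zero] at h0
    rw [h0, norm_mul] at h
    nlinarith [norm_nonneg y]
  simpa using integral_circleMap_of_diffContOnCl hd

/-- On the unit circle the conjugate of ζ is 1/ζ, so the conjugate integrand is ζ/(p̄ζ - ȳ),
holomorphic on the disc when |p| < |y| and zero at the origin. -/
theorem integral_inv_sub_circleMap_mul_of_gt {p y : ℂ} (h : ‖p‖ < ‖y‖) :
    ∫ θ in (0 : ℝ)..(2 * Real.pi), (p - circleMap 0 1 θ * y)⁻¹ = 0 := by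
  have hd : DiffContOnCl ℂ (fun ζ : ℂ => ζ / ((starRingEnd ℂ) p * ζ - (starRingEnd ℂ) y))
      (Metric.ball 0 1) := by
    refine DifferentiableOn.diffContOnCl fun ζ hζ => ?_
    rw [closure_ball _ one_ne_zero, mem_closedBall_zero_iff] at hζ
    refine (DifferentiableAt.div (by fun_prop) (by fun_prop) fun h0 => ?_).differentiableWithinAt
    rw [sub_eq_zero] at h0
    rw [← Complex.norm_conj y, ← h0, norm_mul, Complex.norm_conj] at h
    nlinarith [norm_nonneg p]
  have h1 := integral_circleMap_of_diffContOnCl hd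
  rw [zero_div, mul_zero] at h1
  rw [← map_eq_zero (starRingEnd ℂ), ← intervalIntegral.intervalIntegral_conj]
  refine (intervalIntegral.integral_congr fun θ _ => ?_).trans h1
  have h2 : circleMap 0 1 θ ≠ 0 := by simp [circleMap]
  have h3 : (starRingEnd ℂ) (circleMap 0 1 θ) = (circleMap 0 1 θ)⁻¹ := by
    rw [Complex.inv_def, Complex.normSq_eq_norm_sq]
    simp
  simp only [map_inv₀, map_sub, map_mul, h3]
  rw [← inv_div]
  congr 1
  field_simp

/-- The ball is rotation invariant, so the kernel may be averaged over rotations of y. The mean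
value property makes the average 1/p for |y| < |p| and 0 for |y| > |p|, leaving π|p|²/p. -/
theorem setIntegral_ball_inv_sub (p : ℂ) {R : ℝ} (hp : ‖p‖ < R) :
    ∫ y in Metric.ball (0 : ℂ) R, (p - y)⁻¹ = Real.pi * (starRingEnd ℂ) p := by
  have hpi := Real.pi_pos
  have hn : ∀ θ, ‖circleMap 0 1 θ‖ = 1 := fun θ => by simp
  have hne : ∀ θ, circleMap 0 1 θ ≠ 0 := fun θ => by simp [circleMap]
  have h1 : ∀ θ : ℝ, ∫ y in Metric.ball (0 : ℂ) R, (p - circleMap 0 1 θ * y)⁻¹ =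
      ∫ y in Metric.ball (0 : ℂ) R, (p - y)⁻¹ := by
    intro θ
    have hm := (rotation (Circle.exp θ)).measurePreserving
    have h := hm.setIntegral_preimage_emb (rotation (Circle.exp θ)).toHomeomorph.measurableEmbedding
      (fun y => (p - y)⁻¹) (Metric.ball 0 R)
    rw [← h]
    have hs : (rotation (Circle.exp θ)) ⁻¹' Metric.ball (0 : ℂ) R = Metric.ball 0 R := by
      ext y
      rw [mem_preimage, mem_ball_zero_iff, mem_ball_zero_iff, LinearIsometryEquiv.norm_map]
    rw [hs]
    simp [circleMap, rotation_apply]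
  have hi : Integrable (Function.uncurry fun (θ : ℝ) (y : ℂ) => (p - circleMap 0 1 θ * y)⁻¹)
      ((volume.restrict (uIoc 0 (2 * Real.pi))).prod (volume.restrict (Metric.ball 0 R))) := by
    have hc : Continuous fun θ => (circleMap 0 1 θ)⁻¹ := (continuous_circleMap 0 1).inv₀ hne
    have := integrable_prod_div_sub (a := 0) (b := 2 * Real.pi) (R := R)
      (φ := fun θ => (circleMap 0 1 θ)⁻¹ * p) hc (hc.mul continuous_const) (ρ := ‖p‖)
      fun θ => by rw [norm_mul, norm_inv, hn]; simp
    refine this.congr (Eventually.of_forall fun q => ?_)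
    have h3 := hne q.1
    simp only [Function.uncurry]
    rw [div_eq_mul_inv, ← mul_inv]
    congr 1
    field_simp
  have h2 := intervalIntegral_integral_swap hi
  simp only [h1, intervalIntegral.integral_const, sub_zero] at h2
  have h3 : ∫ y in Metric.ball (0 : ℂ) R, ∫ θ in (0 : ℝ)..(2 * Real.pi),
      (p - circleMap 0 1 θ * y)⁻¹ = ∫ y in Metric.ball (0 : ℂ) R,
        indicator (Metric.ball 0 ‖p‖) (fun _ => 2 * Real.pi * p⁻¹) y := by
    refine integral_congr_ae (ae_restrict_of_ae ?_)
    have h4 : ∀ᵐ y : ℂ, y ∉ Metric.sphere (0 : ℂ) ‖p‖ :=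
      measure_eq_zero_iff_ae_notMem.1 (Measure.addHaar_sphere volume 0 ‖p‖)
    filter_upwards [h4] with y hy
    rw [mem_sphere_zero_iff_norm] at hy
    rcases lt_or_gt_of_ne hy with h | h
    · rw [integral_inv_sub_circleMap_mul_of_lt h, indicator_of_mem (by simpa using h)]
    · rw [integral_inv_sub_circleMap_mul_of_gt h, indicator_of_notMem (by simpa using h.le)]
  rw [h3, setIntegral_indicator measurableSet_ball, inter_eq_right.2 (Metric.ball_subset_ball hp.le),
    setIntegral_const, Measure.real, Complex.volume_ball, Complex.real_smul, Complex.real_smul] at h2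
  have h5 : (2 * Real.pi : ℂ) ≠ 0 := by simp [Real.pi_ne_zero]
  refine mul_left_cancel₀ h5 ?_
  push_cast at h2
  rw [h2]
  simp only [ENNReal.toReal_mul, ENNReal.toReal_pow, ENNReal.toReal_ofReal (norm_nonneg p),
    ENNReal.coe_toReal, NNReal.coe_real_pi]
  by_cases h0 : p = 0
  · simp [h0]
  · have := Complex.mul_conj' p
    push_cast
    rw [← this]
    field_simp

theorem intervalIntegrable_abs_rpow {r : ℝ} (hr : -1 < r) (a : ℝ) :
    IntervalIntegrable (fun u : ℝ => |u| ^ r) volume (-a) a := by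
  refine intervalIntegrable_of_even (fun u => by rw [abs_neg]) fun x hx => ?_
  refine (intervalIntegral.intervalIntegrable_rpow' hr).congr fun u hu => ?_
  rw [uIoc_of_le hx.le] at hu
  rw [abs_of_pos hu.1]

/-- The larger of the two distances is at least d/2; half of its inverse power is spent on d and
half on the smaller distance. The exponents 1/2 on the line and 3/2 in the plane are both
integrable, which justifies Fubini for two Cauchy kernels whose poles collide. The sharp constant √2
is rounded up to 2. -/
theorem inv_mul_inv_le {a b d : ℝ} (ha : 0 < a) (hb : 0 < b) (hd : 0 < d) (h : d ≤ a + b) :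
    a⁻¹ * b⁻¹ ≤ 2 * d ^ (-(1 / 2) : ℝ) * (a ^ (-(3 / 2) : ℝ) + b ^ (-(3 / 2) : ℝ)) := by
  wlog hab : a ≤ b generalizing a b
  · rw [mul_comm a⁻¹, add_comm (a ^ _)]
    exact this hb ha (by linarith) (by linarith)
  have h1 : b⁻¹ ≤ 2 * d ^ (-(1 / 2) : ℝ) * a ^ (-(1 / 2) : ℝ) := by
    have e1 : b⁻¹ = b ^ (-(1 / 2) : ℝ) * b ^ (-(1 / 2) : ℝ) := by
      rw [← Real.rpow_add hb, ← Real.rpow_neg_one]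
      norm_num
    have e2 : b ^ (-(1 / 2) : ℝ) ≤ a ^ (-(1 / 2) : ℝ) :=
      Real.rpow_le_rpow_of_nonpos ha hab (by norm_num)
    have e3 : b ^ (-(1 / 2) : ℝ) ≤ 2 * d ^ (-(1 / 2) : ℝ) := by
      have e4 : b ^ (-(1 / 2) : ℝ) ≤ (d / 2) ^ (-(1 / 2) : ℝ) :=
        Real.rpow_le_rpow_of_nonpos (by positivity) (by linarith) (by norm_num)
      refine e4.trans ?_
      rw [Real.div_rpow hd.le (by norm_num), Real.rpow_neg (x := 2) (by norm_num) (1 / 2),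
        div_inv_eq_mul, mul_comm]
      refine mul_le_mul_of_nonneg_right ?_ (by positivity)
      calc (2 : ℝ) ^ (1 / 2 : ℝ) ≤ 2 ^ (1 : ℝ) :=
            Real.rpow_le_rpow_of_exponent_le (by norm_num) (by norm_num)
        _ = 2 := Real.rpow_one 2
    rw [e1]
    exact mul_le_mul e3 e2 (by positivity) (by positivity)
  have h2 : a⁻¹ * a ^ (-(1 / 2) : ℝ) = a ^ (-(3 / 2) : ℝ) := by
    rw [← Real.rpow_neg_one, ← Real.rpow_add ha]
    norm_num
  calc a⁻¹ * b⁻¹ ≤ a⁻¹ * (2 * d ^ (-(1 / 2) : ℝ) * a ^ (-(1 / 2) : ℝ)) :=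
        mul_le_mul_of_nonneg_left h1 (by positivity)
    _ = 2 * d ^ (-(1 / 2) : ℝ) * a ^ (-(3 / 2) : ℝ) := by rw [← h2]; ring
    _ ≤ _ := mul_le_mul_of_nonneg_left (le_add_of_nonneg_right (by positivity)) (by positivity)

/-! ### Area integrals over the enclosed region as contour integrals -/

section curve

variable {γ : ℝ → ℂ} (hγ : IsSmoothParam γ)
include hγ

theorem volume_range_eq_zero : volume (range γ) = 0 := by
  have h1 : volume ≪ (Measure.hausdorffMeasure (Module.finrank ℝ ℂ : ℝ) : Measure ℂ) :=
    Measure.absolutelyContinuous_isAddHaarMeasure _ _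
  refine measure_zero_of_dimH_lt (d := 2) (by simpa using h1) ?_
  refine hγ.contDiff.dimH_range_le.trans_lt ?_
  simp

theorem exists_norm_lt : ∃ R, ∀ β, ‖γ β‖ < R := by
  have hc : Continuous γ := hγ.contDiff.continuous
  obtain ⟨M, hM⟩ := (isCompact_Icc (a := (0 : ℝ)) (b := 2 * Real.pi)).exists_bound_of_continuousOn
    hc.continuousOn
  refine ⟨M + 1, fun β => ?_⟩
  obtain ⟨x, hx, h⟩ := hγ.periodic.exists_mem_Ico₀ Real.two_pi_pos β
  rw [h]
  linarith [hM x ⟨hx.1, hx.2.le⟩]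

theorem windingNumber_eq_shift (w : ℂ) (α : ℝ) :
    windingNumber γ w = 1 / (2 * Real.pi * Complex.I) *
      ∫ u in (-Real.pi)..Real.pi, deriv γ (α + u) / (γ (α + u) - w) := by
  rw [← cauchyInt_one, cauchyInt_eq_shift hγ (f := fun _ => 1) (fun _ => rfl) w α]
  simp

/-- When w lies farther out than the whole curve, 1 - γ/w stays in the right half plane, and its
principal logarithm is a periodic primitive of the integrand. -/
theorem windingNumber_eq_zero_of_forall_norm_lt {w : ℂ} (hw : ∀ β, ‖γ β‖ < ‖w‖) :
    windingNumber γ w = 0 := by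
  have hw0 : w ≠ 0 := norm_pos_iff.1 ((norm_nonneg _).trans_lt (hw 0))
  have hn : ∀ β, ‖γ β / w‖ < 1 := fun β => by
    rw [norm_div, div_lt_one (norm_pos_iff.2 hw0)]
    exact hw β
  have hs : ∀ β, 1 - γ β / w ∈ Complex.slitPlane := fun β => by
    refine Or.inl ?_
    have := (Complex.abs_re_le_norm (γ β / w)).trans_lt (hn β)
    rw [abs_lt] at this
    simp only [Complex.sub_re, Complex.one_re]
    linarith
  have hd : ∀ β, HasDerivAt (fun β => Complex.log (1 - γ β / w)) (deriv γ β / (γ β - w)) β := by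
    intro β
    have h1 := (hγ.perC.differentiable (by norm_num) β).hasDerivAt
    have h2 : HasDerivAt (fun β => 1 - γ β / w) (-(deriv γ β / w)) β := by
      simpa using (h1.div_const w).const_sub 1
    have h3 := h2.clog_real (hs β)
    have h4 : γ β - w ≠ 0 := fun h => by
      have := hw β
      rw [sub_eq_zero.1 h] at this
      exact lt_irrefl _ this
    have h5 := Complex.slitPlane_ne_zero (hs β)
    convert h3 using 1
    have h6 : 1 - γ β / w = -(γ β - w) / w := by
      field_simp
      ring
    rw [h6]
    field_simp
  have hc : Continuous fun β => deriv γ β / (γ β - w) := by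
    refine hγ.perC_deriv.smooth.continuous.div
      (hγ.contDiff.continuous.sub continuous_const) fun β h => ?_
    have := hw β
    rw [sub_eq_zero.1 h] at this
    exact lt_irrefl _ this
  rw [windingNumber, intervalIntegral.integral_eq_sub_of_hasDerivAt (fun β _ => hd β)
    (hc.intervalIntegrable _ _)]
  have := hγ.periodic 0
  rw [zero_add] at this
  simp [this]

theorem measurableSet_enclosedRegion : MeasurableSet (enclosedRegion γ) := by
  have hr : IsClosed (range γ) := by
    have : range γ = γ '' Icc 0 (2 * Real.pi) := by
      rw [← hγ.periodic.image_Icc Real.two_pi_pos 0, zero_add]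
    rw [this]
    exact (isCompact_Icc.image hγ.contDiff.continuous).isClosed
  have hc := hγ.contDiff.continuous
  have hc' := hγ.perC_deriv.smooth.continuous
  have hm : Measurable (windingNumber γ) := by
    have h1 : StronglyMeasurable fun q : ℂ × ℝ => deriv γ q.2 / (γ q.2 - q.1) :=
      Measurable.stronglyMeasurable (by fun_prop)
    have h2 := (h1.integral_prod_right' (ν := volume.restrict (Ioc 0 (2 * Real.pi)))).measurable
    have h3 : windingNumber γ = fun w => 1 / (2 * Real.pi * Complex.I) *
        ∫ β in Ioc 0 (2 * Real.pi), deriv γ β / (γ β - w) := by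
      funext w
      rw [windingNumber, intervalIntegral.integral_of_le Real.two_pi_pos.le]
    rw [h3]
    exact h2.const_mul _
  exact hr.measurableSet.compl.inter (hm (measurableSet_singleton 0).compl)

/-- The winding number is the indicator of the region off the null set of the curve, and it vanishes
outside the ball. Replacing the indicator by the winding integral and exchanging integrals reduces
the unknown region to a ball. -/
theorem setIntegral_enclosedRegion {R : ℝ} (hR : ∀ β, ‖γ β‖ < R) {g : ℂ → ℂ} (α : ℝ)
    (hi : Integrable (Function.uncurry fun (u : ℝ) (y : ℂ) =>
      deriv γ (α + u) / (γ (α + u) - y) * g y)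
      ((volume.restrict (uIoc (-Real.pi) Real.pi)).prod (volume.restrict (Metric.ball 0 R)))) :
    ∫ y in enclosedRegion γ, g y = 1 / (2 * Real.pi * Complex.I) *
      ∫ u in (-Real.pi)..Real.pi, ∫ y in Metric.ball (0 : ℂ) R,
        deriv γ (α + u) / (γ (α + u) - y) * g y := by
  rw [intervalIntegral_integral_swap hi, ← integral_const_mul,
    ← integral_indicator (measurableSet_enclosedRegion hγ), ← integral_indicator measurableSet_ball]
  refine integral_congr_ae ?_
  filter_upwards [measure_eq_zero_iff_ae_notMem.1 (volume_range_eq_zero hγ)] with y hy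
  have h1 : 1 / (2 * Real.pi * Complex.I) *
      ∫ u in (-Real.pi)..Real.pi, deriv γ (α + u) / (γ (α + u) - y) * g y =
      windingNumber γ y * g y := by
    rw [windingNumber_eq_shift hγ y α, intervalIntegral.integral_mul_const, ← mul_assoc]
  by_cases h2 : y ∈ Metric.ball (0 : ℂ) R
  · rw [indicator_of_mem h2, h1]
    rcases windingNumber_eq_zero_or_one hγ hy with h3 | h3
    · rw [indicator_of_notMem (fun h => h.2 h3), h3, zero_mul]
    · have h4 : y ∈ enclosedRegion γ := ⟨hy, by rw [h3]; exact one_ne_zero⟩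
      rw [indicator_of_mem h4, h3, one_mul]
  · have h3 : windingNumber γ y = 0 :=
      windingNumber_eq_zero_of_forall_norm_lt hγ fun β => by
        rw [mem_ball_zero_iff, not_lt] at h2
        exact (hR β).trans_le h2
    rw [indicator_of_notMem h2, indicator_of_notMem (fun h => h.2 h3)]

/-- This is Green's formula, that the contour integral of z̄ is 2i times the area. It comes from the
preceding representation with g = 1 and the ball integral of the Cauchy kernel. -/
theorem contour_conj (hA : volume (enclosedRegion γ) = ENNReal.ofReal Real.pi) :
    contour γ (fun x => (starRingEnd ℂ) (γ x)) = 2 * Real.pi * Complex.I := by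
  obtain ⟨R, hR⟩ := exists_norm_lt hγ
  have hc := hγ.contDiff.continuous
  have hc' := hγ.perC_deriv.smooth.continuous
  have h0 := setIntegral_enclosedRegion hγ hR (g := fun _ => 1) 0 (by
    simp only [mul_one]
    exact integrable_prod_div_sub (w := fun u => deriv γ (0 + u)) (φ := fun u => γ (0 + u))
      (by fun_prop) (by fun_prop) fun u => (hR _).le)
  rw [setIntegral_const, Measure.real, hA, ENNReal.toReal_ofReal Real.pi_pos.le] at h0
  have h1 : ∀ u : ℝ, ∫ y in Metric.ball (0 : ℂ) R, deriv γ (0 + u) / (γ (0 + u) - y) * 1 =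
      Real.pi * ((starRingEnd ℂ) (γ (0 + u)) * deriv γ (0 + u)) := by
    intro u
    simp only [mul_one, div_eq_mul_inv, integral_const_mul]
    rw [setIntegral_ball_inv_sub _ (hR _)]
    ring
  simp only [h1] at h0
  rw [intervalIntegral.integral_const_mul, ← contour_eq_shift hγ
    (f := fun x => (starRingEnd ℂ) (γ x)) hγ.perC.conj.per] at h0
  have h3 := Real.pi_ne_zero
  have h4 : (Real.pi : ℂ) ≠ 0 := by exact_mod_cast h3
  simp only [Complex.real_smul, mul_one] at h0
  have h5 := Complex.I_ne_zero
  field_simp at h0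
  linear_combination -h0

/-- The poles at γ(α+u) and γ(α) are separated by at least c|u|, so `inv_mul_inv_le` bounds the
product by |u| to the power -1/2 times integrable planar singularities. -/
theorem integrable_prod_cauchy_mul {R : ℝ} (hR : ∀ β, ‖γ β‖ < R) (α : ℝ) :
    Integrable (Function.uncurry fun (u : ℝ) (y : ℂ) =>
      deriv γ (α + u) / (γ (α + u) - y) * (γ α - y)⁻¹)
      ((volume.restrict (uIoc (-Real.pi) Real.pi)).prod (volume.restrict (Metric.ball 0 R))) := by
  have hc := hγ.contDiff.continuous
  have hc' := hγ.perC_deriv.smooth.continuous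
  obtain ⟨c, η, hc0, hη, hlow⟩ := exists_norm_lower_bound hγ α
  obtain ⟨M, hM0, hM⟩ := (reg_shift hγ.perC_deriv).exists_bound (mem_univ α)
  set k := indicator (Metric.ball (0 : ℂ) (R + R)) fun v => ‖v‖ ^ (-(3 / 2) : ℝ) with hk
  have hkm : Measurable k := measurable_indicator_norm_rpow (3 / 2) (R + R)
  have hki : Integrable k := integrable_indicator_norm_rpow (by norm_num) (R + R)
  have hw := (intervalIntegrable_abs_rpow (r := -(1 / 2)) (by norm_num) Real.pi).const_mul
    (M * (2 * c ^ (-(1 / 2) : ℝ)))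
  have i1 := (integrable_prod_comp_sub hkm hki hw (φ := fun u => γ (α + u)) (by fun_prop)).add
    (integrable_prod_comp_sub hkm hki hw (φ := fun _ => γ α) (by fun_prop))
  have i2 := i1.mono_measure (Measure.prod_mono le_rfl
    (Measure.restrict_le_self (s := Metric.ball (0 : ℂ) R)))
  refine i2.mono' (Measurable.aestronglyMeasurable (by fun_prop)) ?_
  have h3 : ∀ᵐ q ∂((volume.restrict (uIoc (-Real.pi) Real.pi)).prod
      (volume.restrict (Metric.ball (0 : ℂ) R))), q.2 ∈ Metric.ball (0 : ℂ) R :=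
    Measure.quasiMeasurePreserving_snd.ae (ae_restrict_mem measurableSet_ball)
  have h4 : ∀ᵐ q ∂((volume.restrict (uIoc (-Real.pi) Real.pi)).prod
      (volume.restrict (Metric.ball (0 : ℂ) R))), q.1 ∈ uIoc (-Real.pi) Real.pi ∧ q.1 ≠ 0 := by
    have h0 : ∀ᵐ u : ℝ ∂volume, u ≠ 0 := by simp [ae_iff]
    exact Measure.quasiMeasurePreserving_fst.ae
      ((ae_restrict_mem measurableSet_uIoc).and (ae_restrict_of_ae h0))
  filter_upwards [h3, h4] with q hq ⟨hu, hu0⟩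
  obtain ⟨u, y⟩ := q
  simp only at hq hu hu0
  have hu' := uIoc_subset_uIcc hu
  rw [mem_ball_zero_iff] at hq
  have m1 : γ (α + u) - y ∈ Metric.ball (0 : ℂ) (R + R) := by
    rw [mem_ball_zero_iff]
    linarith [norm_sub_le (γ (α + u)) y, hR (α + u)]
  have m2 : γ α - y ∈ Metric.ball (0 : ℂ) (R + R) := by
    rw [mem_ball_zero_iff]
    linarith [norm_sub_le (γ α) y, hR α]
  have hl : c * |u| ≤ ‖γ (α + u) - γ α‖ := by
    simpa using hlow 0 (by simpa using hη) u hu'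
  have hup : 0 < |u| := abs_pos.2 hu0
  simp only [Function.uncurry, Pi.add_apply, hk, indicator_of_mem m1, indicator_of_mem m2, norm_mul,
    norm_div, norm_inv]
  have hR0 : 0 ≤ M * (2 * c ^ (-(1 / 2) : ℝ)) * |u| ^ (-(1 / 2) : ℝ) *
      ‖γ (α + u) - y‖ ^ (-(3 / 2) : ℝ) + M * (2 * c ^ (-(1 / 2) : ℝ)) * |u| ^ (-(1 / 2) : ℝ) *
      ‖γ α - y‖ ^ (-(3 / 2) : ℝ) := by positivity
  by_cases z1 : γ (α + u) - y = 0
  · simpa [z1] using hR0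
  by_cases z2 : γ α - y = 0
  · simpa [z2] using hR0
  have hb := inv_mul_inv_le (norm_pos_iff.2 z1) (norm_pos_iff.2 z2) (mul_pos hc0 hup) (by
    refine hl.trans ?_
    rw [show γ (α + u) - γ α = (γ (α + u) - y) - (γ α - y) by ring]
    exact norm_sub_le _ _)
  rw [Real.mul_rpow hc0.le hup.le] at hb
  calc ‖deriv γ (α + u)‖ / ‖γ (α + u) - y‖ * ‖γ α - y‖⁻¹
      = ‖deriv γ (α + u)‖ * (‖γ (α + u) - y‖⁻¹ * ‖γ α - y‖⁻¹) := by ring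
    _ ≤ M * (2 * (c ^ (-(1 / 2) : ℝ) * |u| ^ (-(1 / 2) : ℝ)) *
        (‖γ (α + u) - y‖ ^ (-(3 / 2) : ℝ) + ‖γ α - y‖ ^ (-(3 / 2) : ℝ))) :=
      mul_le_mul (hM u hu' hu0) hb (by positivity) hM0
    _ = _ := by ring

/-- The conjugate of the gradient is the area integral of the Cauchy kernel 1/(γ(α) - y). As a
contour integral of ball integrals it involves a product of two Cauchy kernels, and these ball
integrals produce difference quotients of z̄, that is, A applied to z̄. -/
theorem gravityGradient_eq (α : ℝ) :
    gravityGradient (enclosedRegion γ) (γ α) = Real.pi / 2 * defectBar γ γ α := by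
  obtain ⟨R, hR⟩ := exists_norm_lt hγ
  have h0 := setIntegral_enclosedRegion hγ hR (g := fun y => (γ α - y)⁻¹) α
    (integrable_prod_cauchy_mul hγ hR α)
  have h1 : gravityGradient (enclosedRegion γ) (γ α) =
      (starRingEnd ℂ) (∫ y in enclosedRegion γ, (γ α - y)⁻¹) := by
    rw [gravityGradient, ← integral_conj]
    congr 1
    funext y
    rw [Complex.inv_def, map_mul, Complex.conj_conj, Complex.conj_ofReal,
      Complex.normSq_eq_norm_sq]
    push_cast
    rw [div_eq_mul_inv]
  have h2 : ∀ u ∈ increments, u ≠ 0 → ∫ y in Metric.ball (0 : ℂ) R,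
      deriv γ (α + u) / (γ (α + u) - y) * (γ α - y)⁻¹ =
      -Real.pi * (((starRingEnd ℂ) (γ (α + u)) - (starRingEnd ℂ) (γ α)) / (γ (α + u) - γ α) *
        deriv γ (α + u)) := by
    intro u hu hu0
    have h3 := hγ.sub_ne_zero α hu hu0
    -- Partial fractions in y separate the two poles; each resulting ball integral equals π times
    -- the conjugate of its pole.
    have h4 : ∫ y in Metric.ball (0 : ℂ) R, deriv γ (α + u) / (γ (α + u) - y) * (γ α - y)⁻¹ =
        ∫ y in Metric.ball (0 : ℂ) R, -(deriv γ (α + u) / (γ (α + u) - γ α)) *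
          ((γ (α + u) - y)⁻¹ - (γ α - y)⁻¹) := by
      refine integral_congr_ae (ae_restrict_of_ae ?_)
      have n1 : ∀ᵐ y : ℂ ∂volume, y ≠ γ (α + u) := by simp [ae_iff]
      have n2 : ∀ᵐ y : ℂ ∂volume, y ≠ γ α := by simp [ae_iff]
      filter_upwards [n1, n2] with y hy1 hy2
      have z1 : γ (α + u) - y ≠ 0 := sub_ne_zero.2 hy1.symm
      have z2 : γ α - y ≠ 0 := sub_ne_zero.2 hy2.symm
      field_simp
      ring
    rw [h4, integral_const_mul, integral_sub (integrableOn_inv_sub _ _) (integrableOn_inv_sub _ _),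
      setIntegral_ball_inv_sub _ (hR _), setIntegral_ball_inv_sub _ (hR _)]
    ring
  rw [h1, h0, integral_congr_increments h2, intervalIntegral.integral_const_mul, defectBar]
  rw [show (Real.pi / 2 : ℂ) = (starRingEnd ℂ) (Real.pi / 2) by
    rw [map_div₀, Complex.conj_ofReal, map_ofNat], ← map_mul, defect]
  congr 1
  have h4 : (Real.pi : ℂ) ≠ 0 := by exact_mod_cast Real.pi_ne_zero
  have h5 := Complex.I_ne_zero
  field_simp

theorem curve_mul_defect_conj (hA : volume (enclosedRegion γ) = ENNReal.ofReal Real.pi) (α : ℝ) :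
    γ α * defect γ (fun x => (starRingEnd ℂ) (γ x)) α =
      defect γ (fun x => γ x * (starRingEnd ℂ) (γ x)) α + 2 := by
  rw [defect_curve_mul hγ (hγ.perC.of_le (by norm_num)).conj, contour_conj hγ hA]
  have h4 : (Real.pi : ℂ) ≠ 0 := by exact_mod_cast Real.pi_ne_zero
  have h5 := Complex.I_ne_zero
  field_simp
  ring

end curve

/-! ### Joint regularity of the singular integrals -/

/-- `f t α` is of class `C^n` on `S × ℝ` and `2π`-periodic in `α`. -/
structure SmP (S : Set ℝ) (n : ℕ) (f : ℝ → ℝ → ℂ) : Prop where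
  smooth : Sm S n f
  per : ∀ t ∈ S, Function.Periodic (f t) (2 * Real.pi)

namespace SmP

variable {S : Set ℝ} {n m : ℕ} {f g : ℝ → ℝ → ℂ}

theorem of_le (hf : SmP S n f) (h : m ≤ n) : SmP S m f := ⟨hf.smooth.of_le h, hf.per⟩

theorem congr (hf : SmP S n f) (h : ∀ t ∈ S, ∀ α, g t α = f t α) : SmP S n g :=
  ⟨hf.smooth.congr h, fun t ht α => by rw [h t ht, h t ht, hf.per t ht]⟩

theorem add (hf : SmP S n f) (hg : SmP S n g) : SmP S n (f + g) :=
  ⟨hf.smooth.add hg.smooth, fun t ht => (hf.per t ht).add (hg.per t ht)⟩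

theorem sub (hf : SmP S n f) (hg : SmP S n g) : SmP S n (f - g) :=
  ⟨hf.smooth.sub hg.smooth, fun t ht => (hf.per t ht).sub (hg.per t ht)⟩

theorem mul (hf : SmP S n f) (hg : SmP S n g) : SmP S n (f * g) :=
  ⟨hf.smooth.mul hg.smooth, fun t ht => (hf.per t ht).mul (hg.per t ht)⟩

theorem const (c : ℂ) : SmP S n (fun _ _ => c) := ⟨Sm.const c, fun _ _ _ => rfl⟩

theorem div (hf : SmP S n f) (hg : SmP S n g) (h : ∀ t ∈ S, ∀ α, g t α ≠ 0) : SmP S n (f / g) :=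
  ⟨hf.smooth.div hg.smooth h, fun t ht => (hf.per t ht).div (hg.per t ht)⟩

theorem bar (hf : SmP S n f) : SmP S n (bar f) :=
  ⟨hf.smooth.bar, fun t ht α => congrArg (starRingEnd ℂ) (hf.per t ht α)⟩

theorem perC (hf : SmP S n f) {t : ℝ} (ht : t ∈ S) : PerC n (f t) :=
  ⟨hf.smooth.slice ht, hf.per t ht⟩

theorem dt (hS : IsOpen S) (hf : SmP S (n + 1) f) : SmP S n (dt f) := by
  refine ⟨hf.smooth.dt hS, fun t ht α => Filter.EventuallyEq.deriv_eq ?_⟩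
  filter_upwards [hS.mem_nhds ht] with s hs using hf.per s hs α

theorem da (hS : IsOpen S) (hf : SmP S (n + 1) f) : SmP S n (da f) :=
  ⟨hf.smooth.da hS, fun _ ht => (hf.perC ht).deriv.per⟩

end SmP

theorem dt_congr {S : Set ℝ} (hS : IsOpen S) {f g : ℝ → ℝ → ℂ}
    (h : ∀ s ∈ S, ∀ x, f s x = g s x) {t : ℝ} (ht : t ∈ S) (α : ℝ) : dt f t α = dt g t α := by
  refine Filter.EventuallyEq.deriv_eq ?_
  filter_upwards [hS.mem_nhds ht] with s hs using h s hs α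

theorem da_congr {f g : ℝ → ℝ → ℂ} {t : ℝ} (h : ∀ x, f t x = g t x) (α : ℝ) :
    da f t α = da g t α := by
  rw [da, da, funext h]

section joint

variable {S : Set ℝ} {n : ℕ} {f g w z : ℝ → ℝ → ℂ}

theorem Sm.comp_shift (hf : Sm S n f) :
    ContDiffOn ℝ n (fun q : (ℝ × ℝ) × ℝ => f q.1.1 (q.1.2 + q.2)) ((S ×ˢ univ) ×ˢ increments) :=
  ContDiffOn.comp (g := fun p : ℝ × ℝ => f p.1 p.2) hf
    (f := fun q : (ℝ × ℝ) × ℝ => (q.1.1, q.1.2 + q.2)) (by fun_prop)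
    fun _ hq => ⟨hq.1.1, mem_univ _⟩

theorem reg_shift_joint (hf : Sm S n f) :
    Reg (S ×ˢ (univ : Set ℝ)) n (fun p u => f p.1 (p.2 + u)) :=
  Reg.of_contDiffOn hf.comp_shift

theorem reg_quot_joint (hS : IsOpen S) (hz : Sm S (n + 1) z)
    (hγ : ∀ t ∈ S, IsCounterclockwiseParam (z t)) (hf : Sm S (n + 1) f) :
    Reg (S ×ˢ (univ : Set ℝ)) n
      (fun p u => (f p.1 (p.2 + u) - f p.1 p.2) / (z p.1 (p.2 + u) - z p.1 p.2)) := by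
  have hU : IsOpen (S ×ˢ (univ : Set ℝ)) := hS.prod isOpen_univ
  have a1 := Reg.div_increment hU (n := n) hf.comp_shift
  have a2 := Reg.increment_div hU (n := n) hz.comp_shift
    (fun p hp u hu hu0 => by simpa using (hγ p.1 hp.1).ne_of_mem_increments p.2 hu hu0)
    (fun p hp => by
      have h1 : DifferentiableAt ℝ (fun q : (ℝ × ℝ) × ℝ => z q.1.1 (q.1.2 + q.2)) (p, 0) :=
        ((hz.comp_shift.differentiableOn (by simp)).differentiableAt
          ((hU.prod isOpen_Ioo).mem_nhds ⟨hp, zero_mem_increments⟩))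
      have h2 : HasDerivAt (fun s : ℝ => (p, s)) ((0 : ℝ × ℝ), (1 : ℝ)) 0 :=
        (hasDerivAt_const 0 p).prodMk (hasDerivAt_id 0)
      have h3 := HasFDerivAt.comp_hasDerivAt (f := fun s : ℝ => (p, s)) 0 h1.hasFDerivAt h2
      rw [← h3.deriv]
      have h4 : deriv (fun s => z p.1 (p.2 + s)) 0 = deriv (z p.1) p.2 := by
        rw [deriv_comp_const_add, add_zero]
      exact h4.trans_ne ((hγ p.1 hp.1).deriv_ne_zero p.2))
  refine (a1.mul a2).congr fun p hp u hu hu0 => ?_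
  have b1 := (hγ p.1 hp.1).sub_ne_zero p.2 hu hu0
  have b2 : (u : ℂ) ≠ 0 := by exact_mod_cast hu0
  simp only [add_zero]
  field_simp

theorem Reg.sm_integral (hS : IsOpen S) {Ψ : ℝ × ℝ → ℝ → ℂ}
    (h : Reg (S ×ˢ (univ : Set ℝ)) n Ψ) :
    Sm S n (fun t α => ∫ u in (-Real.pi)..Real.pi, Ψ (t, α) u) :=
  h.contDiffOn_integral (hS.prod isOpen_univ)

/-- The operator `I - H` of the moving curve `z`. -/
def defectOp (z f : ℝ → ℝ → ℂ) : ℝ → ℝ → ℂ := fun t => defect (z t) (f t)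

/-- The bilinear singular integral `mixed` of the moving curve `z`. -/
def mixedOp (z f g : ℝ → ℝ → ℂ) : ℝ → ℝ → ℂ := fun t => mixed (z t) (f t) (g t)

/-- The singular integral with the kernel `(f(β) - f(α)) (g(β) - g(α)) / (z(β) - z(α))²`. -/
def mixedSq (z f g k : ℝ → ℝ → ℂ) : ℝ → ℝ → ℂ := fun t α =>
  ∫ u in (-Real.pi)..Real.pi, (f t (α + u) - f t α) / (z t (α + u) - z t α) *
    ((g t (α + u) - g t α) / (z t (α + u) - z t α)) * da k t (α + u)

variable (hS : IsOpen S) (hγ : ∀ t ∈ S, IsCounterclockwiseParam (z t))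
include hS hγ

theorem SmP.mixedOp (hz : SmP S (n + 1) z) (hf : SmP S (n + 1) f) (hg : SmP S (n + 1) g) :
    SmP S n (mixedOp z f g) := by
  refine ⟨?_, fun t ht α => ?_⟩
  · have h := ((reg_quot_joint hS hz.smooth hγ hf.smooth).mul
      (reg_shift_joint (hg.smooth.da hS))).sm_integral hS
    exact (Sm.const _).mul h
  · have e : ∀ u, α + 2 * Real.pi + u = α + u + 2 * Real.pi := fun u => by ring
    have hd : Function.Periodic (deriv (g t)) (2 * Real.pi) := (hg.perC ht).deriv.per
    simp only [EulerPoisson.mixedOp, mixed, e, hf.per t ht _, hz.per t ht _, hd _]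

theorem SmP.defectOp (hz : SmP S (n + 1) z) (hf : SmP S (n + 1) f) : SmP S n (defectOp z f) := by
  have h := (SmP.const (-1)).mul (SmP.mixedOp hS hγ hz hf hz)
  refine h.congr fun t ht α => ?_
  simp only [EulerPoisson.defectOp, Pi.mul_apply, EulerPoisson.mixedOp, mixed_curve_right]
  ring

theorem SmP.mixedSq {k : ℝ → ℝ → ℂ} (hz : SmP S (n + 1) z) (hf : SmP S (n + 1) f)
    (hg : SmP S (n + 1) g) (hk : SmP S (n + 1) k) : Sm S n (mixedSq z f g k) :=
  (((reg_quot_joint hS hz.smooth hγ hf.smooth).mul (reg_quot_joint hS hz.smooth hγ hg.smooth)).mul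
      (reg_shift_joint (hk.smooth.da hS))).sm_integral hS

theorem hasDerivAt_defectOp (hz : SmP S 2 z) (hf : SmP S 2 f) {t : ℝ} (ht : t ∈ S) (α : ℝ) :
    HasDerivAt (fun s => defectOp z f s α) (defectOp z (dt f) t α + mixedOp z (dt z) f t α) t := by
  have hsh : ∀ {f : ℝ → ℝ → ℂ}, Sm S 2 f → Sm S 2 (fun s u => f s (α + u)) := fun h =>
    ContDiffOn.comp (g := fun p : ℝ × ℝ => _) h (f := fun p : ℝ × ℝ => (p.1, α + p.2))
      (by fun_prop) fun p hp => ⟨hp.1, mem_univ _⟩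
  have hda : ∀ f : ℝ → ℝ → ℂ, da (fun s u => f s (α + u)) = fun s u => da f s (α + u) := fun f => by
    funext s u
    exact deriv_comp_const_add (f s) α u
  have h := hasDerivAt_integral_quot hS (hsh hz.smooth) (hsh hf.smooth)
    (fun s hs u hu hu0 => by simpa using (hγ s hs).ne_of_mem_increments α hu hu0)
    (fun s hs => by rw [hda]; exact (hγ s hs).deriv_ne_zero _)
    (fun s hs => (hz.perC hs).sub_two_pi α) (fun s hs => (hf.perC hs).sub_two_pi α) ht
  rw [hda, hda] at h
  have h' := h.const_mul (-(1 / (Real.pi * Complex.I)) : ℂ)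
  simp only [add_zero] at h'
  refine h'.congr_deriv ?_
  simp only [EulerPoisson.defectOp, EulerPoisson.mixedOp, defect, mixed, dt, da, add_zero]
  ring

theorem dt_defectOp (hz : SmP S 2 z) (hf : SmP S 2 f) {t : ℝ} (ht : t ∈ S) (α : ℝ) :
    dt (defectOp z f) t α = defectOp z (dt f) t α + mixedOp z (dt z) f t α :=
  (hasDerivAt_defectOp hS hγ hz hf ht α).deriv

/-- No integration by parts is made here: differentiating the denominator leaves the squared kernel,
which for w = z_t and f = ε is the source of J₂. -/
theorem dt_mixedOp (hz : SmP S 2 z) (hw : SmP S 2 w) (hf : SmP S 2 f) {t : ℝ} (ht : t ∈ S)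
    (α : ℝ) : dt (mixedOp z w f) t α = mixedOp z (dt w) f t α + mixedOp z w (dt f) t α -
      1 / (Real.pi * Complex.I) * mixedSq z w (dt z) f t α := by
  have hsl : ∀ {m : ℕ} {Ψ : ℝ × ℝ → ℝ → ℂ}, Reg (S ×ˢ (univ : Set ℝ)) m Ψ →
      Reg S m (fun s => Ψ (s, α)) := by
    rintro m Ψ ⟨Φ, h1, h2⟩
    exact ⟨fun q => Φ ((q.1, α), q.2), h1.comp (by fun_prop) fun q hq => ⟨⟨hq.1, mem_univ _⟩, hq.2⟩,
      fun s hs u hu hu0 => h2 (s, α) ⟨hs, mem_univ _⟩ u hu hu0⟩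
  have hz1 := hz.of_le (m := 1) (by norm_num)
  have hw1 := hw.of_le (m := 1) (by norm_num)
  have hdz : SmP S 1 (dt z) := hz.dt hS
  have hdw : SmP S 1 (dt w) := hw.dt hS
  have hdf : SmP S 1 (dt f) := hf.dt hS
  have hfa : Sm S 1 (da f) := hf.smooth.da hS
  have R := hsl ((reg_quot_joint (n := 1) hS hz.smooth hγ hw.smooth).mul (reg_shift_joint hfa))
  have R1 := hsl ((reg_quot_joint (n := 0) hS hz1.smooth hγ hdw.smooth).mul
    (reg_shift_joint (hfa.of_le (by norm_num))))
  have R2 := hsl ((reg_quot_joint (n := 0) hS hz1.smooth hγ hw1.smooth).mul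
    (reg_shift_joint (hdf.smooth.da hS)))
  have R3 := hsl (((reg_quot_joint (n := 0) hS hz1.smooth hγ hw1.smooth).mul
    (reg_quot_joint (n := 0) hS hz1.smooth hγ hdz.smooth)).mul
    (reg_shift_joint (hfa.of_le (by norm_num))))
  have h := (R.hasDerivAt_integral hS ht).const_mul (1 / (Real.pi * Complex.I) : ℂ)
  refine h.deriv.trans ?_
  simp only [EulerPoisson.mixedOp, mixed, EulerPoisson.mixedSq]
  rw [← mul_add, ← mul_sub]
  congr 1
  have i1 := R1.intervalIntegrable ht
  have i2 := R2.intervalIntegrable ht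
  have i3 := R3.intervalIntegrable ht
  refine Eq.trans ?_ ((intervalIntegral.integral_sub (i1.add i2) i3).trans
    (congrArg (· - _) (intervalIntegral.integral_add i1 i2)))
  refine integral_congr_increments fun u hu hu0 => ?_
  have b1 := (hγ t ht).sub_ne_zero α hu hu0
  have c1 := (hw.smooth.hasDerivAt_dt hS (by norm_num) ht (α + u)).sub
    (hw.smooth.hasDerivAt_dt hS (by norm_num) ht α)
  have c2 := (hz.smooth.hasDerivAt_dt hS (by norm_num) ht (α + u)).sub
    (hz.smooth.hasDerivAt_dt hS (by norm_num) ht α)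
  have c3 := hfa.hasDerivAt_dt hS le_rfl ht (α + u)
  have c4 := ((c1.div c2 b1).mul c3).deriv
  rw [hf.smooth.dt_da hS ht (α + u)] at c4
  refine c4.trans ?_
  simp only [Pi.sub_apply, Pi.div_apply]
  field_simp
  ring

end joint

/-! ### The equation for `δ` -/

section calculus

variable {S : Set ℝ} (hS : IsOpen S) {f g : ℝ → ℝ → ℂ} (hf : Sm S 1 f) (hg : Sm S 1 g) {t : ℝ}
  (ht : t ∈ S) (α : ℝ)
include hS hf ht

theorem dt_bar : dt (bar f) t α = (starRingEnd ℂ) (dt f t α) :=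
  deriv_conj (hf.hasDerivAt_dt hS le_rfl ht α).differentiableAt

theorem dt_const_mul (c : ℂ) : dt (fun s x => c * f s x) t α = c * dt f t α :=
  ((hf.hasDerivAt_dt hS le_rfl ht α).const_mul c).deriv

include hg

theorem dt_add : dt (f + g) t α = dt f t α + dt g t α :=
  ((hf.hasDerivAt_dt hS le_rfl ht α).add (hg.hasDerivAt_dt hS le_rfl ht α)).deriv

theorem dt_sub : dt (f - g) t α = dt f t α - dt g t α :=
  ((hf.hasDerivAt_dt hS le_rfl ht α).sub (hg.hasDerivAt_dt hS le_rfl ht α)).deriv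

theorem dt_mul : dt (f * g) t α = dt f t α * g t α + f t α * dt g t α :=
  ((hf.hasDerivAt_dt hS le_rfl ht α).mul (hg.hasDerivAt_dt hS le_rfl ht α)).deriv

end calculus

theorem eps_eq_fun (z : ℝ → ℝ → ℂ) : eps z = z * bar z - fun _ _ => 1 := by
  funext t α
  exact eps_eq z t α

theorem SmP.eps {S : Set ℝ} {n : ℕ} {z : ℝ → ℝ → ℂ} (hz : SmP S n z) : SmP S n (eps z) := by
  rw [eps_eq_fun]
  exact (hz.mul hz.bar).sub (SmP.const 1)

/-- A solution of class `C³` with unit mean radius whose domain contains the origin. -/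
structure IsRegularSolution (S : Set ℝ) (z : ℝ → ℝ → ℂ) (a : ℝ → ℝ → ℝ) : Prop
    extends IsSolution S z a where
  isOpen : IsOpen S
  smooth : Sm S 3 z
  area : ∀ t ∈ S, volume (enclosedRegion (z t)) = ENNReal.ofReal Real.pi
  origin : ∀ t ∈ S, (0 : ℂ) ∈ enclosedRegion (z t)

namespace IsRegularSolution

variable {S : Set ℝ} {z : ℝ → ℝ → ℂ} {a : ℝ → ℝ → ℝ} (h : IsRegularSolution S z a)
include h

theorem smP : SmP S 3 z := ⟨h.smooth, fun t ht => (h.curve t ht).periodic⟩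

theorem isSmoothParam {t : ℝ} (ht : t ∈ S) : IsSmoothParam (z t) :=
  ⟨h.curve t ht, h.smooth.slice ht⟩

theorem ne_zero {t : ℝ} (ht : t ∈ S) (x : ℝ) : z t x ≠ 0 := fun h0 =>
  (h.origin t ht).1 ⟨x, h0⟩

theorem smP_dt : SmP S 2 (dt z) := h.smP.dt h.isOpen

theorem smP_dt_dt : SmP S 1 (dt (dt z)) := h.smP_dt.dt h.isOpen

theorem smP_eps : SmP S 3 (eps z) := h.smP.eps

theorem defect_conj_dt {t : ℝ} (ht : t ∈ S) (x : ℝ) :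
    defect (z t) (fun y => (starRingEnd ℂ) (dt z t y)) x = 0 := by
  have h1 := h.holomorphic t ht x
  rw [H_eq (h.isSmoothParam ht) (f := bar (dt z)) ((h.smP_dt.bar.perC ht).of_le (by norm_num))] at h1
  exact sub_eq_self.1 h1

theorem dt_eps {t : ℝ} (ht : t ∈ S) (α : ℝ) :
    dt (eps z) t α = dt z t α * (starRingEnd ℂ) (z t α) +
      z t α * (starRingEnd ℂ) (dt z t α) := by
  have hz : Sm S 1 z := h.smooth.of_le (by norm_num)
  rw [eps_eq_fun, dt_sub h.isOpen (hz.mul hz.bar) (Sm.const 1) ht,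
    dt_mul h.isOpen hz hz.bar ht, dt_bar h.isOpen hz ht]
  simp [dt, bar]

theorem dt_dt_eps {t : ℝ} (ht : t ∈ S) (α : ℝ) :
    dt (dt (eps z)) t α = dt (dt z) t α * (starRingEnd ℂ) (z t α) +
      2 * (dt z t α * (starRingEnd ℂ) (dt z t α)) +
      z t α * (starRingEnd ℂ) (dt (dt z) t α) := by
  have hz : Sm S 1 z := h.smooth.of_le (by norm_num)
  have hw : Sm S 1 (dt z) := h.smP_dt.smooth.of_le (by norm_num)
  rw [dt_congr h.isOpen (g := dt z * bar z + z * bar (dt z)) (fun s hs x => h.dt_eps hs x) ht,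
    dt_add h.isOpen (hw.mul hz.bar) (hz.mul hw.bar) ht, dt_mul h.isOpen hw hz.bar ht,
    dt_mul h.isOpen hz hw.bar ht, dt_bar h.isOpen hz ht, dt_bar h.isOpen hw ht]
  simp only [bar]
  ring

theorem da_eps {t : ℝ} (ht : t ∈ S) (α : ℝ) :
    da (eps z) t α = da z t α * (starRingEnd ℂ) (z t α) +
      z t α * (starRingEnd ℂ) (da z t α) := by
  have hz := (h.smooth.hasDerivAt_da h.isOpen (by norm_num) ht α)
  have hb := (h.smP.bar.smooth.hasDerivAt_da h.isOpen (by norm_num) ht α)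
  have h1 := ((hz.mul hb).sub_const (1 : ℂ)).deriv
  rw [da_bar (h.isSmoothParam ht)] at h1
  rw [eps_eq_fun]
  exact h1

theorem sm_defectOp {n : ℕ} (hz : SmP S (n + 1) z) {f : ℝ → ℝ → ℂ} (hf : SmP S (n + 1) f) :
    SmP S n (defectOp z f) := SmP.defectOp h.isOpen h.curve hz hf

theorem sm_mixedOp {n : ℕ} (hz : SmP S (n + 1) z) {f g : ℝ → ℝ → ℂ} (hf : SmP S (n + 1) f)
    (hg : SmP S (n + 1) g) : SmP S n (mixedOp z f g) :=
  SmP.mixedOp h.isOpen h.curve hz hf hg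

theorem delta_eq_defectOp {t : ℝ} (ht : t ∈ S) (α : ℝ) :
    delta z t α = defectOp z (eps z) t α := delta_eq (h.isSmoothParam ht) α

theorem smP_delta {n : ℕ} (hz : SmP S (n + 1) z) : SmP S n (delta z) :=
  (h.sm_defectOp hz hz.eps).congr fun _ ht α => h.delta_eq_defectOp ht α

theorem smP_E {n : ℕ} (hz : SmP S (n + 1) z) {f : ℝ → ℝ → ℂ} (hf : SmP S (n + 1) f) :
    SmP S n (E z f) := by
  have hz' := hz.of_le (Nat.le_succ n)
  have hf' := hf.of_le (Nat.le_succ n)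
  have hL : SmP S n (fun t α => ∫ u in (-Real.pi)..Real.pi,
      f t (α + u) * (deriv (z t) (α + u) / z t (α + u))) := by
    have hq : SmP S n (f * (da z / z)) :=
      hf'.mul ((hz.da h.isOpen).div hz' fun t ht => h.ne_zero ht)
    refine ⟨(reg_shift_joint hq.smooth).sm_integral h.isOpen, fun t ht α => ?_⟩
    have e : ∀ u, α + 2 * Real.pi + u = α + u + 2 * Real.pi := fun u => by ring
    have hp := hq.per t ht
    simp only [e]
    exact intervalIntegral.integral_congr fun u _ => hp (α + u)
  refine (((((SmP.const 2).mul hf').sub (h.sm_defectOp hz hf)).sub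
    (h.sm_defectOp hz hf.bar).bar).sub
    ((SmP.const (1 / (Real.pi * Complex.I))).mul hL)).add
      (hz'.mul (h.sm_mixedOp hz hz.eps hf)) |>.congr fun t ht α => ?_
  rw [E_eq (h.isSmoothParam ht) (h.ne_zero ht) ((hf.perC ht).of_le (by omega))]
  rfl

/-- The rule ∂_t A f = A f_t + M(z_t, f) is applied twice. The mixed term arises once from each
differentiation, whence the factor 2, and J₂ comes from differentiating the kernel of M. -/
theorem dt_dt_delta {t : ℝ} (ht : t ∈ S) (α : ℝ) :
    dt (dt (delta z)) t α = defect (z t) (dt (dt (eps z)) t) α +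
      2 * mixed (z t) (dt z t) (dt (eps z) t) α + mixed (z t) (dt (dt z) t) (eps z t) α -
      1 / (Real.pi * Complex.I) * J2 z t α := by
  have hS := h.isOpen
  have hz2 := h.smP.of_le (m := 2) (by norm_num)
  have he2 := h.smP_eps.of_le (m := 2) (by norm_num)
  have het : SmP S 2 (dt (eps z)) := h.smP_eps.dt hS
  have e1 : ∀ s ∈ S, ∀ x, dt (delta z) s x =
      (defectOp z (dt (eps z)) + mixedOp z (dt z) (eps z)) s x := fun s hs x => by
    rw [dt_congr hS (fun r hr y => h.delta_eq_defectOp hr y) hs,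
      dt_defectOp hS h.curve hz2 he2 hs]
    rfl
  rw [dt_congr hS e1 ht, dt_add hS (h.sm_defectOp hz2 het).smooth
    (h.sm_mixedOp hz2 h.smP_dt he2).smooth ht, dt_defectOp hS h.curve hz2 het ht,
    dt_mixedOp hS h.curve hz2 h.smP_dt he2 ht,
    (J2_eq (h.isSmoothParam ht) (h.smP_dt.perC ht) α).2]
  have e2 : mixedSq z (dt z) (dt z) (eps z) t α = ∫ u in (-Real.pi)..Real.pi,
      ((dt z t (α + u) - dt z t α) / (z t (α + u) - z t α)) ^ 2 * da (eps z) t (α + u) := by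
    simp only [mixedSq, pow_two]
  rw [e2]
  simp only [defectOp, mixedOp]
  ring

theorem da_delta {t : ℝ} (ht : t ∈ S) (α : ℝ) : da (delta z) t α =
    da z t α * defect (z t) (fun x => deriv (eps z t) x / deriv (z t) x) α := by
  rw [da_congr (g := defectOp z (eps z)) (fun x => h.delta_eq_defectOp ht x)]
  exact deriv_defect (h.isSmoothParam ht) ((h.smP_eps.perC ht).of_le (by norm_num)) α

/-- The time derivative of `(I - H) (z conj(z_t)) = 0`. -/
theorem defect_dt_curve_mul_conj {t : ℝ} (ht : t ∈ S) (α : ℝ) :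
    defect (z t) (fun x => dt z t x * (starRingEnd ℂ) (dt z t x) +
      z t x * (starRingEnd ℂ) (dt (dt z) t x)) α =
    -mixed (z t) (dt z t) (fun x => z t x * (starRingEnd ℂ) (dt z t x)) α := by
  have hS := h.isOpen
  have hz2 := h.smP.of_le (m := 2) (by norm_num)
  have hz1 := h.smP.of_le (m := 1) (by norm_num)
  have hw1 := h.smP_dt.of_le (m := 1) (by norm_num)
  have hF : SmP S 2 (z * bar (dt z)) := hz2.mul h.smP_dt.bar
  have e1 := dt_defectOp hS h.curve hz2 hF ht α
  -- Both z and z̄_t lie in the kernel of A at every time of the open set S, hence so does their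
  -- product, and the time derivative vanishes.
  have e2 : dt (defectOp z (z * bar (dt z))) t α = 0 := by
    rw [dt_congr hS (g := fun _ _ => 0) (fun s hs x => ?_) ht]
    · simp [dt]
    · exact defect_curve_mul_eq_zero (h.isSmoothParam hs)
        ((h.smP_dt.bar.perC hs).of_le (by norm_num)) (h.defect_conj_dt hs) x
  have e3 : dt (z * bar (dt z)) t = fun x => dt z t x * (starRingEnd ℂ) (dt z t x) +
      z t x * (starRingEnd ℂ) (dt (dt z) t x) := by
    funext x
    rw [dt_mul hS hz1.smooth hw1.bar.smooth ht, dt_bar hS hw1.smooth ht]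
    rfl
  rw [e2, defectOp, e3] at e1
  exact eq_neg_of_add_eq_zero_left e1.symm

theorem momentum_eq {t : ℝ} (ht : t ∈ S) (x : ℝ) :
    dt (dt z) t x + Complex.I * a t x * da z t x =
      -(Real.pi / 2) * defectBar (z t) (z t) x := by
  rw [h.momentum t ht, gravityGradient_eq (h.isSmoothParam ht)]
  ring

theorem defect_curve_mul_conj {t : ℝ} (ht : t ∈ S) (x : ℝ) :
    z t x * (starRingEnd ℂ) (defectBar (z t) (z t) x) = defect (z t) (eps z t) x + 2 := by
  rw [defectBar, Complex.conj_conj, curve_mul_defect_conj (h.isSmoothParam ht) (h.area t ht)]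
  have hz1 : PerC 1 (z t) := (h.smP.perC ht).of_le (by norm_num)
  rw [defect_congr (eps_eq z t), defect_sub (h.isSmoothParam ht) (hz1.mul hz1.conj) (PerC.const 1),
    defect_const, sub_zero]

theorem conj_curve_mul {t : ℝ} (ht : t ∈ S) (x : ℝ) :
    (starRingEnd ℂ) (z t x) * defectBar (z t) (z t) x = defectBar (z t) (eps z t) x + 2 := by
  have h1 := congrArg (starRingEnd ℂ) (h.defect_curve_mul_conj ht x)
  rw [map_mul, Complex.conj_conj, map_add, map_ofNat] at h1
  rw [h1, defectBar, defect_congr (f := fun x => (starRingEnd ℂ) (eps z t x)) (g := eps z t)]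
  intro y
  rw [eps, Complex.conj_ofReal]

/-- Let G = -(π/2) Āz. The momentum equation turns M(z_tt, ε) + ia ∂_α δ into M(G, ε) + A(iaε_α).
The conjugate momentum equation gives ε_tt + iaε_α = z̄G - zḠ + 2(|z_t|² + z z̄_tt). Here z̄G and zḠ
are affine in Āε and Aε by the area normalization, and the last bracket is absorbed by the
derivative of A(z z̄_t) = 0, which also cancels half of 2M(z_t, ε_t). The rest is `key_identity`. -/
theorem delta_equation {t : ℝ} (ht : t ∈ S) (α : ℝ) :
    dt (dt (delta z)) t α + Complex.I * a t α * da (delta z) t α - Real.pi * delta z t α =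
      Real.pi / 2 * mixed (z t) (E z z t) (eps z t) α +
      Real.pi / 2 * defect (z t) (E z (eps z) t) α +
      2 * mixed (z t) (dt z t) (fun x => dt z t x * (starRingEnd ℂ) (z t x)) α -
      1 / (Real.pi * Complex.I) * J2 z t α := by
  have hγ := h.isSmoothParam ht
  have hz1 : PerC 1 (z t) := hγ.perC.of_le (by norm_num)
  have he1 : PerC 1 (eps z t) := (perC_eps hγ).of_le (by norm_num)
  have he2 : PerC 2 (eps z t) := (perC_eps hγ).of_le (by norm_num)
  have hw1 : PerC 1 (dt z t) := (h.smP_dt.perC ht).of_le (by norm_num)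
  have hv : PerC 1 (dt (dt z) t) := h.smP_dt_dt.perC ht
  have hh : PerC 1 (fun x => deriv (eps z t) x / deriv (z t) x) :=
    perC_deriv_div hγ (by norm_num) he2
  have hB : PerC 1 (defectBar (z t) (z t)) :=
    PerC.defectBar hγ (by norm_num) (hγ.perC.of_le (by norm_num))
  have hG : PerC 1 (fun x => -(Real.pi / 2 : ℂ) * defectBar (z t) (z t) x) :=
    (PerC.const _).mul hB
  have hAe : PerC 1 (defect (z t) (eps z t)) := PerC.defect hγ (by norm_num) he2
  have hBe : PerC 1 (defectBar (z t) (eps z t)) := PerC.defectBar hγ (by norm_num) he2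
  have hett : PerC 1 (dt (dt (eps z)) t) :=
    ((h.smP_eps.dt h.isOpen : SmP S 2 _).dt h.isOpen : SmP S 1 _).perC ht
  have hP : PerC 1 (fun x => dt z t x * (starRingEnd ℂ) (dt z t x) +
      z t x * (starRingEnd ℂ) (dt (dt z) t x)) := (hw1.mul hw1.conj).add (hz1.mul hv.conj)
  have m1 := mixed_eq hγ hv he2 α
  have m2 := mixed_eq hγ hG he2 α
  rw [mixed_const_mul] at m2
  have m3 : mixed (z t) (dt z t) (dt (eps z) t) α =
      mixed (z t) (dt z t) (fun x => dt z t x * (starRingEnd ℂ) (z t x)) α +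
      mixed (z t) (dt z t) (fun x => z t x * (starRingEnd ℂ) (dt z t x)) α := by
    rw [← mixed_add_right hγ hw1 (hw1.mul hz1.conj) (hz1.mul hw1.conj)]
    congr 1
    funext x
    exact h.dt_eps ht x
  -- These three densities combine to ε_tt + iaε_α. They are kept apart because a is not assumed
  -- differentiable, so A is applied only to densities known to be C¹.
  have m4 : defect (z t) (dt (dt (eps z)) t) α +
      defect (z t) (fun x => -(Real.pi / 2) * defectBar (z t) (z t) x *
        (deriv (eps z t) x / deriv (z t) x)) α -
      defect (z t) (fun x => dt (dt z) t x * (deriv (eps z t) x / deriv (z t) x)) α =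
      -(Real.pi / 2) * defect (z t) (defectBar (z t) (eps z t)) α +
      Real.pi * defect (z t) (eps z t) α + 2 * defect (z t) (fun x => dt z t x *
        (starRingEnd ℂ) (dt z t x) + z t x * (starRingEnd ℂ) (dt (dt z) t x)) α := by
    rw [← defect_add hγ hett (hG.mul hh), ← defect_sub hγ (hett.add (hG.mul hh)) (hv.mul hh)]
    have e1 : ∀ x, dt (dt (eps z)) t x + -(Real.pi / 2) * defectBar (z t) (z t) x *
        (deriv (eps z t) x / deriv (z t) x) -
        dt (dt z) t x * (deriv (eps z t) x / deriv (z t) x) =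
        (-(Real.pi / 2) * (defectBar (z t) (eps z t) x + 2) +
          Real.pi / 2 * (defect (z t) (eps z t) x + 2)) + 2 * (dt z t x *
        (starRingEnd ℂ) (dt z t x) + z t x * (starRingEnd ℂ) (dt (dt z) t x)) := by
      intro x
      have g1 := h.momentum_eq ht x
      have g2 := congrArg (starRingEnd ℂ) g1
      have g3 := h.da_eps ht x
      have g4 := h.dt_dt_eps ht x
      have g5 : deriv (z t) x ≠ 0 := hγ.deriv_ne_zero x
      simp only [map_add, map_mul, Complex.conj_I, Complex.conj_ofReal, map_neg, map_div₀,
        map_ofNat] at g2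
      rw [← h.conj_curve_mul ht x, ← h.defect_curve_mul_conj ht x]
      -- The quotient by z_α coming from M is undone, so that ia z_α in the momentum equation
      -- becomes iaε_α.
      have g6 : Complex.I * a t x * (da z t x * (deriv (eps z t) x / deriv (z t) x)) =
          Complex.I * a t x * da (eps z) t x := by
        rw [da, da]
        field_simp
      rw [g4]
      rw [g3] at g6
      linear_combination (-(deriv (eps z t) x / deriv (z t) x) + (starRingEnd ℂ) (z t x)) * g1 +
        g6 - z t x * g2
    rw [defect_congr e1, defect_add hγ (((PerC.const _).mul (hBe.add (PerC.const 2))).add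
      ((PerC.const _).mul (hAe.add (PerC.const 2)))) ((PerC.const 2).mul hP),
      defect_add hγ ((PerC.const _).mul (hBe.add (PerC.const 2)))
      ((PerC.const _).mul (hAe.add (PerC.const 2))), defect_const_mul, defect_const_mul,
      defect_const_mul, defect_add hγ hBe (PerC.const 2), defect_add hγ hAe (PerC.const 2),
      defect_const, defect_defect hγ he1 hAe]
    ring
  have m5 := key_identity hγ (h.ne_zero ht) α
  rw [h.dt_dt_delta ht, h.da_delta ht, delta_eq hγ, m3]
  rw [h.defect_dt_curve_mul_conj ht] at m4
  have m6 := h.momentum_eq ht α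
  linear_combination m1 - m2 + m4 + (Real.pi / 2 : ℂ) * m5 +
    defect (z t) (fun x => deriv (eps z t) x / deriv (z t) x) α * m6

theorem comm_Hsum_eq {t : ℝ} (ht : t ∈ S) (α : ℝ) :
    comm (dt z) (Hsum z) (da (dt z * bar z)) t α =
      -mixed (z t) (dt z t) (fun x => dt z t x * (starRingEnd ℂ) (z t x)) α :=
  comm_Hsum (h.isSmoothParam ht) (h.smP_dt.perC ht) (h.defect_conj_dt ht) α

theorem N1_eq {t : ℝ} (ht : t ∈ S) (α : ℝ) :
    N1 z t α = Real.pi / 2 * mixed (z t) (E z z t) (eps z t) α +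
      Real.pi / 2 * defect (z t) (E z (eps z) t) α +
      2 * mixed (z t) (dt z t) (fun x => dt z t x * (starRingEnd ℂ) (z t x)) α -
      1 / (Real.pi * Complex.I) * J2 z t α := by
  have hγ := h.isSmoothParam ht
  have hE1 : PerC 1 (E z z t) := ((h.smP_E h.smP h.smP).perC ht).of_le (by norm_num)
  have hE2 : PerC 1 (E z (eps z) t) := ((h.smP_E h.smP h.smP_eps).perC ht).of_le (by norm_num)
  rw [N1, comm_H_div hγ hE1 ((perC_eps hγ).of_le (by norm_num)), h.comm_Hsum_eq ht]
  change _ + Real.pi / 2 * (E z (eps z) t α - H z (E z (eps z)) t α) - _ - _ = _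
  rw [H_eq hγ hE2]
  ring

end IsRegularSolution

/-! ### The equation for `∂_t δ` -/

namespace IsRegularSolution

variable {S : Set ℝ} {z : ℝ → ℝ → ℂ} {a : ℝ → ℝ → ℝ} (h : IsRegularSolution S z a)
include h

/-- The momentum equation can be solved for a because z_α does not vanish. Since a is real, it is
the real part of a quotient of C¹ functions. -/
theorem contDiffOn_coefficient (hz : SmP S 4 z) :
    ContDiffOn ℝ 1 (fun p : ℝ × ℝ => a p.1 p.2) (S ×ˢ univ) := by
  have hS := h.isOpen
  have hza : SmP S 3 (da z) := hz.da hS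
  have hztt : SmP S 1 (dt (dt z)) := h.smP_dt_dt
  have hB : SmP S 1 (bar (defectOp z (bar z))) :=
    ((h.sm_defectOp (n := 3) hz hz.bar).bar).of_le (by norm_num)
  have hq : SmP S 1 (((fun _ _ => -(Real.pi / 2 : ℂ)) * bar (defectOp z (bar z)) - dt (dt z)) /
      ((fun _ _ => Complex.I) * da z)) :=
    (((SmP.const _).mul hB).sub hztt).div ((SmP.const _).mul (hza.of_le (by norm_num)))
      fun t ht x => mul_ne_zero Complex.I_ne_zero ((h.isSmoothParam ht).deriv_ne_zero x)
  refine (Complex.reCLM.contDiff.comp_contDiffOn hq.smooth).congr fun p hp => ?_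
  have h1 := h.momentum_eq hp.1 p.2
  have h2 : da z p.1 p.2 ≠ 0 := (h.isSmoothParam hp.1).deriv_ne_zero p.2
  have h3 : (a p.1 p.2 : ℂ) = (-(Real.pi / 2 : ℂ) * defectBar (z p.1) (z p.1) p.2 -
      dt (dt z) p.1 p.2) / (Complex.I * da z p.1 p.2) := by
    rw [← h1]
    have := Complex.I_ne_zero
    field_simp
    ring
  have h4 := congrArg Complex.re h3
  rw [Complex.ofReal_re] at h4
  exact h4

theorem J1_eq_mixedOp {t : ℝ} (ht : t ∈ S) (α : ℝ) :
    J1 z t α = Real.pi * Complex.I * mixedOp z (dt z) (dt z * bar z) t α := by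
  have h1 := (J1_eq (h.isSmoothParam ht) (h.ne_zero ht) (h.smP_dt.perC ht)
    (h.defect_conj_dt ht) α).2
  have h2 := pi_mul_I_ne_zero
  have h3 : mixedOp z (dt z) (dt z * bar z) t α = 1 / (Real.pi * Complex.I) * J1 z t α := h1.symm
  rw [h3]
  field_simp

theorem J2_eq_mixedSq {t : ℝ} (ht : t ∈ S) (α : ℝ) :
    J2 z t α = mixedSq z (dt z) (dt z) (eps z) t α := by
  rw [(J2_eq (h.isSmoothParam ht) (h.smP_dt.perC ht) α).2]
  simp only [mixedSq, pow_two]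

theorem sm_J1 : Sm S 1 (J1 z) := by
  have h1 := h.sm_mixedOp (n := 1) (h.smP.of_le (by norm_num)) h.smP_dt
    (h.smP_dt.mul (h.smP.bar.of_le (by norm_num)))
  exact ((Sm.const (Real.pi * Complex.I)).mul h1.smooth).congr fun t ht α => h.J1_eq_mixedOp ht α

theorem sm_J2 : Sm S 1 (J2 z) :=
  (SmP.mixedSq (n := 1) h.isOpen h.curve (h.smP.of_le (by norm_num)) h.smP_dt h.smP_dt
    (h.smP_eps.of_le (by norm_num))).congr fun t ht α => h.J2_eq_mixedSq ht α

/-- Here M(f, ε) is first written as f Aq - A(fq) with q = ε_α/z_α, and ∂_t is commuted with A in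
each term. Differentiating in this form, rather than under the integral, produces exactly the four
commutators of N₂. -/
theorem dt_mixedOp_eps (hz : SmP S 4 z) {f : ℝ → ℝ → ℂ} (hf : SmP S 2 f) {t : ℝ} (ht : t ∈ S)
    (α : ℝ) : dt (mixedOp z f (eps z)) t α =
      -(comm (dt f) (H z) (da (eps z) / da z) t α
        + comm f (H z) (dt (da (eps z) / da z)) t α
        + f t α * comm (dt z) (H z) (da (da (eps z) / da z) / da z) t α
        - comm (dt z) (H z) (da (f * (da (eps z) / da z)) / da z) t α) := by
  have hS := h.isOpen
  have hγ := h.isSmoothParam ht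
  have hz2 := hz.of_le (m := 2) (by norm_num)
  have hq2 : SmP S 2 (da (eps z) / da z) :=
    (((hz.eps.da hS : SmP S 3 _).div (hz.da hS) fun t ht x =>
      (h.isSmoothParam ht).deriv_ne_zero x)).of_le (by norm_num)
  set q := da (eps z) / da z with hq
  have hq1 := hq2.of_le (m := 1) (by norm_num)
  have hf1 := hf.of_le (m := 1) (by norm_num)
  have hw1 := h.smP_dt.of_le (m := 1) (by norm_num)
  have hft : SmP S 1 (dt f) := hf.dt hS
  have hqt : SmP S 1 (dt q) := hq2.dt hS
  have e1 : ∀ s ∈ S, ∀ x, mixedOp z f (eps z) s x =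
      (f * defectOp z q - defectOp z (f * q)) s x := fun s hs x =>
    mixed_eq (h.isSmoothParam hs) (hf1.perC hs) ((h.smP_eps.perC hs).of_le (by norm_num)) x
  have hAq : SmP S 1 (defectOp z q) := h.sm_defectOp hz2 hq2
  have hAfq : SmP S 1 (defectOp z (f * q)) := h.sm_defectOp hz2 (hf.mul hq2)
  rw [dt_congr hS e1 ht, dt_sub hS (hf1.mul hAq).smooth hAfq.smooth ht,
    dt_mul hS hf1.smooth hAq.smooth ht, dt_defectOp hS h.curve hz2 hq2 ht,
    dt_defectOp hS h.curve hz2 (hf.mul hq2) ht, comm_H hγ (hft.perC ht) (hq1.perC ht),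
    comm_H hγ (hf1.perC ht) (hqt.perC ht), comm_H_div hγ (hw1.perC ht) (hq2.perC ht),
    comm_H_div hγ (hw1.perC ht) ((hf.mul hq2).perC ht)]
  have e2 : defectOp z (dt (f * q)) t α = defect (z t) (fun x => dt f t x * q t x) α +
      defect (z t) (fun x => f t x * dt q t x) α := by
    rw [← defect_add hγ ((hft.perC ht).mul (hq1.perC ht)) ((hf1.perC ht).mul (hqt.perC ht))]
    exact defect_congr (fun x => dt_mul hS hf1.smooth hq1.smooth ht x) α
  rw [e2]
  simp only [defectOp, mixedOp]
  ring

theorem dt_delta_equation (hz : SmP S 4 z) {t : ℝ} (ht : t ∈ S) (α : ℝ) :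
    dt (dt (dt (delta z))) t α + Complex.I * a t α * da (dt (delta z)) t α -
      Real.pi * dt (delta z) t α = N2 z a t α := by
  have hS := h.isOpen
  have hγ := h.isSmoothParam ht
  have hz2 := hz.of_le (m := 2) (by norm_num)
  have hδ : SmP S 3 (delta z) := h.smP_delta hz
  have hδ1 := hδ.of_le (m := 1) (by norm_num)
  have hδtt : SmP S 1 (dt (dt (delta z))) := (hδ.dt hS : SmP S 2 _).dt hS
  have hδa : SmP S 1 (da (delta z)) := (hδ.da hS : SmP S 2 _).of_le (by norm_num)
  have hE1 : SmP S 2 (E z z) := (h.smP_E hz hz : SmP S 3 _).of_le (by norm_num)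
  have hE2 : SmP S 2 (E z (eps z)) := (h.smP_E hz hz.eps : SmP S 3 _).of_le (by norm_num)
  have ha : Sm S 1 (fun s x => (a s x : ℂ)) :=
    Complex.ofRealCLM.contDiff.comp_contDiffOn (h.contDiffOn_coefficient hz)
  have hM1 : SmP S 1 (mixedOp z (E z z) (eps z)) :=
    h.sm_mixedOp hz2 hE1 (h.smP_eps.of_le (by norm_num))
  have hA : SmP S 1 (defectOp z (E z (eps z))) := h.sm_defectOp hz2 hE2
  have c : ∀ {k : ℂ} {f : ℝ → ℝ → ℂ}, Sm S 1 f → Sm S 1 (fun s x => k * f s x) := fun hf =>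
    (Sm.const _).mul hf
  have hJ1 := h.sm_J1
  have hJ2 := h.sm_J2
  -- The equation for δ is recorded as an identity of functions of time, with M(z_t, z_t z̄)
  -- replaced by J₁, so that both sides can be differentiated.
  have e1 : ∀ s ∈ S, ∀ x, (dt (dt (delta z)) +
      (fun r y => Complex.I * ((fun s x => (a s x : ℂ)) * da (delta z)) r y) -
        fun r y => Real.pi * delta z r y) s x =
      ((fun r y => (Real.pi / 2 : ℂ) * mixedOp z (E z z) (eps z) r y) +
        (fun r y => (Real.pi / 2 : ℂ) * defectOp z (E z (eps z)) r y) +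
        (fun r y => 2 / (Real.pi * Complex.I) * J1 z r y) -
        fun r y => 1 / (Real.pi * Complex.I) * J2 z r y) s x := by
    intro s hs x
    have h1 := h.delta_equation hs x
    have h2 := (J1_eq (h.isSmoothParam hs) (h.ne_zero hs) (h.smP_dt.perC hs)
      (h.defect_conj_dt hs) x).2
    rw [← h2] at h1
    simp only [Pi.add_apply, Pi.sub_apply, Pi.mul_apply, mixedOp, defectOp]
    linear_combination h1
  have e2 := dt_congr hS e1 ht α
  rw [dt_sub hS (hδtt.smooth.add (c (ha.mul hδa.smooth))) (c hδ1.smooth) ht,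
    dt_add hS hδtt.smooth (c (ha.mul hδa.smooth)) ht, dt_const_mul hS (ha.mul hδa.smooth) ht,
    dt_mul hS ha hδa.smooth ht, dt_const_mul hS hδ1.smooth ht,
    dt_sub hS (((c hM1.smooth).add (c hA.smooth)).add (c hJ1)) (c hJ2) ht,
    dt_add hS ((c hM1.smooth).add (c hA.smooth)) (c hJ1) ht,
    dt_add hS (c hM1.smooth) (c hA.smooth) ht, dt_const_mul hS hM1.smooth ht,
    dt_const_mul hS hA.smooth ht, dt_const_mul hS hJ1 ht, dt_const_mul hS hJ2 ht,
    h.dt_mixedOp_eps hz hE1 ht, dt_defectOp hS h.curve hz2 hE2 ht,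
    hδ.smooth.of_le (m := 2) (by norm_num) |>.dt_da hS ht] at e2
  have hE2t : PerC 1 (dt (E z (eps z)) t) := (hE2.dt hS : SmP S 1 _).perC ht
  have e3 := H_eq hγ (f := dt (E z (eps z))) hE2t α
  have e4 := comm_H_div hγ (f := dt z) (g := E z (eps z))
    ((h.smP_dt.perC ht).of_le (by norm_num)) (hE2.perC ht) α
  rw [N2, Pi.sub_apply, Pi.sub_apply, e3, e4]
  simp only [defectOp, mixedOp] at e2
  linear_combination e2

end IsRegularSolution

end EulerPoisson

end

/-! ### Assembly of the theorem -/

theorem mainTheorem5 (S : Set ℝ) (hS : IsOpen S) (z : ℝ → ℝ → ℂ) (a : ℝ → ℝ → ℝ)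
    (hreg : ContDiffOn ℝ 3 (fun p : ℝ × ℝ => z p.1 p.2) (S ×ˢ Set.univ))
    (hsol : EulerPoisson.IsSolution S z a)
    (harea : ∀ t ∈ S, MeasureTheory.volume (EulerPoisson.enclosedRegion (z t))
      = ENNReal.ofReal Real.pi)
    (horigin : ∀ t ∈ S, (0 : ℂ) ∈ EulerPoisson.enclosedRegion (z t)) :
    -- all principal values and integrals below converge
    (∀ t ∈ S, ∀ f : ℝ → ℝ → ℂ, ContDiff ℝ 1 (f t) → Function.Periodic (f t) (2 * Real.pi) →
      ∀ α, EulerPoisson.PVExists (EulerPoisson.hilbertKernel z f t α) α ∧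
        EulerPoisson.PVExists (EulerPoisson.hilbertBarKernel z f t α) α ∧
        EulerPoisson.PVExists (EulerPoisson.E1Kernel z f t α) α ∧
        EulerPoisson.PVExists (EulerPoisson.E2Kernel z f t α) α ∧
        EulerPoisson.PVExists (EulerPoisson.E3Kernel z f t α) α) ∧
    (∀ t ∈ S, ∀ α,
      IntervalIntegrable (EulerPoisson.J1Integrand z t α) MeasureTheory.volume 0 (2 * Real.pi) ∧
      IntervalIntegrable (EulerPoisson.J2Integrand z t α) MeasureTheory.volume 0 (2 * Real.pi)) ∧
    -- the derivatives in the first equation exist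
    ContDiffOn ℝ 2 (fun p : ℝ × ℝ => EulerPoisson.delta z p.1 p.2) (S ×ˢ Set.univ) ∧
    ContDiffOn ℝ 1 (fun p : ℝ × ℝ => EulerPoisson.E z z p.1 p.2) (S ×ˢ Set.univ) ∧
    ContDiffOn ℝ 1 (fun p : ℝ × ℝ => EulerPoisson.E z (EulerPoisson.eps z) p.1 p.2)
      (S ×ˢ Set.univ) ∧
    -- the equation for `δ`
    (∀ t ∈ S, ∀ α,
      EulerPoisson.dt (EulerPoisson.dt (EulerPoisson.delta z)) t α
        + Complex.I * a t α * EulerPoisson.da (EulerPoisson.delta z) t α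
        - Real.pi * EulerPoisson.delta z t α = EulerPoisson.N1 z t α) ∧
    -- the explicit form of the commutator in `N1`
    (∀ t ∈ S, ∀ α,
      EulerPoisson.comm (EulerPoisson.dt z) (EulerPoisson.Hsum z)
          (EulerPoisson.da (EulerPoisson.dt z * EulerPoisson.bar z)) t α
        = -(1 / (Real.pi * Complex.I)) * EulerPoisson.J1 z t α) ∧
    -- the equation for `∂_t δ`, with one more derivative on `z`
    (ContDiffOn ℝ 4 (fun p : ℝ × ℝ => z p.1 p.2) (S ×ˢ Set.univ) →
      ContDiffOn ℝ 3 (fun p : ℝ × ℝ => EulerPoisson.delta z p.1 p.2) (S ×ˢ Set.univ) ∧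
      ContDiffOn ℝ 1 (fun p : ℝ × ℝ => a p.1 p.2) (S ×ˢ Set.univ) ∧
      ContDiffOn ℝ 2 (fun p : ℝ × ℝ => EulerPoisson.E z z p.1 p.2) (S ×ˢ Set.univ) ∧
      ContDiffOn ℝ 2 (fun p : ℝ × ℝ => EulerPoisson.E z (EulerPoisson.eps z) p.1 p.2)
        (S ×ˢ Set.univ) ∧
      (∀ α, DifferentiableOn ℝ (fun t => EulerPoisson.J1 z t α) S ∧
        DifferentiableOn ℝ (fun t => EulerPoisson.J2 z t α) S) ∧
      ∀ t ∈ S, ∀ α,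
        EulerPoisson.dt (EulerPoisson.dt (EulerPoisson.dt (EulerPoisson.delta z))) t α
          + Complex.I * a t α
            * EulerPoisson.da (EulerPoisson.dt (EulerPoisson.delta z)) t α
          - Real.pi * EulerPoisson.dt (EulerPoisson.delta z) t α
          = EulerPoisson.N2 z a t α) := by
  have h : EulerPoisson.IsRegularSolution S z a := ⟨hsol, hS, hreg, harea, horigin⟩
  refine ⟨fun t ht f hf hp α => ?_, fun t ht α => ?_, ?_, ?_, ?_, fun t ht α => ?_,
    fun t ht α => ?_, fun hreg4 => ?_⟩
  · have hγ := h.isSmoothParam ht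
    have hf1 : EulerPoisson.PerC 1 (f t) := ⟨hf, hp⟩
    obtain ⟨_, h1⟩ := EulerPoisson.exists_hasPV_E1Kernel hγ (h.ne_zero ht) hf1 α
    obtain ⟨_, h2⟩ := EulerPoisson.exists_hasPV_E2Kernel hγ (h.ne_zero ht) hf1 α
    obtain ⟨_, h3⟩ := EulerPoisson.exists_hasPV_E3Kernel hγ (h.ne_zero ht) hf1 α
    exact ⟨(EulerPoisson.hasPV_hilbertKernel hγ hf1 α).exists,
      (EulerPoisson.hasPV_hilbertBarKernel hγ hf1 α).exists, h1.exists, h2.exists, h3.exists⟩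
  · exact ⟨(EulerPoisson.J1_eq (h.isSmoothParam ht) (h.ne_zero ht) (h.smP_dt.perC ht)
      (h.defect_conj_dt ht) α).1,
      (EulerPoisson.J2_eq (h.isSmoothParam ht) (h.smP_dt.perC ht) α).1⟩
  · exact (h.smP_delta h.smP).smooth
  · exact ((h.smP_E h.smP h.smP : EulerPoisson.SmP S 2 _).of_le (m := 1) (by norm_num)).smooth
  · exact ((h.smP_E h.smP h.smP_eps : EulerPoisson.SmP S 2 _).of_le (m := 1) (by norm_num)).smooth
  · rw [h.delta_equation ht, h.N1_eq ht]
  · rw [h.comm_Hsum_eq ht, h.J1_eq_mixedOp ht, neg_mul, ← mul_assoc,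
      one_div_mul_cancel EulerPoisson.pi_mul_I_ne_zero, one_mul]
    rfl
  · have hz : EulerPoisson.SmP S 4 z := ⟨hreg4, h.smP.per⟩
    refine ⟨(h.smP_delta hz).smooth, h.contDiffOn_coefficient hz,
      ((h.smP_E hz hz : EulerPoisson.SmP S 3 _).of_le (m := 2) (by norm_num)).smooth,
      ((h.smP_E hz hz.eps : EulerPoisson.SmP S 3 _).of_le (m := 2) (by norm_num)).smooth,
      fun α => ⟨fun t ht => ?_, fun t ht => ?_⟩, fun t ht α => h.dt_delta_equation hz ht α⟩
    · exact (h.sm_J1.hasDerivAt_dt hS le_rfl ht α).differentiableAt.differentiableWithinAt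
    · exact (h.sm_J2.hasDerivAt_dt hS le_rfl ht α).differentiableAt.differentiableWithinAt
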